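/- **Setting.** Let $H$ be a real Hilbert space, $\mathbf X$ a locally compact Polish space, $\nu$ a Borel measure on $\mathbf X$ that is finite on compact sets, $T>0$, $\mathbf X_T=[0,T]\times\mathbf X$, $\nu_T=\lambda_T\otimes\nu$ with $\lambda_T$ Lebesgue measure on $[0,T]$, and $x_0\in H$. Assume: 1. $A:D(A)\subseteq H\to H$ is a closed, densely defined linear operator that generates a $C_0$-semigroup $(S(t))_{t\ge0}$ on $H$, and there is $\lambda>0$ with $\|S(t)\|\le e^{\lambda t}$ for all $t\ge 0$. 2. $f:H\to H$ is demicontinuous ($x_n\to x$ strongly implies $f(x_n)\to f(x)$ weakly); there is $C>0$ with $\|f(x)\|\le C(1+\|x\|)$ for all $x$; and there is $M\ge0$ with $\langle f(x)-f(y),x-y\rangle\le M\|x-y\|^2$ for all $x,y\in H$. 3. $G:[0,T]\times H\times\mathbf X\to H$ is such that $(t,v)\mapsto G(t,x,v)$ is ($\nu_T$-a.e. strongly) measurable for every $x\in H$, and there is $M\ge0$ with $\int_{\mathbf X}\|G(t,x,v)-G(t,y,v)\|^2\,\nu(dv)\le M\|x-y\|^2$ for all $t\in[0,T]$ and $x,y\in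 H$. 4. Put $\|G(t,v)\|_0=\sup_{x\in H}\frac{\|G(t,x,v)\|}{1+\|x\|}$ and $\|G(t,v)\|_1=\sup_{x\ne y}\frac{\|G(t,x,v)-G(t,y,v)\|}{\|x-y\|}$. For $i=0,1$ the function $(t,v)\mapsto\|G(t,v)\|_i$ is $\nu_T$-measurable and $\int_{\mathbf X_T}\|G(t,v)\|_i^2\,d\nu_T<\infty$; and there is $\delta>0$ such that $\int_E e^{\delta\|G(t,v)\|_i^2}\,d\nu_T<\infty$ for $i=0,1$ and every Borel set $E\subseteq\mathbf X_T$ with $\nu_T(E)<\infty$. For measurable $g:\mathbf X_T\to[0,\infty)$ let $L_T(g)=\int_{\mathbf X_T}l(g)\,d\nu_T$, where $l(r)=r\log r-r+1$ and $l(0)=1$. For $N\ge0$ let $S^N=\{g: L_T(g)\le N\}$, and let $\mathbb S=\bigcup_N S^N$. **Theorem.** For every $g\in\mathbb S$ there is exactly one $X^g\in C([0,T];H)$ such that for all $t\in[0,T]$ $$X^g_t=S(t)x_0+\int_0^tS(t-s)f(X^g_s)\,ds+\int_0^tS(t-s)\int_{\mathbf X}G(s,X^g_s,v)\,(g(s,v)-1)\,\nu(dv)\,ds$$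 (with integrable integrands $f(X^g_s)$ on $[0,T]$ and $G(s,X^g_s,v)(g(s,v)-1)$ on $\mathbf X_T$). Write $\mathcal G^0(g)=X^g$. Then for every real $N\ge 0$ the set $$K_N=\{\mathcal G^0(g):g\in S^N\}$$ is compact in $C([0,T];H)$ with the uniform norm. Moreover, the function $I(\phi)=\inf\{L_T(g):g\in\mathbb S,\ \mathcal G^0(g)=\phi\}$ (with $\inf\varnothing=\infty$) on $C([0,T];H)$ is a good rate function: it is lower semicontinuous, and $\{\phi: I(\phi)\le a\}$ is compact for every $a\in[0,\infty)$. -/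

import Mathlib

open MeasureTheory Set Filter Topology
open scoped NNReal ENNReal

noncomputable section

namespace LevySkeleton

/-! ### Semigroup and drift -/

section Operators

variable {H : Type*} [NormedAddCommGroup H] [InnerProductSpace ℝ H]

/-- `S` (restricted to times `t ≥ 0`) is a strongly continuous semigroup of bounded operators. -/
structure IsC0Semigroup (S : ℝ → H →L[ℝ] H) : Prop where
  zero : S 0 = ContinuousLinearMap.id ℝ H
  add : ∀ s t : ℝ, 0 ≤ s → 0 ≤ t → S (s + t) = (S s).comp (S t)
  tendsto_zero : ∀ x : H, Tendsto (fun t => S t x) (𝓝[>] 0) (𝓝 x)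

/-- The (possibly unbounded) operator `A` is the infinitesimal generator of `S`: its domain consists
of all `x` for which `(S t x - x) / t` converges as `t ↓ 0`, and `A x` is that limit. -/
def IsGenerator (A : H →ₗ.[ℝ] H) (S : ℝ → H →L[ℝ] H) : Prop :=
  ∀ x y : H, (x, y) ∈ A.graph ↔ Tendsto (fun t : ℝ => t⁻¹ • (S t x - x)) (𝓝[>] 0) (𝓝 y)

/-- `f` maps strongly convergent sequences to weakly convergent sequences. -/
def Demicontinuous (f : H → H) : Prop :=
  ∀ (u : ℕ → H) (x : H), Tendsto u atTop (𝓝 x) →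
    ∀ y : H, Tendsto (fun n => inner ℝ (f (u n)) y) atTop (𝓝 (inner ℝ (f x) y))

end Operators

/-! ### The jump coefficient -/

section Jump

variable {H : Type*} [NormedAddCommGroup H] {X : Type*}

/-- `‖G(t,v)‖₀ = sup_x ‖G(t,x,v)‖ / (1 + ‖x‖)`, with values in `[0,∞]`. -/
def growthNorm (G : ℝ → H → X → H) (p : ℝ × X) : ℝ≥0∞ :=
  ⨆ x : H, ENNReal.ofReal (‖G p.1 x p.2‖ / (1 + ‖x‖))

/-- `‖G(t,v)‖₁ = sup_{x ≠ y} ‖G(t,x,v) - G(t,y,v)‖ / ‖x - y‖`, with values in `[0,∞]`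
(a pair with `x = y` contributes `0 / 0 = 0`). -/
def lipNorm (G : ℝ → H → X → H) (p : ℝ × X) : ℝ≥0∞ :=
  ⨆ (x : H) (y : H), ENNReal.ofReal (‖G p.1 x p.2 - G p.1 y p.2‖ / ‖x - y‖)

variable [MeasurableSpace X]

/-- `ν_T = λ_T ⊗ ν`, where `λ_T` is Lebesgue measure on `[0,T]`. -/
def nuT (T : ℝ) (ν : Measure X) : Measure (ℝ × X) :=
  (volume.restrict (Icc 0 T)).prod ν

/-- `∫_E exp(δ h²) dν_T < ∞` for every Borel set `E ⊆ [0,T] × X` with `ν_T(E) < ∞`. -/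
def ExpSqIntegrable (T : ℝ) (ν : Measure X) (δ : ℝ) (h : ℝ × X → ℝ≥0∞) : Prop :=
  ∀ E : Set (ℝ × X), MeasurableSet E → E ⊆ Icc 0 T ×ˢ univ → nuT T ν E < ∞ →
    ∫⁻ p in E, EReal.exp ((δ : EReal) * ((h p ^ 2 : ℝ≥0∞) : EReal)) ∂(nuT T ν) < ∞

end Jump

/-! ### Controls -/

section Controls

variable {X : Type*} [MeasurableSpace X]

/-- `L_T(g) = ∫_{[0,T] × X} l(g) dν_T` with `l(r) = r log r - r + 1`. -/
def cost (T : ℝ) (ν : Measure X) (g : ℝ × X → ℝ≥0) : ℝ≥0∞ :=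
  ∫⁻ p, ENNReal.ofReal (InformationTheory.klFun (g p)) ∂(nuT T ν)

/-- `S^N`: the controls `g` with `L_T(g) ≤ N` (only the values on `[0,T] × X` matter). -/
def controlBall (T : ℝ) (ν : Measure X) (N : ℝ≥0) : Set (ℝ × X → ℝ≥0) :=
  {g | Measurable g ∧ cost T ν g ≤ N}

/-- `𝕊 = ⋃_N S^N`: the controls of finite cost. -/
def controls (T : ℝ) (ν : Measure X) : Set (ℝ × X → ℝ≥0) :=
  ⋃ N : ℝ≥0, controlBall T ν N

end Controls

/-! ### The skeleton equation, its solution map and the rate function -/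

section Skeleton

variable {H : Type*} [NormedAddCommGroup H] [InnerProductSpace ℝ H] {X : Type*}
  [MeasurableSpace X]

/-- `φ ∈ C([0,T];H)` solves the skeleton equation with control `g`: the data are integrable along
`φ`, and for all `t ∈ [0,T]`
`φ(t) = S(t)x₀ + ∫₀ᵗ S(t-s) f(φ(s)) ds + ∫₀ᵗ S(t-s) ∫_X G(s,φ(s),v)(g(s,v)-1) ν(dv) ds`. -/
structure IsSkeletonSolution {T : ℝ} (hT : 0 < T) (ν : Measure X) (S : ℝ → H →L[ℝ] H)
    (f : H → H) (G : ℝ → H → X → H) (x₀ : H) (g : ℝ × X → ℝ≥0) (φ : C(Icc (0 : ℝ) T, H)) :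
    Prop where
  integrable_drift :
    IntegrableOn (fun s => f (IccExtend hT.le φ s)) (Icc 0 T)
  integrable_jump :
    Integrable (fun p : ℝ × X => ((g p : ℝ) - 1) • G p.1 (IccExtend hT.le φ p.1) p.2) (nuT T ν)
  eq : ∀ t : Icc (0 : ℝ) T,
    φ t = S t x₀ + (∫ s in (0 : ℝ)..t, S (t - s) (f (IccExtend hT.le φ s)))
      + ∫ s in (0 : ℝ)..t,
          S (t - s) (∫ v, ((g (s, v) : ℝ) - 1) • G s (IccExtend hT.le φ s) v ∂ν)

open Classical in
/-- `𝒢⁰(g)`: the solution of the skeleton equation with control `g` (and `0` if there is none). -/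
def skeletonMap {T : ℝ} (hT : 0 < T) (ν : Measure X) (S : ℝ → H →L[ℝ] H)
    (f : H → H) (G : ℝ → H → X → H) (x₀ : H) (g : ℝ × X → ℝ≥0) : C(Icc (0 : ℝ) T, H) :=
  if h : ∃ φ, IsSkeletonSolution hT ν S f G x₀ g φ then h.choose else 0

/-- `I(φ) = inf {L_T(g) : g ∈ 𝕊, 𝒢⁰(g) = φ}`, which is `∞` if there is no such `g`. -/
def rateFunction {T : ℝ} (hT : 0 < T) (ν : Measure X) (S : ℝ → H →L[ℝ] H)
    (f : H → H) (G : ℝ → H → X → H) (x₀ : H) (φ : C(Icc (0 : ℝ) T, H)) : ℝ≥0∞ :=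
  ⨅ (g : ℝ × X → ℝ≥0) (_ : g ∈ controls T ν ∧ φ = skeletonMap hT ν S f G x₀ g), cost T ν g

end Skeleton

/-- A lower semicontinuous `I : E → [0,∞]` all of whose finite level sets are compact. -/
def IsGoodRateFunction {E : Type*} [TopologicalSpace E] (I : E → ℝ≥0∞) : Prop :=
  LowerSemicontinuous I ∧ ∀ a : ℝ≥0, IsCompact {x | I x ≤ a}

end LevySkeleton

end

/-!
The skeleton equation is a mild equation `u t = S t x₀ + ∫₀ᵗ S (t-s) F (s, u s) ds`, whose drift
`F (s, x) = f x + ∫ (g (s, v) - 1) G (s, x, v) ν(dv)` is one-sided Lipschitz with a rate in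
`L¹(0, T)`.

*Mild equations* (`IsMonoDrift`). Since `‖S t‖ ≤ e^{lt}`, a mild solution with forcing `h`
satisfies the energy inequality `‖u t‖² ≤ ‖x‖² + ∫₀ᵗ (2l ‖u‖² + 2 ⟪u, h⟫)`
(`IsC0Semigroup.energy`). Together with Gronwall's inequality it yields a stability estimate
(`IsMonoDrift.norm_sub_sq_le`): if `uᵢ` solves the equation with the drift evaluated along a path
`yᵢ` that is uniformly close to `uᵢ`, for `i = 1, 2`, then `u₁` and `u₂` are uniformly close. The
estimate is used three times. It gives uniqueness. It gives existence, since the solutions `u` of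
the equation in which the drift is evaluated at `S δ (u (t-δ))`, which can be solved step by step,
form a Cauchy sequence as `δ → 0`; their limit is a solution because the drift is demicontinuous.
And it gives continuity in the control, as explained below.

*Controls*. Young's inequality `a |b - 1| ≤ (e^a - 1 - a) + l(b)`, `a ≥ 0`, pairs the controls of finite
cost with the functions `Ψ` all of whose multiples have integrable `e^{c‖Ψ‖} - 1 - c‖Ψ‖`
(`MemOrliczHeart`). The hypotheses on `G` place `(s, v) ↦ G (s, φ s, v)` in this class for every
continuous `φ`; in particular the rate of the drift is in `L¹`, with a norm bounded over `S^N`. The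
set `S^N` is compact for the topology of testing against this class
(`exists_weak_limit_entropyBall`): the truncations `min (g - 1) m` are bounded in `L²`, so that
they have weak limits along an ultrafilter, which increase with `m` to a limit control, and the
cost is lower semicontinuous by its dual form.

*Compactness* (`IsJumpCoeff.isCompact_image_skeletonMap`). If `g' → g` weakly in `S^N`, then the
jump convolutions along the fixed path `𝒢⁰(g)` converge uniformly in time, as they are
equicontinuous uniformly over `S^N`. So `𝒢⁰(g)` solves the equation with control `g'` up to a small
error, and the stability estimate shows that `𝒢⁰(g')` tends to `𝒢⁰(g)`. Thus `K_N` is compact as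
the continuous image of a compact set. The level sets of the rate function are
`{I ≤ a} = ⋂_{N > a} K_N` (`setOf_rateFunction_le`), which makes it good.
-/

namespace LevySkeleton

/-! ### Quasi-contractive semigroups and mild convolutions -/

section Semigroup

variable {H : Type*} [NormedAddCommGroup H] [InnerProductSpace ℝ H]
  {S : ℝ → H →L[ℝ] H} {l : ℝ}

theorem norm_semigroup_apply_le (hb : ∀ t : ℝ, 0 ≤ t → ‖S t‖ ≤ Real.exp (l * t)) {t : ℝ}
    (ht : 0 ≤ t) (x : H) : ‖S t x‖ ≤ Real.exp (l * t) * ‖x‖ :=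
  ((S t).le_opNorm x).trans (by gcongr; exact hb t ht)

theorem norm_semigroup_apply_le_of_le (hl : 0 ≤ l)
    (hb : ∀ t : ℝ, 0 ≤ t → ‖S t‖ ≤ Real.exp (l * t)) {t R : ℝ} (ht : 0 ≤ t) (htR : t ≤ R) (x : H) :
    ‖S t x‖ ≤ Real.exp (l * R) * ‖x‖ :=
  (norm_semigroup_apply_le hb ht x).trans (by gcongr)

theorem IsC0Semigroup.norm_sub_le (hS : IsC0Semigroup S) (hl : 0 ≤ l)
    (hb : ∀ t : ℝ, 0 ≤ t → ‖S t‖ ≤ Real.exp (l * t)) {a b R : ℝ} (ha : 0 ≤ a) (hb0 : 0 ≤ b)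
    (haR : a ≤ R) (hbR : b ≤ R) (x : H) :
    ‖S a x - S b x‖ ≤ Real.exp (l * R) * ‖S |a - b| x - x‖ := by
  wlog hab : a ≤ b generalizing a b
  · rw [norm_sub_rev, abs_sub_comm]
    exact this hb0 ha hbR haR (le_of_not_ge hab)
  have h1 : S b x = S a (S (b - a) x) := by
    rw [← ContinuousLinearMap.comp_apply, ← hS.add a (b - a) ha (by linarith)]
    congr 2; ring
  rw [h1, ← map_sub, abs_sub_comm, abs_of_nonneg (by linarith : 0 ≤ b - a),
    norm_sub_rev (S (b - a) x) x]
  exact norm_semigroup_apply_le_of_le hl hb ha haR _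

/-- The orbit map, extended by `S 0` to negative times, is jointly continuous. -/
theorem IsC0Semigroup.continuous_extend (hS : IsC0Semigroup S) (hl : 0 ≤ l)
    (hb : ∀ t : ℝ, 0 ≤ t → ‖S t‖ ≤ Real.exp (l * t)) :
    Continuous fun p : ℝ × H => S (max p.1 0) p.2 := by
  rw [continuous_iff_continuousAt]
  rintro ⟨r, x⟩
  rw [ContinuousAt, tendsto_iff_norm_sub_tendsto_zero]
  set R := |r| + 1
  have h0 : Tendsto (fun t => S |t| x - x) (𝓝 0) (𝓝 0) := by
    have h2 : Tendsto (fun t => S t x) (𝓝[≥] 0) (𝓝 x) := by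
      have : (𝓝[≥] (0:ℝ)) = pure 0 ⊔ 𝓝[>] 0 := by
        rw [← nhdsWithin_singleton, ← nhdsWithin_union, singleton_union, Ioi_insert]
      rw [this]
      refine Tendsto.sup ?_ (hS.tendsto_zero x)
      rw [tendsto_pure_left]
      intro s hs
      simpa [hS.zero] using mem_of_mem_nhds hs
    have h3 : Tendsto (fun t : ℝ => |t|) (𝓝 0) (𝓝[≥] 0) := by
      refine tendsto_nhdsWithin_iff.2 ⟨?_, Eventually.of_forall fun t => abs_nonneg t⟩
      simpa using (continuous_abs.tendsto (0:ℝ))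
    simpa using (h2.comp h3).sub_const x
  have h4 : Tendsto (fun p : ℝ × H => Real.exp (l * R) * ‖p.2 - x‖
      + Real.exp (l * R) * ‖S |max p.1 0 - max r 0| x - x‖) (𝓝 (r, x)) (𝓝 0) := by
    have h5 : Tendsto (fun p : ℝ × H => max p.1 0 - max r 0) (𝓝 (r, x)) (𝓝 0) := by
      have : Continuous fun p : ℝ × H => max p.1 0 - max r 0 := by fun_prop
      simpa using this.tendsto (r, x)
    have h6 : Tendsto (fun p : ℝ × H => p.2 - x) (𝓝 (r, x)) (𝓝 0) := by
      have : Continuous fun p : ℝ × H => p.2 - x := by fun_prop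
      simpa using this.tendsto (r, x)
    have := (h6.norm.const_mul (Real.exp (l * R))).add
      ((h0.comp h5).norm.const_mul (Real.exp (l * R)))
    simpa using this
  refine squeeze_zero' (Eventually.of_forall fun _ => norm_nonneg _) ?_ h4
  have h7 : ∀ᶠ p : ℝ × H in 𝓝 (r, x), |p.1| < R := by
    have : Continuous fun p : ℝ × H => |p.1| := by fun_prop
    exact this.tendsto (r, x) |>.eventually_lt_const (by simp [R])
  filter_upwards [h7] with p hp
  have hR : 0 ≤ R := by positivity
  have e : S (max p.1 0) p.2 - S (max r 0) x
      = S (max p.1 0) (p.2 - x) + (S (max p.1 0) x - S (max r 0) x) := by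
    rw [map_sub]; abel
  have hm1 : max p.1 0 ≤ R := max_le ((le_abs_self _).trans hp.le) hR
  have hm2 : max r 0 ≤ R := max_le ((le_abs_self _).trans (by simp [R])) hR
  rw [e]
  refine (norm_add_le _ _).trans (add_le_add ?_ ?_)
  · exact norm_semigroup_apply_le_of_le hl hb (le_max_right _ _) hm1 _
  · exact hS.norm_sub_le hl hb (le_max_right _ _) (le_max_right _ _) hm1 hm2 x

variable {T : ℝ}

theorem IsC0Semigroup.aestronglyMeasurable_apply (hS : IsC0Semigroup S) (hl : 0 ≤ l)
    (hb : ∀ t : ℝ, 0 ≤ t → ‖S t‖ ≤ Real.exp (l * t)) {α : Type*} [MeasurableSpace α]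
    {μ : Measure α} {r : α → ℝ} (hr : AEStronglyMeasurable r μ) {h : α → H}
    (hh : AEStronglyMeasurable h μ) : AEStronglyMeasurable (fun s => S (max (r s) 0) (h s)) μ :=
  (hS.continuous_extend hl hb).comp_aestronglyMeasurable (hr.prodMk hh)

theorem IsC0Semigroup.integrableOn_extend (hS : IsC0Semigroup S) (hl : 0 ≤ l)
    (hb : ∀ t : ℝ, 0 ≤ t → ‖S t‖ ≤ Real.exp (l * t)) {h : ℝ → H}
    (hh : IntegrableOn h (Icc 0 T)) (t : ℝ) :
    IntegrableOn (fun s => S (max (t - s) 0) (h s)) (Icc 0 T) := by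
  refine Integrable.mono' (hh.norm.const_mul (Real.exp (l * max t 0)))
    (hS.aestronglyMeasurable_apply hl hb
      (by fun_prop : Continuous fun s : ℝ => t - s).aestronglyMeasurable hh.aestronglyMeasurable) ?_
  filter_upwards [ae_restrict_mem measurableSet_Icc] with s hs
  exact norm_semigroup_apply_le_of_le hl hb (le_max_right _ _)
    (max_le_max_right _ (by linarith [hs.1])) _

theorem IsC0Semigroup.intervalIntegrable_apply (hS : IsC0Semigroup S) (hl : 0 ≤ l)
    (hb : ∀ t : ℝ, 0 ≤ t → ‖S t‖ ≤ Real.exp (l * t)) {h : ℝ → H}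
    (hh : IntegrableOn h (Icc 0 T)) {a b t : ℝ} (ha : 0 ≤ a) (hab : a ≤ b) (hbt : b ≤ t)
    (htT : t ≤ T) : IntervalIntegrable (fun s => S (t - s) (h s)) volume a b := by
  rw [intervalIntegrable_iff_integrableOn_Ioc_of_le hab]
  have h1 := (hS.integrableOn_extend hl hb hh t).mono_set
    (show Ioc a b ⊆ Icc 0 T from fun s hs => ⟨ha.trans hs.1.le, hs.2.trans (hbt.trans htT)⟩)
  refine h1.congr_fun (fun s hs => ?_) measurableSet_Ioc
  have : max (t - s) 0 = t - s := max_eq_left (by linarith [hs.2])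
  simp only [this]

/-- The mild convolution `∫₀ᵗ S(t-s) h(s) ds`. -/
noncomputable def mildConv (S : ℝ → H →L[ℝ] H) (h : ℝ → H) (t : ℝ) : H :=
  ∫ s in (0 : ℝ)..t, S (t - s) (h s)

/-- Over the fixed domain `[0, T]` the dependence on `t` sits in the integrand, so that dominated
convergence applies. -/
theorem mildConv_eq_setIntegral (h : ℝ → H) {t : ℝ} (ht : t ∈ Icc 0 T) :
    mildConv S h t
      = ∫ s in Icc 0 T, (Iic t).indicator (fun s => S (max (t - s) 0) (h s)) s := by
  rw [mildConv, intervalIntegral.integral_of_le ht.1, integral_indicator measurableSet_Iic,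
    Measure.restrict_restrict measurableSet_Iic,
    show Iic t ∩ Icc 0 T = Icc 0 t by ext s; simp; grind, integral_Icc_eq_integral_Ioc]
  refine setIntegral_congr_fun measurableSet_Ioc fun s hs => ?_
  have : max (t - s) 0 = t - s := max_eq_left (by linarith [hs.2])
  simp only [this]

theorem IsC0Semigroup.continuousOn_mildConv (hS : IsC0Semigroup S) (hl : 0 ≤ l)
    (hb : ∀ t : ℝ, 0 ≤ t → ‖S t‖ ≤ Real.exp (l * t)) {h : ℝ → H}
    (hh : IntegrableOn h (Icc 0 T)) : ContinuousOn (mildConv S h) (Icc 0 T) := by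
  refine ContinuousOn.congr (f := fun t => ∫ s in Icc 0 T,
    (Iic t).indicator (fun s => S (max (t - s) 0) (h s)) s) ?_
    (fun t ht => mildConv_eq_setIntegral h ht)
  intro t0 ht0
  refine continuousWithinAt_of_dominated (bound := fun s => Real.exp (l * T) * ‖h s‖)
    ?_ ?_ (hh.norm.const_mul _) ?_
  · exact Eventually.of_forall fun t =>
      (hS.integrableOn_extend hl hb hh t).aestronglyMeasurable.indicator measurableSet_Iic
  · filter_upwards [self_mem_nhdsWithin] with t ht
    filter_upwards [ae_restrict_mem measurableSet_Icc] with s hs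
    refine (norm_indicator_le_norm_self _ _).trans ?_
    exact norm_semigroup_apply_le_of_le hl hb (le_max_right _ _)
      (max_le (by linarith [hs.1, ht.2]) (ht.1.trans ht.2)) _
  · have : ∀ᵐ s ∂(volume.restrict (Icc 0 T)), s ≠ t0 :=
      ae_restrict_of_ae (by simp [ae_iff, measure_singleton])
    filter_upwards [this] with s hs
    refine ContinuousAt.continuousWithinAt ?_
    have hc : Continuous fun t => S (max (t - s) 0) (h s) :=
      (hS.continuous_extend hl hb).comp
        (by fun_prop : Continuous fun t : ℝ => (t - s, h s))
    rcases lt_or_gt_of_ne hs with hlt | hgt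
    · refine hc.continuousAt.congr ?_
      filter_upwards [lt_mem_nhds hlt] with t ht
      rw [indicator_of_mem (mem_Iic.2 ht.le)]
    · refine (continuousAt_const (y := (0:H))).congr ?_
      filter_upwards [gt_mem_nhds hgt] with t ht
      rw [indicator_of_notMem (by simpa using ht)]

theorem norm_integral_semigroup_le (hl : 0 ≤ l)
    (hb : ∀ t : ℝ, 0 ≤ t → ‖S t‖ ≤ Real.exp (l * t)) {h : ℝ → H} {ℓ : ℝ → ℝ}
    (hℓ : IntegrableOn ℓ (Icc 0 T)) (hhℓ : ∀ᵐ s ∂volume.restrict (Icc 0 T), ‖h s‖ ≤ ℓ s)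
    {a t : ℝ} (ha : 0 ≤ a) (hat : a ≤ t) (htT : t ≤ T) :
    ‖∫ s in a..t, S (t - s) (h s)‖ ≤ Real.exp (l * T) * ∫ s in a..t, ℓ s := by
  rw [← intervalIntegral.integral_const_mul]
  have hsub : Ioc a t ⊆ Icc 0 T := fun s hs => ⟨ha.trans hs.1.le, hs.2.trans htT⟩
  refine intervalIntegral.norm_integral_le_of_norm_le hat ?_ ?_
  · rw [ae_restrict_iff' measurableSet_Icc] at hhℓ
    filter_upwards [hhℓ] with s hs hst
    refine (norm_semigroup_apply_le_of_le hl hb (by linarith [hst.2] : 0 ≤ t - s)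
      (by linarith [hst.1] : t - s ≤ T) _).trans ?_
    gcongr
    exact hs (hsub hst)
  · rw [intervalIntegrable_iff_integrableOn_Ioc_of_le hat]
    exact (hℓ.mono_set hsub).const_mul _

variable [CompleteSpace H]

theorem IsC0Semigroup.mildConv_split (hS : IsC0Semigroup S) (hl : 0 ≤ l)
    (hb : ∀ t : ℝ, 0 ≤ t → ‖S t‖ ≤ Real.exp (l * t)) {h : ℝ → H}
    (hh : IntegrableOn h (Icc 0 T)) {a t : ℝ} (ha : 0 ≤ a) (hat : a ≤ t) (htT : t ≤ T) :
    mildConv S h t = S (t - a) (mildConv S h a) + ∫ s in a..t, S (t - s) (h s) := by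
  rw [mildConv, mildConv, ← intervalIntegral.integral_add_adjacent_intervals
    (hS.intervalIntegrable_apply hl hb hh le_rfl ha hat htT)
    (hS.intervalIntegrable_apply hl hb hh ha hat le_rfl htT),
    ← ContinuousLinearMap.intervalIntegral_comp_comm _
      (hS.intervalIntegrable_apply hl hb hh le_rfl ha le_rfl (hat.trans htT))]
  congr 1
  refine intervalIntegral.integral_congr fun s hs => ?_
  rw [uIcc_of_le ha] at hs
  rw [← ContinuousLinearMap.comp_apply, ← hS.add _ _ (by linarith) (by linarith [hs.2])]
  congr 2; ring

end Semigroup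

/-! ### The energy inequality for mild solutions -/

section Energy

variable {H : Type*} [NormedAddCommGroup H] [InnerProductSpace ℝ H] [CompleteSpace H]
  {S : ℝ → H →L[ℝ] H} {l T : ℝ}

omit [CompleteSpace H] in
theorem IsC0Semigroup.continuousOn_mild (hS : IsC0Semigroup S) (hl : 0 ≤ l)
    (hb : ∀ t : ℝ, 0 ≤ t → ‖S t‖ ≤ Real.exp (l * t)) (x : H) {h : ℝ → H}
    (hh : IntegrableOn h (Icc 0 T)) :
    ContinuousOn (fun t => S t x + mildConv S h t) (Icc 0 T) := by
  refine ContinuousOn.add ?_ (hS.continuousOn_mildConv hl hb hh)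
  have hc : Continuous fun t => S (max t 0) x :=
    (hS.continuous_extend hl hb).comp (by fun_prop : Continuous fun t : ℝ => (t, x))
  refine hc.continuousOn.congr fun t ht => ?_
  simp only [max_eq_left ht.1]

theorem IsC0Semigroup.mild_split (hS : IsC0Semigroup S) (hl : 0 ≤ l)
    (hb : ∀ t : ℝ, 0 ≤ t → ‖S t‖ ≤ Real.exp (l * t)) (x : H) {h : ℝ → H}
    (hh : IntegrableOn h (Icc 0 T)) {a t : ℝ} (ha : 0 ≤ a) (hat : a ≤ t) (htT : t ≤ T) :
    S t x + mildConv S h t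
      = S (t - a) (S a x + mildConv S h a) + ∫ s in a..t, S (t - s) (h s) := by
  rw [hS.mildConv_split hl hb hh ha hat htT, map_add, ← ContinuousLinearMap.comp_apply (S (t - a)),
    ← hS.add _ _ (by linarith) ha, sub_add_cancel, add_assoc]

/-- For a continuous forcing term `h`, the average of `S (z - s) (h s)` over `[t, z]` tends to
`h t` as `z ↓ t`. -/
theorem IsC0Semigroup.tendsto_average (hS : IsC0Semigroup S) (hl : 0 ≤ l)
    (hb : ∀ t : ℝ, 0 ≤ t → ‖S t‖ ≤ Real.exp (l * t)) {h : ℝ → H} (hh : Continuous h) (t : ℝ) :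
    Tendsto (fun z => (z - t)⁻¹ • ∫ s in t..z, S (z - s) (h s)) (𝓝[>] t) (𝓝 (h t)) := by
  have hc : Continuous fun p : ℝ × ℝ => S (max (p.1 - p.2) 0) (h p.2) :=
    (hS.continuous_extend hl hb).comp
      (by fun_prop : Continuous fun p : ℝ × ℝ => (p.1 - p.2, h p.2))
  rw [Metric.tendsto_nhds]
  intro ε hε
  have h1 := (hc.tendsto (t, t)).eventually (Metric.ball_mem_nhds _ (half_pos hε))
  simp only [sub_self, max_self, hS.zero, ContinuousLinearMap.id_apply] at h1
  obtain ⟨δ, hδ, hδ'⟩ := Metric.eventually_nhds_iff.1 h1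
  have hmem : Ioo t (t + δ) ∈ 𝓝[>] t := Ioo_mem_nhdsGT (by linarith)
  filter_upwards [hmem] with z hz
  have hzt : 0 < z - t := by linarith [hz.1]
  have hcz : ∀ s ∈ uIcc t z, S (z - s) (h s) = S (max (z - s) 0) (h s) := by
    intro s hs
    rw [uIcc_of_le hz.1.le] at hs
    rw [max_eq_left (by linarith [hs.2])]
  have hint : IntervalIntegrable (fun s => S (max (z - s) 0) (h s)) volume t z :=
    (hc.comp (by fun_prop : Continuous fun s : ℝ => (z, s))).intervalIntegrable _ _
  rw [intervalIntegral.integral_congr hcz]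
  have e : (z - t)⁻¹ • (∫ s in t..z, S (max (z - s) 0) (h s)) - h t
      = (z - t)⁻¹ • ∫ s in t..z, (S (max (z - s) 0) (h s) - h t) := by
    rw [intervalIntegral.integral_sub hint (by simp), intervalIntegral.integral_const, smul_sub,
      smul_smul, inv_mul_cancel₀ hzt.ne', one_smul]
  rw [dist_eq_norm, e, norm_smul, norm_inv, Real.norm_of_nonneg hzt.le]
  have hle : ‖∫ s in t..z, (S (max (z - s) 0) (h s) - h t)‖ ≤ (ε / 2) * |z - t| := by
    refine intervalIntegral.norm_integral_le_of_norm_le_const fun s hs => ?_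
    rw [uIoc_of_le hz.1.le] at hs
    have : dist ((z, s) : ℝ × ℝ) (t, t) < δ := by
      rw [Prod.dist_eq, Real.dist_eq, Real.dist_eq, max_lt_iff, abs_lt, abs_lt]
      constructor <;> constructor <;> linarith [hs.1, hs.2, hz.2, hz.1]
    have := hδ' this
    rw [dist_eq_norm] at this
    exact this.le
  rw [abs_of_pos hzt] at hle
  calc (z - t)⁻¹ * _ ≤ (z - t)⁻¹ * (ε / 2 * (z - t)) := by gcongr
    _ = ε / 2 := by field_simp
    _ < ε := half_lt_self hε

theorem tendsto_exp_slope (c t : ℝ) :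
    Tendsto (fun z => (z - t)⁻¹ * (Real.exp (c * (z - t)) - 1)) (𝓝[>] t) (𝓝 c) := by
  have h1 : HasDerivAt (fun z => Real.exp (c * (z - t))) c t := by
    have := (((hasDerivAt_id t).sub_const t).const_mul c).exp
    simpa using this
  have h2 := (hasDerivAt_iff_tendsto_slope.1 h1).mono_left
    (nhdsWithin_mono t (fun z (hz : t < z) => hz.ne'))
  refine h2.congr fun z => ?_
  simp [slope_def_field, div_eq_inv_mul]

/-- Energy inequality with continuous forcing. The upper right Dini derivative of `‖u‖²` is at most
`2 l ‖u‖² + 2 ⟪u, h⟫`, because `u (t + k) = S k (u t) + ∫ S (t + k - s) (h s)` with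
`‖S k‖ ≤ exp (l k)`. -/
theorem IsC0Semigroup.energy_of_continuous (hS : IsC0Semigroup S) (hl : 0 ≤ l)
    (hb : ∀ t : ℝ, 0 ≤ t → ‖S t‖ ≤ Real.exp (l * t)) (x : H) {h : ℝ → H}
    (hh : Continuous h) {u : ℝ → H} (hu : ∀ t, u t = S t x + mildConv S h t) {t : ℝ}
    (ht : t ∈ Icc 0 T) :
    ‖u t‖ ^ 2 ≤ ‖x‖ ^ 2 + ∫ s in (0 : ℝ)..t, (2 * l * ‖u s‖ ^ 2 + 2 * inner ℝ (u s) (h s)) := by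
  have hT : 0 ≤ T := ht.1.trans ht.2
  have hhi : IntegrableOn h (Icc 0 T) := hh.integrableOn_Icc
  have huc : ContinuousOn u (Icc 0 T) :=
    (hS.continuousOn_mild hl hb x hhi).congr fun t _ => hu t
  set β : ℝ → ℝ := fun s => 2 * l * ‖u s‖ ^ 2 + 2 * inner ℝ (u s) (h s) with hβ
  have hβc : ContinuousOn β (Icc 0 T) := by
    have := hh.continuousOn (s := Icc 0 T)
    exact ((huc.norm.pow 2).const_mul _).add ((ContinuousOn.inner (𝕜 := ℝ) huc this).const_mul 2)
  set β' : ℝ → ℝ := IccExtend hT ((Icc 0 T).domRestrict β) with hβ'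
  have hβ'c : Continuous β' := (continuousOn_iff_continuous_domRestrict.1 hβc).Icc_extend'
  have hββ' : ∀ s ∈ Icc 0 T, β' s = β s := fun s hs => by
    rw [hβ', IccExtend_of_mem _ _ hs]; rfl
  have main := image_le_of_liminf_slope_right_le_deriv_boundary
    (f := fun t => ‖u t‖ ^ 2) (a := 0) (b := T)
    (B := fun t => ‖x‖ ^ 2 + ∫ s in (0 : ℝ)..t, β' s) (B' := β') (huc.norm.pow 2) ?_ ?_ ?_ ?_ ht
  · have e : ∫ s in (0 : ℝ)..t, β' s = ∫ s in (0 : ℝ)..t, β s := by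
      refine intervalIntegral.integral_congr fun s hs => ?_
      rw [uIcc_of_le ht.1] at hs
      exact hββ' s ⟨hs.1, hs.2.trans ht.2⟩
    rw [← e]; exact main
  · simp [hu, mildConv, hS.zero]
  · exact (continuous_const.add
      (intervalIntegral.continuous_primitive (fun a b => hβ'c.intervalIntegrable a b) 0)).continuousOn
  · intro y _
    exact ((hβ'c.integral_hasStrictDerivAt 0 y).hasDerivAt.const_add _).hasDerivWithinAt
  · intro y hy r hr
    rw [hββ' y ⟨hy.1, hy.2.le⟩] at hr
    set J : ℝ → H := fun z => (z - y)⁻¹ • ∫ s in y..z, S (z - s) (h s) with hJ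
    have hJt : Tendsto J (𝓝[>] y) (𝓝 (h y)) := hS.tendsto_average hl hb hh y
    have hSt : Tendsto (fun z => S (z - y) (u y)) (𝓝[>] y) (𝓝 (u y)) := by
      refine (hS.tendsto_zero (u y)).comp (tendsto_nhdsWithin_iff.2 ⟨?_, ?_⟩)
      · have : Continuous fun z : ℝ => z - y := by fun_prop
        simpa using (this.tendsto y).mono_left nhdsWithin_le_nhds
      · filter_upwards [self_mem_nhdsWithin] with z hz
        exact sub_pos.2 (mem_Ioi.1 hz)
    have hz0 : Tendsto (fun z : ℝ => z - y) (𝓝[>] y) (𝓝 0) := by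
      have : Continuous fun z : ℝ => z - y := by fun_prop
      simpa using (this.tendsto y).mono_left nhdsWithin_le_nhds
    have lim : Tendsto (fun z => ((z - y)⁻¹ * (Real.exp (2 * l * (z - y)) - 1)) * ‖u y‖ ^ 2
        + 2 * inner ℝ (S (z - y) (u y)) (J z) + (z - y) * ‖J z‖ ^ 2) (𝓝[>] y) (𝓝 (β y)) := by
      have := (((tendsto_exp_slope (2 * l) y).mul_const (‖u y‖ ^ 2)).add
        ((hSt.inner hJt).const_mul 2)).add (hz0.mul (hJt.norm.pow 2))
      simpa [hβ] using this
    refine Eventually.frequently ?_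
    filter_upwards [lim.eventually_lt_const hr, Ioo_mem_nhdsGT hy.2] with z hz hzT
    refine lt_of_le_of_lt ?_ hz
    have hk : 0 < z - y := sub_pos.2 hzT.1
    have eJ : (∫ s in y..z, S (z - s) (h s)) = (z - y) • J z := by
      rw [hJ]; simp only [smul_smul]; rw [mul_inv_cancel₀ hk.ne', one_smul]
    have eu : u z = S (z - y) (u y) + (z - y) • J z := by
      rw [hu z, hS.mild_split hl hb x hhi hy.1 hzT.1.le hzT.2.le, ← hu y, eJ]
    have hn : ‖S (z - y) (u y)‖ ^ 2 ≤ Real.exp (2 * l * (z - y)) * ‖u y‖ ^ 2 := by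
      have := norm_semigroup_apply_le hb hk.le (u y)
      calc ‖S (z - y) (u y)‖ ^ 2 ≤ (Real.exp (l * (z - y)) * ‖u y‖) ^ 2 := by gcongr
        _ = _ := by rw [mul_pow, ← Real.exp_nat_mul]; push_cast; ring_nf
    rw [slope_def_field, div_eq_inv_mul, eu, norm_add_sq_real, norm_smul, inner_smul_right,
      Real.norm_of_nonneg hk.le, inv_mul_le_iff₀ hk]
    have e3 : (z - y) * (((z - y)⁻¹ * (Real.exp (2 * l * (z - y)) - 1)) * ‖u y‖ ^ 2
        + 2 * inner ℝ (S (z - y) (u y)) (J z) + (z - y) * ‖J z‖ ^ 2)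
        = (Real.exp (2 * l * (z - y)) - 1) * ‖u y‖ ^ 2
        + 2 * ((z - y) * inner ℝ (S (z - y) (u y)) (J z)) + ((z - y) * ‖J z‖) ^ 2 := by
      field_simp
    rw [e3]
    linarith

/-- **Energy inequality** for a mild solution `u t = S t x + ∫₀ᵗ S (t-s) (h s) ds` with integrable
forcing, obtained from the continuous case by approximation in `L¹`. -/
theorem IsC0Semigroup.energy (hS : IsC0Semigroup S) (hl : 0 ≤ l)
    (hb : ∀ t : ℝ, 0 ≤ t → ‖S t‖ ≤ Real.exp (l * t)) (x : H) {h : ℝ → H}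
    (hh : IntegrableOn h (Icc 0 T)) {u : ℝ → H} (hu : ∀ t, u t = S t x + mildConv S h t) {t : ℝ}
    (ht : t ∈ Icc 0 T) :
    ‖u t‖ ^ 2 ≤ ‖x‖ ^ 2 + ∫ s in (0 : ℝ)..t, (2 * l * ‖u s‖ ^ 2 + 2 * inner ℝ (u s) (h s)) := by
  have hT : 0 ≤ T := ht.1.trans ht.2
  have huc : ContinuousOn u (Icc 0 T) :=
    (hS.continuousOn_mild hl hb x hh).congr fun t _ => hu t
  obtain ⟨R, hR⟩ := isCompact_Icc.exists_bound_of_continuousOn huc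
  have hR0 : 0 ≤ R := (norm_nonneg _).trans (hR t ht)
  set D := Real.exp (l * T) with hD
  have hD0 : 0 ≤ D := (Real.exp_pos _).le
  set K : ℝ := D * (2 * R + D) + T * (2 * l * (D * (2 * R + D))) + 2 * (R + D)
    + 2 * D * ∫ s in Icc 0 T, ‖h s‖ with hK
  have hK0 : 0 ≤ K := by
    have : 0 ≤ ∫ s in Icc 0 T, ‖h s‖ := integral_nonneg fun _ => norm_nonneg _
    positivity
  suffices H : ∀ η : ℝ, 0 < η → η ≤ 1 → ‖u t‖ ^ 2 ≤ (‖x‖ ^ 2 +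
      ∫ s in (0 : ℝ)..t, (2 * l * ‖u s‖ ^ 2 + 2 * inner ℝ (u s) (h s))) + K * η by
    refine le_of_forall_pos_le_add fun ε hε => ?_
    have hη : 0 < min 1 (ε / (K + 1)) := by positivity
    refine (H _ hη (min_le_left _ _)).trans ?_
    gcongr
    calc K * min 1 (ε / (K + 1)) ≤ K * (ε / (K + 1)) := by gcongr; exact min_le_right _ _
      _ ≤ (K + 1) * (ε / (K + 1)) := by gcongr; linarith
      _ = ε := by field_simp
  intro η hη hη1
  obtain ⟨h', -, hle, hc', -⟩ := hh.exists_hasCompactSupport_integral_sub_le hη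
  have hh' : IntegrableOn h' (Icc 0 T) := hc'.integrableOn_Icc
  have hdi : IntegrableOn (fun s => ‖h s - h' s‖) (Icc 0 T) := (hh.sub hh').norm
  set u' : ℝ → H := fun t => S t x + mildConv S h' t with hu'
  have huc' : ContinuousOn u' (Icc 0 T) := hS.continuousOn_mild hl hb x hh'
  have hdiff : ∀ s ∈ Icc 0 T, ‖u s - u' s‖ ≤ D * η := by
    intro s hs
    have e : u s - u' s = ∫ r in (0 : ℝ)..s, S (s - r) (h r - h' r) := by
      simp only [map_sub]
      rw [intervalIntegral.integral_sub (hS.intervalIntegrable_apply hl hb hh le_rfl hs.1 le_rfl hs.2)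
        (hS.intervalIntegrable_apply hl hb hh' le_rfl hs.1 le_rfl hs.2), hu, hu']
      simp only [mildConv]; abel
    rw [e]
    refine (norm_integral_semigroup_le hl hb hdi (Eventually.of_forall fun _ => le_rfl) le_rfl hs.1
      hs.2).trans ?_
    gcongr
    refine le_trans ?_ hle
    rw [intervalIntegral.integral_of_le hs.1]
    exact setIntegral_mono_set hdi (Eventually.of_forall fun _ => norm_nonneg _)
      (Eventually.of_forall fun r hr => ⟨hr.1.le, hr.2.trans hs.2⟩)
  have hDη : D * η ≤ D := by nlinarith
  have hn' : ∀ s ∈ Icc 0 T, ‖u' s‖ ≤ R + D := fun s hs => by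
    have := norm_sub_norm_le (u' s) (u s)
    rw [norm_sub_rev] at this
    linarith [hdiff s hs, hR s hs]
  have hsq : ∀ s ∈ Icc 0 T, |‖u s‖ ^ 2 - ‖u' s‖ ^ 2| ≤ D * (2 * R + D) * η := by
    intro s hs
    rw [sq_sub_sq, abs_mul]
    have h1 : |‖u s‖ - ‖u' s‖| ≤ D * η := (abs_norm_sub_norm_le _ _).trans (hdiff s hs)
    have h2 : |‖u s‖ + ‖u' s‖| ≤ 2 * R + D := by
      rw [abs_of_nonneg (by positivity)]
      linarith [hn' s hs, hR s hs]
    calc _ ≤ (2 * R + D) * (D * η) := by gcongr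
      _ = _ := by ring
  have E := hS.energy_of_continuous (T := T) hl hb x hc' (u := u') (fun _ => rfl) ht
  have i1 : ∀ {v : ℝ → H} {k : ℝ → H}, ContinuousOn v (Icc 0 T) → IntegrableOn k (Icc 0 T) →
      IntegrableOn (fun s => 2 * l * ‖v s‖ ^ 2 + 2 * inner ℝ (v s) (k s)) (Icc 0 T) := by
    intro v k hv hk
    refine ((hv.norm.pow 2).integrableOn_Icc.const_mul _).add (Integrable.const_mul ?_ _)
    obtain ⟨B, hB⟩ := isCompact_Icc.exists_bound_of_continuousOn hv
    refine Integrable.mono' (hk.norm.const_mul B)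
      ((hv.aestronglyMeasurable measurableSet_Icc).inner hk.aestronglyMeasurable) ?_
    filter_upwards [ae_restrict_mem measurableSet_Icc] with s hs
    refine (norm_inner_le_norm _ _).trans ?_
    gcongr
    exact hB s hs
  have hsub : Ioc 0 t ⊆ Icc 0 T := fun s hs => ⟨hs.1.le, hs.2.trans ht.2⟩
  have ii : ∀ {k : ℝ → ℝ}, IntegrableOn k (Icc 0 T) → IntervalIntegrable k volume 0 t :=
    fun hk => (intervalIntegrable_iff_integrableOn_Ioc_of_le ht.1).2 (hk.mono_set hsub)
  have key : ∫ s in (0 : ℝ)..t, (2 * l * ‖u' s‖ ^ 2 + 2 * inner ℝ (u' s) (h' s)) ≤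
      ∫ s in (0 : ℝ)..t, ((2 * l * ‖u s‖ ^ 2 + 2 * inner ℝ (u s) (h s)) +
        (2 * l * (D * (2 * R + D) * η) + 2 * (R + D) * ‖h s - h' s‖ + 2 * (D * η) * ‖h s‖)) := by
    have hr : IntegrableOn (fun s => 2 * l * (D * (2 * R + D) * η) + 2 * (R + D) * ‖h s - h' s‖
        + 2 * (D * η) * ‖h s‖) (Icc 0 T) :=
      ((integrable_const _).add (hdi.const_mul _)).add (hh.norm.const_mul _)
    refine intervalIntegral.integral_mono_on ht.1 (ii (i1 huc' hh')) (ii ((i1 huc hh).add hr)) ?_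
    intro s hs
    have hs' : s ∈ Icc 0 T := ⟨hs.1, hs.2.trans ht.2⟩
    have h1 := abs_le.1 (hsq s hs')
    have h2 : inner ℝ (u' s) (h' s) - inner ℝ (u s) (h s)
        = inner ℝ (u' s) (h' s - h s) + inner ℝ (u' s - u s) (h s) := by
      rw [inner_sub_right, inner_sub_left]; ring
    have h3 : inner ℝ (u' s) (h' s - h s) ≤ (R + D) * ‖h s - h' s‖ := by
      refine (real_inner_le_norm _ _).trans ?_
      rw [norm_sub_rev]
      gcongr
      exact hn' s hs'
    have h4 : inner ℝ (u' s - u s) (h s) ≤ (D * η) * ‖h s‖ := by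
      refine (real_inner_le_norm _ _).trans ?_
      rw [norm_sub_rev]
      gcongr
      exact hdiff s hs'
    have h5 : l * (‖u' s‖ ^ 2 - ‖u s‖ ^ 2) ≤ l * (D * (2 * R + D) * η) := by
      gcongr; linarith [h1.1]
    linarith
  have j1 : ∫ s in (0 : ℝ)..t, ‖h s - h' s‖ ≤ η := by
    refine le_trans ?_ hle
    rw [intervalIntegral.integral_of_le ht.1]
    exact setIntegral_mono_set hdi (Eventually.of_forall fun _ => norm_nonneg _)
      (Eventually.of_forall hsub)
  have j2 : ∫ s in (0 : ℝ)..t, ‖h s‖ ≤ ∫ s in Icc 0 T, ‖h s‖ := by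
    rw [intervalIntegral.integral_of_le ht.1]
    exact setIntegral_mono_set hh.norm (Eventually.of_forall fun _ => norm_nonneg _)
      (Eventually.of_forall hsub)
  have k1 : IntervalIntegrable (fun _ : ℝ => 2 * l * (D * (2 * R + D) * η)) volume 0 t := by simp
  have k2 : IntervalIntegrable (fun s => 2 * (R + D) * ‖h s - h' s‖) volume 0 t :=
    ii (hdi.const_mul _)
  have k3 : IntervalIntegrable (fun s => 2 * (D * η) * ‖h s‖) volume 0 t :=
    ii (hh.norm.const_mul _)
  have q1 : ∫ s in (0 : ℝ)..t, 2 * (R + D) * ‖h s - h' s‖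
      = 2 * (R + D) * ∫ s in (0 : ℝ)..t, ‖h s - h' s‖ := intervalIntegral.integral_const_mul _ _
  have q2 : ∫ s in (0 : ℝ)..t, 2 * (D * η) * ‖h s‖
      = 2 * (D * η) * ∫ s in (0 : ℝ)..t, ‖h s‖ := intervalIntegral.integral_const_mul _ _
  have q3 : ∫ _ in (0 : ℝ)..t, 2 * l * (D * (2 * R + D) * η)
      = (t - 0) • (2 * l * (D * (2 * R + D) * η)) := intervalIntegral.integral_const _
  rw [intervalIntegral.integral_add (ii (i1 huc hh)) ((k1.add k2).add k3),
    intervalIntegral.integral_add (k1.add k2) k3, intervalIntegral.integral_add k1 k2,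
    q1, q2, q3] at key
  have j3 : 2 * (R + D) * ∫ s in (0 : ℝ)..t, ‖h s - h' s‖ ≤ 2 * (R + D) * η := by gcongr
  have j4 : 2 * (D * η) * ∫ s in (0 : ℝ)..t, ‖h s‖ ≤ 2 * (D * η) * ∫ s in Icc 0 T, ‖h s‖ := by
    gcongr
  have j5 : (t - 0) • (2 * l * (D * (2 * R + D) * η)) ≤ T * (2 * l * (D * (2 * R + D) * η)) := by
    rw [smul_eq_mul, sub_zero]; gcongr; exact ht.2
  have j6 := (abs_le.1 (hsq t ht)).2
  have e : K * η = D * (2 * R + D) * η + T * (2 * l * (D * (2 * R + D) * η)) + 2 * (R + D) * η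
    + 2 * (D * η) * ∫ s in Icc 0 T, ‖h s‖ := by rw [hK]; ring
  rw [e]
  linarith

end Energy

/-! ### Gronwall's inequality with an integrable kernel -/

/-- The function `W t = exp (2 ∫₀ᵗ ℓ)` is monotone with derivative `2 ℓ W` almost everywhere, so
that `∫ 2 ℓ W ≤ W t - W 0`; absolute continuity is not needed. -/
theorem two_mul_integral_mul_exp_le {ℓ : ℝ → ℝ} {T t : ℝ} (hℓ : IntegrableOn ℓ (Icc 0 T))
    (hℓ0 : ∀ s, 0 ≤ ℓ s) (ht : t ∈ Icc 0 T) :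
    ∫ s in (0 : ℝ)..t, 2 * (ℓ s * Real.exp (2 * ∫ r in (0 : ℝ)..s, ℓ r))
      ≤ Real.exp (2 * ∫ r in (0 : ℝ)..t, ℓ r) - 1 := by
  have hsub : Icc 0 t ⊆ Icc 0 T := Icc_subset_Icc le_rfl ht.2
  have hi : ∀ a b, a ∈ Icc 0 t → b ∈ Icc 0 t → IntervalIntegrable ℓ volume a b := by
    intro a b ha hb
    rw [intervalIntegrable_iff]
    refine hℓ.mono_set fun s hs => hsub ?_
    rw [uIoc, mem_Ioc, min_lt_iff, le_max_iff] at hs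
    constructor
    · rcases hs.1 with h | h
      · exact ha.1.trans h.le
      · exact hb.1.trans h.le
    · rcases hs.2 with h | h
      · exact h.trans ha.2
      · exact h.trans hb.2
  have h0 : (0 : ℝ) ∈ Icc 0 t := ⟨le_rfl, ht.1⟩
  set W : ℝ → ℝ := fun s => Real.exp (2 * ∫ r in (0 : ℝ)..s, ℓ r) with hW
  have hmono : MonotoneOn W (uIcc 0 t) := by
    rw [uIcc_of_le ht.1]
    intro a ha b hb hab
    have : ∫ r in (0 : ℝ)..b, ℓ r = (∫ r in (0 : ℝ)..a, ℓ r) + ∫ r in a..b, ℓ r :=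
      (intervalIntegral.integral_add_adjacent_intervals (hi 0 a h0 ha) (hi a b ha hb)).symm
    have h2 : 0 ≤ ∫ r in a..b, ℓ r := intervalIntegral.integral_nonneg hab fun s _ => hℓ0 s
    simp only [hW]
    gcongr
    linarith
  have key := hmono.intervalIntegral_deriv_mem_uIcc
  have hW0 : W 0 = 1 := by simp [hW]
  have hWt : W 0 ≤ W t := hmono (by simp) (by simp) ht.1
  rw [uIcc_of_le (by linarith), hW0] at key
  refine le_trans (le_of_eq ?_) key.2
  refine intervalIntegral.integral_congr_ae ?_
  filter_upwards [(hi 0 t h0 ⟨ht.1, le_rfl⟩).ae_hasDerivAt_integral] with s hs hst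
  rw [uIoc_of_le ht.1] at hst
  have hst' : s ∈ uIcc 0 t := by rw [uIcc_of_le ht.1]; exact ⟨hst.1.le, hst.2⟩
  have h1 := ((hs hst' 0 left_mem_uIcc).const_mul 2).exp
  rw [h1.deriv]
  ring

/-- **Gronwall's inequality** with an integrable kernel and a delay `θ s ∈ [0, s]` in the argument.
It is proved by maximising `φ t * exp (-2 ∫₀ᵗ ℓ)`. -/
theorem le_of_le_add_integral_mul_delay {ℓ φ θ : ℝ → ℝ} {a T : ℝ}
    (hℓ : IntegrableOn ℓ (Icc 0 T)) (hℓ0 : ∀ s, 0 ≤ ℓ s) (ha : 0 ≤ a)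
    (hφ : ContinuousOn φ (Icc 0 T)) (hφ0 : ∀ t ∈ Icc 0 T, 0 ≤ φ t)
    (hθ : ∀ s ∈ Icc 0 T, θ s ∈ Icc 0 s)
    (hle : ∀ t ∈ Icc 0 T, φ t ≤ a + ∫ s in (0 : ℝ)..t, ℓ s * φ (θ s)) {t : ℝ}
    (ht : t ∈ Icc 0 T) : φ t ≤ 2 * a * Real.exp (2 * ∫ s in Icc 0 T, ℓ s) := by
  have hT : 0 ≤ T := ht.1.trans ht.2
  set Λ : ℝ → ℝ := fun s => ∫ r in (0 : ℝ)..s, ℓ r with hΛ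
  have hΛc : ContinuousOn Λ (Icc 0 T) := by
    have := intervalIntegral.continuousOn_primitive_interval (a := 0) (b := T) (f := ℓ)
      (μ := volume) (by rwa [uIcc_of_le hT])
    rwa [uIcc_of_le hT] at this
  have hΛ0 : ∀ s ∈ Icc 0 T, 0 ≤ Λ s := fun s hs =>
    intervalIntegral.integral_nonneg hs.1 fun r _ => hℓ0 r
  have hsub : ∀ {s}, s ∈ Icc 0 T → Ioc 0 s ⊆ Icc 0 T := fun hs r hr =>
    ⟨hr.1.le, hr.2.trans hs.2⟩
  have hΛm : ∀ s ∈ Icc 0 T, ∀ r ∈ Icc 0 s, Λ r ≤ Λ s := by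
    intro s hs r hr
    simp only [hΛ]
    rw [intervalIntegral.integral_of_le hs.1, intervalIntegral.integral_of_le hr.1]
    exact setIntegral_mono_set (hℓ.mono_set (hsub hs)) (Eventually.of_forall fun _ => hℓ0 _)
      (Eventually.of_forall fun x hx => ⟨hx.1, hx.2.trans hr.2⟩)
  obtain ⟨m, hm, hmax⟩ := isCompact_Icc.exists_isMaxOn ⟨t, ht⟩
    (f := fun s => φ s * Real.exp (-(2 * Λ s))) (by fun_prop)
  set K := φ m * Real.exp (-(2 * Λ m)) with hK
  have hK0 : 0 ≤ K := mul_nonneg (hφ0 m hm) (Real.exp_pos _).le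
  have hφK : ∀ s ∈ Icc 0 T, φ s ≤ K * Real.exp (2 * Λ s) := by
    intro s hs
    have h1 : φ s * Real.exp (-(2 * Λ s)) ≤ K := hmax hs
    calc φ s = φ s * Real.exp (-(2 * Λ s)) * Real.exp (2 * Λ s) := by
          rw [mul_assoc, ← Real.exp_add]; simp
      _ ≤ _ := by gcongr
  have hint : ∫ s in (0 : ℝ)..m, ℓ s * φ (θ s) ≤ K / 2 * (Real.exp (2 * Λ m) - 1) := by
    have hW : IntervalIntegrable (fun s => 2 * (ℓ s * Real.exp (2 * Λ s))) volume 0 m := by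
      rw [intervalIntegrable_iff_integrableOn_Ioc_of_le hm.1]
      refine IntegrableOn.mono_set (t := Icc 0 T) ?_ (hsub hm)
      refine Integrable.const_mul ?_ 2
      refine IntegrableOn.mul_continuousOn (K := Icc 0 T) hℓ ?_ isCompact_Icc
      fun_prop
    calc ∫ s in (0 : ℝ)..m, ℓ s * φ (θ s)
        ≤ ∫ s in (0 : ℝ)..m, K / 2 * (2 * (ℓ s * Real.exp (2 * Λ s))) := by
          rw [intervalIntegral.integral_of_le hm.1, intervalIntegral.integral_of_le hm.1]
          refine integral_mono_of_nonneg ?_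
            ((intervalIntegrable_iff_integrableOn_Ioc_of_le hm.1).1 (hW.const_mul _)) ?_
          · filter_upwards [ae_restrict_mem measurableSet_Ioc] with s hs
            have hs' := hsub hm hs
            have := hθ s hs'
            exact mul_nonneg (hℓ0 s) (hφ0 _ ⟨this.1, this.2.trans hs'.2⟩)
          · filter_upwards [ae_restrict_mem measurableSet_Ioc] with s hs
            have hs' := hsub hm hs
            have hθs := hθ s hs'
            have h1 := hφK (θ s) ⟨hθs.1, hθs.2.trans hs'.2⟩
            have h2 : Real.exp (2 * Λ (θ s)) ≤ Real.exp (2 * Λ s) := by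
              gcongr; exact hΛm s hs' _ hθs
            calc ℓ s * φ (θ s) ≤ ℓ s * (K * Real.exp (2 * Λ s)) := by
                  gcongr
                  · exact hℓ0 s
                  · exact h1.trans (by gcongr)
              _ = _ := by ring
      _ = K / 2 * ∫ s in (0 : ℝ)..m, 2 * (ℓ s * Real.exp (2 * Λ s)) :=
          intervalIntegral.integral_const_mul _ _
      _ ≤ _ := by
          gcongr
          exact two_mul_integral_mul_exp_le hℓ hℓ0 hm
  have hKW : φ m = K * Real.exp (2 * Λ m) := by
    rw [hK, mul_assoc, ← Real.exp_add]; simp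
  have hm1 := hle m hm
  have hW1 : 1 ≤ Real.exp (2 * Λ m) := Real.one_le_exp (by linarith [hΛ0 m hm])
  have hK2 : K ≤ 2 * a := by
    have : K * Real.exp (2 * Λ m) ≤ 2 * a := by
      rw [← hKW]; rw [← sub_nonneg]; rw [hKW] at hm1 ⊢; nlinarith
    nlinarith
  have hΛT : Λ t ≤ ∫ s in Icc 0 T, ℓ s := by
    simp only [hΛ]
    rw [intervalIntegral.integral_of_le ht.1]
    exact setIntegral_mono_set hℓ (Eventually.of_forall fun _ => hℓ0 _)
      (Eventually.of_forall (hsub ht))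
  refine (hφK t ht).trans ?_
  gcongr

/-! ### Mild equations with a one-sided Lipschitz drift -/

section Drift

variable {H : Type*} [NormedAddCommGroup H] [InnerProductSpace ℝ H]

/-- A time-dependent drift `F` on `[0, T]` with rate `ℓ ∈ L¹`: it is measurable, of linear growth,
one-sided Lipschitz and demicontinuous. All conditions are imposed for almost every time along
continuous paths only, so that the exceptional null set may depend on the paths; this matters when
`H` is not separable. -/
structure IsMonoDrift (T : ℝ) (F : ℝ → H → H) (ℓ : ℝ → ℝ) : Prop where
  nonneg : ∀ s, 0 ≤ ℓ s
  integrable : IntegrableOn ℓ (Icc 0 T)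
  meas : ∀ φ : ℝ → H, Continuous φ →
    AEStronglyMeasurable (fun s => F s (φ s)) (volume.restrict (Icc 0 T))
  growth : ∀ φ : ℝ → H, Continuous φ →
    ∀ᵐ s ∂volume.restrict (Icc 0 T), ‖F s (φ s)‖ ≤ ℓ s * (1 + ‖φ s‖)
  mono : ∀ φ χ : ℝ → H, Continuous φ → Continuous χ → ∀ᵐ s ∂volume.restrict (Icc 0 T),
    inner ℝ (F s (φ s) - F s (χ s)) (φ s - χ s) ≤ ℓ s * ‖φ s - χ s‖ ^ 2
  demi : ∀ (φ : ℕ → ℝ → H) (χ : ℝ → H), (∀ n, Continuous (φ n)) → Continuous χ →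
    (∀ s ∈ Icc 0 T, Tendsto (fun n => φ n s) atTop (𝓝 (χ s))) →
    ∀ᵐ s ∂volume.restrict (Icc 0 T), ∀ y : H,
      Tendsto (fun n => inner ℝ (F s (φ n s)) y) atTop (𝓝 (inner ℝ (F s (χ s)) y))

variable {S : ℝ → H →L[ℝ] H} {l T : ℝ} {F : ℝ → H → H} {ℓ : ℝ → ℝ}

theorem IsMonoDrift.ae_norm_le (hF : IsMonoDrift T F ℓ) {φ : ℝ → H} (hφ : Continuous φ) {R : ℝ}
    (hR : ∀ s ∈ Icc 0 T, ‖φ s‖ ≤ R) :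
    ∀ᵐ s ∂volume.restrict (Icc 0 T), ‖F s (φ s)‖ ≤ (1 + R) * ℓ s := by
  filter_upwards [hF.growth φ hφ, ae_restrict_mem measurableSet_Icc] with s h1 h2
  refine h1.trans ?_
  rw [mul_comm]
  have := hF.nonneg s
  gcongr
  exact hR s h2

theorem IsMonoDrift.integrableOn (hF : IsMonoDrift T F ℓ) {φ : ℝ → H} (hφ : Continuous φ) :
    IntegrableOn (fun s => F s (φ s)) (Icc 0 T) := by
  obtain ⟨R, hR⟩ := isCompact_Icc.exists_bound_of_continuousOn (hφ.continuousOn (s := Icc 0 T))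
  exact Integrable.mono' (hF.integrable.const_mul (1 + R)) (hF.meas φ hφ) (hF.ae_norm_le hφ hR)

theorem integral_le_setIntegral {ℓ : ℝ → ℝ} (hℓ : IntegrableOn ℓ (Icc 0 T)) (hℓ0 : ∀ s, 0 ≤ ℓ s)
    {a t : ℝ} (ha : 0 ≤ a) (hat : a ≤ t) (htT : t ≤ T) :
    ∫ s in a..t, ℓ s ≤ ∫ s in Icc 0 T, ℓ s := by
  rw [intervalIntegral.integral_of_le hat]
  exact setIntegral_mono_set hℓ (Eventually.of_forall fun _ => hℓ0 _)
    (Eventually.of_forall fun s hs => ⟨ha.trans hs.1.le, hs.2.trans htT⟩)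

/-- A priori bound for mild equations whose drift is evaluated along a path `y` controlled by the
past of the solution. -/
theorem IsMonoDrift.norm_le (hS : IsC0Semigroup S) (hl : 0 ≤ l)
    (hb : ∀ t : ℝ, 0 ≤ t → ‖S t‖ ≤ Real.exp (l * t)) (hF : IsMonoDrift T F ℓ) {L : ℝ}
    (hL : ∫ s in Icc 0 T, ℓ s ≤ L) {x : H} {u y : ℝ → H} (hy : Continuous y)
    (hu : ∀ t ∈ Icc 0 T, u t = S t x + mildConv S (fun s => F s (y s)) t) {θ : ℝ → ℝ}
    (hθc : Continuous θ) (hθ : ∀ s ∈ Icc 0 T, θ s ∈ Icc 0 s)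
    (hyu : ∀ s ∈ Icc 0 T, ‖y s‖ ≤ Real.exp (l * T) * ‖u (θ s)‖) {t : ℝ} (ht : t ∈ Icc 0 T) :
    ‖u t‖ ≤ 2 * (Real.exp (l * T) * (‖x‖ + L)) * Real.exp (2 * (Real.exp (l * T) ^ 2 * L)) := by
  set D := Real.exp (l * T) with hD
  have hD0 : 0 < D := Real.exp_pos _
  have hL0 : 0 ≤ L := (integral_nonneg fun s => hF.nonneg s).trans hL
  have huc : ContinuousOn u (Icc 0 T) := by
    have h1 := hS.continuousOn_mildConv hl hb (hF.integrableOn hy)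
    have hc : Continuous fun t => S (max t 0) x :=
      (hS.continuous_extend hl hb).comp (by fun_prop : Continuous fun t : ℝ => (t, x))
    refine (hc.continuousOn.add h1).congr fun t ht => ?_
    rw [hu t ht, Pi.add_apply, max_eq_left ht.1]
  obtain ⟨R, hR⟩ := isCompact_Icc.exists_bound_of_continuousOn huc
  have hθ' : ∀ s ∈ Icc 0 T, θ s ∈ Icc 0 T := fun s hs => ⟨(hθ s hs).1, (hθ s hs).2.trans hs.2⟩
  have main := le_of_le_add_integral_mul_delay (ℓ := fun s => D ^ 2 * ℓ s) (φ := fun s => ‖u s‖)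
    (θ := θ) (a := D * (‖x‖ + L)) (hF.integrable.const_mul _)
    (fun s => mul_nonneg (sq_nonneg _) (hF.nonneg s)) (by positivity) huc.norm
    (fun _ _ => norm_nonneg _) hθ ?_ ht
  · refine main.trans ?_
    rw [integral_const_mul]
    gcongr
  · intro t ht
    rw [hu t ht]
    have hgr : ∀ᵐ s ∂volume.restrict (Icc 0 T), ‖F s (y s)‖ ≤ ℓ s * (1 + ‖y s‖) := hF.growth y hy
    have hyb : IntegrableOn (fun s => ℓ s * (1 + ‖y s‖)) (Icc 0 T) :=
      hF.integrable.mul_continuousOn (by fun_prop) isCompact_Icc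
    have h1 : ‖mildConv S (fun s => F s (y s)) t‖ ≤ D * ∫ s in (0 : ℝ)..t, ℓ s * (1 + ‖y s‖) :=
      norm_integral_semigroup_le hl hb hyb hgr le_rfl ht.1 ht.2
    have hsub : Ioc 0 t ⊆ Icc 0 T := fun s hs => ⟨hs.1.le, hs.2.trans ht.2⟩
    have ii : ∀ {k : ℝ → ℝ}, IntegrableOn k (Icc 0 T) → IntervalIntegrable k volume 0 t :=
      fun hk => (intervalIntegrable_iff_integrableOn_Ioc_of_le ht.1).2 (hk.mono_set hsub)
    have hθu : IntegrableOn (fun s => ℓ s * ‖u (θ s)‖) (Icc 0 T) :=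
      hF.integrable.mul_continuousOn (huc.comp hθc.continuousOn hθ').norm isCompact_Icc
    have h2 : ∫ s in (0 : ℝ)..t, ℓ s * (1 + ‖y s‖)
        ≤ ∫ s in (0 : ℝ)..t, (ℓ s + D * (ℓ s * ‖u (θ s)‖)) := by
      refine intervalIntegral.integral_mono_on ht.1 (ii hyb)
        (ii (hF.integrable.add (hθu.const_mul D))) fun s hs => ?_
      have := hyu s ⟨hs.1, hs.2.trans ht.2⟩
      have h3 := mul_le_mul_of_nonneg_left this (hF.nonneg s)
      linarith
    have h3 : ∫ s in (0 : ℝ)..t, ℓ s ≤ L :=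
      (integral_le_setIntegral hF.integrable hF.nonneg le_rfl ht.1 ht.2).trans hL
    have e1 : ∫ s in (0 : ℝ)..t, D * (ℓ s * ‖u (θ s)‖)
        = D * ∫ s in (0 : ℝ)..t, ℓ s * ‖u (θ s)‖ := intervalIntegral.integral_const_mul _ _
    have e2 : ∫ s in (0 : ℝ)..t, D ^ 2 * ℓ s * ‖u (θ s)‖
        = D ^ 2 * ∫ s in (0 : ℝ)..t, ℓ s * ‖u (θ s)‖ := by
      simp only [mul_assoc]
      exact intervalIntegral.integral_const_mul _ _
    rw [intervalIntegral.integral_add (ii hF.integrable) (ii (hθu.const_mul D)), e1] at h2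
    rw [e2]
    have h4 : ‖S t x‖ ≤ D * ‖x‖ := norm_semigroup_apply_le_of_le hl hb ht.1 ht.2 x
    refine (norm_add_le _ _).trans ?_
    have h5 := mul_le_mul_of_nonneg_left (h2.trans (add_le_add_left h3 _)) hD0.le
    linarith

/-- **Stability.** Two approximate solutions `uᵢ`, whose drift is evaluated along paths `yᵢ` that
are `ε`-close to `uᵢ`, are close to each other. -/
theorem IsMonoDrift.norm_sub_sq_le [CompleteSpace H] (hS : IsC0Semigroup S) (hl : 0 ≤ l)
    (hb : ∀ t : ℝ, 0 ≤ t → ‖S t‖ ≤ Real.exp (l * t)) (hF : IsMonoDrift T F ℓ) {L : ℝ}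
    (hL : ∫ s in Icc 0 T, ℓ s ≤ L) {x : H} {u₁ u₂ y₁ y₂ : ℝ → H} (hy₁ : Continuous y₁)
    (hy₂ : Continuous y₂)
    (hu₁ : ∀ t ∈ Icc 0 T, u₁ t = S t x + mildConv S (fun s => F s (y₁ s)) t)
    (hu₂ : ∀ t ∈ Icc 0 T, u₂ t = S t x + mildConv S (fun s => F s (y₂ s)) t) {ε R : ℝ}
    (hε : 0 ≤ ε) (hR : 0 ≤ R)
    (h₁ : ∀ s ∈ Icc 0 T, ‖u₁ s - y₁ s‖ ≤ ε) (h₂ : ∀ s ∈ Icc 0 T, ‖u₂ s - y₂ s‖ ≤ ε)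
    (hR₁ : ∀ s ∈ Icc 0 T, ‖y₁ s‖ ≤ R) (hR₂ : ∀ s ∈ Icc 0 T, ‖y₂ s‖ ≤ R) {t : ℝ}
    (ht : t ∈ Icc 0 T) :
    ‖u₁ t - u₂ t‖ ^ 2
      ≤ 2 * ((16 * ε ^ 2 + 8 * ε * (1 + R)) * L) * Real.exp (2 * (2 * l * T + 4 * L)) := by
  have hL0 : 0 ≤ L := (integral_nonneg fun s => hF.nonneg s).trans hL
  have hT : 0 ≤ T := ht.1.trans ht.2
  have hi₁ := hF.integrableOn hy₁
  have hi₂ := hF.integrableOn hy₂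
  set h : ℝ → H := fun s => F s (y₁ s) - F s (y₂ s) with hh
  have hi : IntegrableOn h (Icc 0 T) := hi₁.sub hi₂
  set w : ℝ → H := fun t => S t (0 : H) + mildConv S h t with hw
  have hwu : ∀ s ∈ Icc 0 T, w s = u₁ s - u₂ s := by
    intro s hs
    rw [hu₁ s hs, hu₂ s hs, hw]
    simp only [map_zero, zero_add, hh, mildConv, map_sub]
    rw [intervalIntegral.integral_sub (hS.intervalIntegrable_apply hl hb hi₁ le_rfl hs.1 le_rfl hs.2)
        (hS.intervalIntegrable_apply hl hb hi₂ le_rfl hs.1 le_rfl hs.2)]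
    abel
  have hwc : ContinuousOn w (Icc 0 T) := hS.continuousOn_mild hl hb 0 hi
  set c : ℝ := 16 * ε ^ 2 + 8 * ε * (1 + R) with hc
  have hc0 : 0 ≤ c := by positivity
  have hkey : ∀ᵐ s ∂volume.restrict (Icc 0 T), 2 * l * ‖w s‖ ^ 2 + 2 * inner ℝ (w s) (h s)
      ≤ c * ℓ s + (2 * l + 4 * ℓ s) * ‖w s‖ ^ 2 := by
    filter_upwards [hF.mono y₁ y₂ hy₁ hy₂, hF.ae_norm_le hy₁ hR₁, hF.ae_norm_le hy₂ hR₂,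
      ae_restrict_mem measurableSet_Icc] with s hm g1 g2 hs
    have hℓ := hF.nonneg s
    have hd : ‖w s - (y₁ s - y₂ s)‖ ≤ 2 * ε := by
      rw [hwu s hs, show u₁ s - u₂ s - (y₁ s - y₂ s) = (u₁ s - y₁ s) - (u₂ s - y₂ s) by abel]
      exact (norm_sub_le _ _).trans (by linarith [h₁ s hs, h₂ s hs])
    have hyw : ‖y₁ s - y₂ s‖ ≤ ‖w s‖ + 2 * ε := by
      have := norm_sub_norm_le (y₁ s - y₂ s) (w s)
      rw [norm_sub_rev (y₁ s - y₂ s) (w s)] at this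
      linarith
    have hhn : ‖h s‖ ≤ 2 * (1 + R) * ℓ s := (norm_sub_le _ _).trans (by linarith)
    have e : inner ℝ (w s) (h s)
        = inner ℝ (h s) (y₁ s - y₂ s) + inner ℝ (w s - (y₁ s - y₂ s)) (h s) := by
      rw [inner_sub_left (w s), real_inner_comm (h s) (w s), real_inner_comm (h s) (y₁ s - y₂ s)]
      ring
    have i1 : inner ℝ (w s - (y₁ s - y₂ s)) (h s) ≤ 2 * ε * (2 * (1 + R) * ℓ s) :=
      (real_inner_le_norm _ _).trans (by gcongr)
    have i2 : ℓ s * ‖y₁ s - y₂ s‖ ^ 2 ≤ ℓ s * (2 * ‖w s‖ ^ 2 + 8 * ε ^ 2) := by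
      gcongr
      calc ‖y₁ s - y₂ s‖ ^ 2 ≤ (‖w s‖ + 2 * ε) ^ 2 := by gcongr
        _ ≤ _ := by nlinarith [sq_nonneg (‖w s‖ - 2 * ε)]
    rw [e, hc]
    linarith
  have hw2 : ContinuousOn (fun s => ‖w s‖ ^ 2) (Icc 0 T) := hwc.norm.pow 2
  have hker : IntegrableOn (fun s => 2 * l + 4 * ℓ s) (Icc 0 T) :=
    (integrable_const _).add (hF.integrable.const_mul 4)
  have main := le_of_le_add_integral_mul_delay (ℓ := fun s => 2 * l + 4 * ℓ s)
    (φ := fun s => ‖w s‖ ^ 2) (θ := fun s => s) (a := c * L) hker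
    (fun s => by have := hF.nonneg s; positivity) (by positivity) hw2
    (fun _ _ => sq_nonneg _) (fun s hs => ⟨hs.1, le_rfl⟩) ?_ ht
  · simp only [hwu t ht] at main
    refine main.trans ?_
    have e0 : ∫ s in Icc 0 T, 4 * ℓ s = 4 * ∫ s in Icc 0 T, ℓ s := integral_const_mul _ _
    have e : ∫ s in Icc 0 T, (2 * l + 4 * ℓ s) = 2 * l * T + 4 * ∫ s in Icc 0 T, ℓ s := by
      rw [integral_add (integrable_const _) (hF.integrable.const_mul 4), e0, setIntegral_const]
      simp [hT]; ring
    rw [e]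
    gcongr
  · intro t ht
    have hsub : Ioc 0 t ⊆ Icc 0 T := fun s hs => ⟨hs.1.le, hs.2.trans ht.2⟩
    have ii : ∀ {k : ℝ → ℝ}, IntegrableOn k (Icc 0 T) → IntervalIntegrable k volume 0 t :=
      fun hk => (intervalIntegrable_iff_integrableOn_Ioc_of_le ht.1).2 (hk.mono_set hsub)
    have E := hS.energy hl hb 0 hi (u := w) (fun _ => rfl) ht
    have iR : IntegrableOn (fun s => (2 * l + 4 * ℓ s) * ‖w s‖ ^ 2) (Icc 0 T) :=
      hker.mul_continuousOn hw2 isCompact_Icc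
    have iL : IntegrableOn (fun s => 2 * l * ‖w s‖ ^ 2 + 2 * inner ℝ (w s) (h s)) (Icc 0 T) := by
      refine (hw2.integrableOn_Icc.const_mul _).add (Integrable.const_mul ?_ _)
      obtain ⟨B, hB⟩ := isCompact_Icc.exists_bound_of_continuousOn hwc
      refine Integrable.mono' (hi.norm.const_mul B)
        ((hwc.aestronglyMeasurable measurableSet_Icc).inner hi.aestronglyMeasurable) ?_
      filter_upwards [ae_restrict_mem measurableSet_Icc] with s hs
      refine (norm_inner_le_norm _ _).trans ?_
      gcongr
      exact hB s hs
    have hle : ∫ s in (0 : ℝ)..t, (2 * l * ‖w s‖ ^ 2 + 2 * inner ℝ (w s) (h s))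
        ≤ ∫ s in (0 : ℝ)..t, (c * ℓ s + (2 * l + 4 * ℓ s) * ‖w s‖ ^ 2) := by
      refine intervalIntegral.integral_mono_ae_restrict ht.1 (ii iL)
        (ii ((hF.integrable.const_mul c).add iR)) ?_
      exact ae_restrict_of_ae_restrict_of_subset (Icc_subset_Icc le_rfl ht.2) hkey
    have e1 : ∫ s in (0 : ℝ)..t, c * ℓ s = c * ∫ s in (0 : ℝ)..t, ℓ s :=
      intervalIntegral.integral_const_mul _ _
    rw [intervalIntegral.integral_add (ii (hF.integrable.const_mul c)) (ii iR), e1] at hle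
    have h3 : c * ∫ s in (0 : ℝ)..t, ℓ s ≤ c * L := by
      gcongr
      exact (integral_le_setIntegral hF.integrable hF.nonneg le_rfl ht.1 ht.2).trans hL
    simp only [norm_zero] at E
    linarith

end Drift

/-! ### Existence and uniqueness of mild solutions -/

section Existence

variable {H : Type*} [NormedAddCommGroup H] [InnerProductSpace ℝ H]
  {S : ℝ → H →L[ℝ] H} {l T : ℝ} {F : ℝ → H → H} {ℓ : ℝ → ℝ}

/-- The delayed path `s ↦ S δ (u (s - δ))`, with `S s (u 0)` in place of it for `s < δ`. -/
noncomputable def delayPath (S : ℝ → H →L[ℝ] H) (hT : 0 ≤ T) (δ : ℝ) (u : C(Icc (0 : ℝ) T, H))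
    (s : ℝ) : H :=
  S (max (min δ s) 0) (IccExtend hT u (s - δ))

theorem continuous_delayPath (hS : IsC0Semigroup S) (hl : 0 ≤ l)
    (hb : ∀ t : ℝ, 0 ≤ t → ‖S t‖ ≤ Real.exp (l * t)) (hT : 0 ≤ T) (δ : ℝ)
    (u : C(Icc (0 : ℝ) T, H)) : Continuous (delayPath S hT δ u) := by
  have h1 : Continuous fun s : ℝ => IccExtend hT u (s - δ) :=
    u.continuous.Icc_extend' (h := hT) |>.comp (by fun_prop)
  exact (hS.continuous_extend hl hb).comp
    ((by fun_prop : Continuous fun s : ℝ => min δ s).prodMk h1)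

theorem delayPath_eq (hT : 0 ≤ T) {δ : ℝ} (hδ : 0 ≤ δ) (u : C(Icc (0 : ℝ) T, H)) {s : ℝ}
    (hs : s ∈ Icc 0 T) :
    delayPath S hT δ u s = S (s - max (s - δ) 0) (IccExtend hT u (max (s - δ) 0)) := by
  rw [delayPath]
  rcases le_total δ s with h | h
  · rw [min_eq_left h, max_eq_left hδ, max_eq_left (by linarith : (0 : ℝ) ≤ s - δ)]
    congr 2; ring
  · rw [min_eq_right h, max_eq_left hs.1, max_eq_right (by linarith : s - δ ≤ 0),
      IccExtend_of_le_left _ _ (by linarith : s - δ ≤ 0), IccExtend_of_le_left _ _ le_rfl, sub_zero]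

theorem mildConv_congr {h k : ℝ → H} {t : ℝ} (ht : 0 ≤ t) (hk : ∀ s ∈ Icc 0 t, h s = k s) :
    mildConv S h t = mildConv S k t := by
  refine intervalIntegral.integral_congr fun s hs => ?_
  rw [uIcc_of_le ht] at hs
  simp only [hk s hs]

/-- The path `t ↦ S t x + ∫₀ᵗ S (t-s) (h s) ds` in `C([0,T];H)`. -/
noncomputable def mildPath [CompleteSpace H] (hS : IsC0Semigroup S) (hl : 0 ≤ l)
    (hb : ∀ t : ℝ, 0 ≤ t → ‖S t‖ ≤ Real.exp (l * t)) (x : H) {h : ℝ → H}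
    (hh : IntegrableOn h (Icc 0 T)) : C(Icc (0 : ℝ) T, H) :=
  ⟨fun t => S t x + mildConv S h t,
    continuousOn_iff_continuous_domRestrict.1 (hS.continuousOn_mild hl hb x hh)⟩

/-- The delayed equation can be solved stepwise on the intervals `[0, k T / n]`; here the solution
is the `n`-th Picard iterate, which is already a fixed point. -/
theorem IsMonoDrift.exists_delayed [CompleteSpace H] (hS : IsC0Semigroup S) (hl : 0 ≤ l)
    (hb : ∀ t : ℝ, 0 ≤ t → ‖S t‖ ≤ Real.exp (l * t)) (hF : IsMonoDrift T F ℓ) (hT : 0 < T) (x : H)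
    {n : ℕ} (hn : 0 < n) :
    ∃ u : C(Icc (0 : ℝ) T, H), ∀ t : Icc (0 : ℝ) T,
      u t = S t x + mildConv S (fun s => F s (delayPath S hT.le (T / n) u s)) t := by
  set δ : ℝ := T / n with hδ
  have hδ0 : 0 < δ := by positivity
  set Γ : C(Icc (0 : ℝ) T, H) → C(Icc (0 : ℝ) T, H) := fun u =>
    mildPath hS hl hb x (hF.integrableOn (continuous_delayPath hS hl hb hT.le δ u)) with hΓ
  have hΓa : ∀ u t, Γ u t = S t x + mildConv S (fun s => F s (delayPath S hT.le δ u s)) t :=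
    fun u t => rfl
  set U : ℕ → C(Icc (0 : ℝ) T, H) := fun k => Γ^[k] (ContinuousMap.const _ x) with hU
  have hUs : ∀ k, U (k + 1) = Γ (U k) := fun k => Function.iterate_succ_apply' _ _ _
  have hstep : ∀ k : ℕ, ∀ t : Icc (0 : ℝ) T, (t : ℝ) ≤ k * δ → U (k + 1) t = U k t := by
    intro k
    induction k with
    | zero =>
      intro t ht
      have h0 : (t : ℝ) = 0 := le_antisymm (by simpa using ht) t.2.1
      rw [hUs, hΓa, h0]
      simp [mildConv, hS.zero, hU]
    | succ k ih =>
      intro t ht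
      rw [hUs (k + 1), hΓa, hUs k, hΓa]
      congr 1
      refine mildConv_congr t.2.1 fun s hs => ?_
      congr 1
      simp only [delayPath]
      congr 1
      rw [← hUs k]
      push_cast at ht
      refine ih _ ?_
      rw [coe_projIcc]
      refine max_le (by positivity) (min_le_of_right_le ?_)
      linarith [hs.2]
  refine ⟨U n, fun t => ?_⟩
  rw [← hΓa, ← hUs]
  refine (hstep n t ?_).symm
  have : n * δ = T := by rw [hδ]; field_simp
  rw [this]; exact t.2.2

/-- Integrals over windows of length `δ` are small, uniformly in the position of the window. -/
theorem exists_integral_window_le {ℓ : ℝ → ℝ} (hT : 0 ≤ T) (hℓ : IntegrableOn ℓ (Icc 0 T)) {ε : ℝ}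
    (hε : 0 < ε) : ∃ δ₀ > 0, ∀ δ, 0 ≤ δ → δ < δ₀ → ∀ t ∈ Icc 0 T,
      ∫ s in max (t - δ) 0..t, ℓ s ≤ ε := by
  have hc : ContinuousOn (fun s => ∫ r in (0 : ℝ)..s, ℓ r) (Icc 0 T) := by
    have := intervalIntegral.continuousOn_primitive_interval (a := 0) (b := T) (f := ℓ)
      (μ := volume) (by rwa [uIcc_of_le hT])
    rwa [uIcc_of_le hT] at this
  obtain ⟨δ₀, h0, h1⟩ := Metric.uniformContinuousOn_iff.1
    (isCompact_Icc.uniformContinuousOn_of_continuous hc) ε hε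
  refine ⟨δ₀, h0, fun δ hδ0 hδ t ht => ?_⟩
  have hm : max (t - δ) 0 ∈ Icc 0 T := ⟨le_max_right _ _, max_le (by linarith [ht.2]) hT⟩
  have hmt : max (t - δ) 0 ≤ t := max_le (by linarith) ht.1
  have hd : dist t (max (t - δ) 0) < δ₀ := by
    rw [Real.dist_eq, abs_of_nonneg (by linarith)]
    linarith [le_max_left (t - δ) 0]
  have h2 := h1 t ht _ hm hd
  have ii : ∀ a b, 0 ≤ a → a ≤ b → b ≤ T → IntervalIntegrable ℓ volume a b := fun a b ha hab hb =>
    (intervalIntegrable_iff_integrableOn_Ioc_of_le hab).2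
      (hℓ.mono_set fun s hs => ⟨ha.trans hs.1.le, hs.2.trans hb⟩)
  rw [Real.dist_eq, intervalIntegral.integral_interval_sub_left
    (ii _ _ le_rfl ht.1 ht.2) (ii _ _ le_rfl hm.1 hm.2)] at h2
  exact (le_abs_self _).trans h2.le

theorem tendsto_stability_const (R L c : ℝ) :
    Tendsto (fun ε : ℝ => 2 * ((16 * ε ^ 2 + 8 * ε * (1 + R)) * L) * Real.exp c) (𝓝 0) (𝓝 0) := by
  have : Continuous fun ε : ℝ => 2 * ((16 * ε ^ 2 + 8 * ε * (1 + R)) * L) * Real.exp c := by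
    fun_prop
  simpa using this.tendsto 0

omit [InnerProductSpace ℝ H] in
theorem norm_continuousMap_sub_le {u v : C(Icc (0 : ℝ) T, H)} {η : ℝ} (hη : 0 ≤ η)
    (h : ∀ t : Icc (0 : ℝ) T, ‖u t - v t‖ ^ 2 ≤ η ^ 2) : dist u v ≤ η := by
  refine (ContinuousMap.dist_le hη).2 fun t => ?_
  rw [dist_eq_norm]
  exact (sq_le_sq₀ (norm_nonneg _) hη).1 (h t)

theorem IsMonoDrift.unique [CompleteSpace H] (hS : IsC0Semigroup S) (hl : 0 ≤ l)
    (hb : ∀ t : ℝ, 0 ≤ t → ‖S t‖ ≤ Real.exp (l * t)) (hF : IsMonoDrift T F ℓ) (hT : 0 < T) {x : H}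
    {u v : C(Icc (0 : ℝ) T, H)}
    (hu : ∀ t : Icc (0 : ℝ) T, u t = S t x + mildConv S (fun s => F s (IccExtend hT.le u s)) t)
    (hv : ∀ t : Icc (0 : ℝ) T, v t = S t x + mildConv S (fun s => F s (IccExtend hT.le v s)) t) :
    u = v := by
  have cu : Continuous (IccExtend hT.le u) := u.continuous.Icc_extend'
  have cv : Continuous (IccExtend hT.le v) := v.continuous.Icc_extend'
  ext t
  have h := hF.norm_sub_sq_le hS hl hb le_rfl (u₁ := IccExtend hT.le u) (u₂ := IccExtend hT.le v)
    cu cv (x := x) (ε := 0) (R := max ‖u‖ ‖v‖)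
    (fun t ht => by rw [IccExtend_of_mem _ _ ht]; exact hu ⟨t, ht⟩)
    (fun t ht => by rw [IccExtend_of_mem _ _ ht]; exact hv ⟨t, ht⟩) le_rfl
    (le_max_of_le_left (norm_nonneg _))
    (by simp) (by simp) (fun s hs => (u.norm_coe_le_norm _).trans (le_max_left _ _))
    (fun s hs => (v.norm_coe_le_norm _).trans (le_max_right _ _)) t.2
  rw [IccExtend_val, IccExtend_val] at h
  have h2 : ‖u t - v t‖ ^ 2 ≤ 0 := by simpa using h
  have h3 : ‖u t - v t‖ = 0 := by
    have := sq_nonneg ‖u t - v t‖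
    exact pow_eq_zero_iff (two_ne_zero) |>.1 (le_antisymm h2 this)
  exact sub_eq_zero.1 (norm_eq_zero.1 h3)

/-- Mild solutions exist: the solutions of the delayed equations are a Cauchy sequence, because
`S δ (u (t - δ))` differs from `u t` only by an integral over a window of length `δ`, uniformly
small in `t`. The drift converges weakly along their limit. -/
theorem IsMonoDrift.exists_solution [CompleteSpace H] (hS : IsC0Semigroup S) (hl : 0 ≤ l)
    (hb : ∀ t : ℝ, 0 ≤ t → ‖S t‖ ≤ Real.exp (l * t)) (hF : IsMonoDrift T F ℓ) (hT : 0 < T) (x : H) :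
    ∃ u : C(Icc (0 : ℝ) T, H), ∀ t : Icc (0 : ℝ) T,
      u t = S t x + mildConv S (fun s => F s (IccExtend hT.le u s)) t := by
  choose U hU using fun n : ℕ => hF.exists_delayed hS hl hb hT x (Nat.succ_pos n)
  set δ : ℕ → ℝ := fun n => T / (n.succ : ℕ) with hδ
  have hδ0 : ∀ n, 0 < δ n := fun n => by positivity
  have hδt : Tendsto δ atTop (𝓝 0) := by
    have := (tendsto_const_div_atTop_nhds_zero_nat T).comp (tendsto_add_atTop_nat 1)
    exact this
  set Y : ℕ → ℝ → H := fun n => delayPath S hT.le (δ n) (U n) with hY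
  have hYc : ∀ n, Continuous (Y n) := fun n => continuous_delayPath hS hl hb hT.le _ _
  set V : ℕ → ℝ → H := fun n => IccExtend hT.le (U n) with hV
  have hVc : ∀ n, Continuous (V n) := fun n => (U n).continuous.Icc_extend'
  have hVU : ∀ n, ∀ t ∈ Icc 0 T, V n t = S t x + mildConv S (fun s => F s (Y n s)) t := by
    intro n t ht
    rw [hV]; simp only; rw [IccExtend_of_mem _ _ ht]; exact hU n ⟨t, ht⟩
  set D := Real.exp (l * T) with hD
  have hD0 : 0 < D := Real.exp_pos _
  set L := ∫ s in Icc 0 T, ℓ s with hL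
  have hL0 : 0 ≤ L := integral_nonneg fun s => hF.nonneg s
  have hθ : ∀ n, ∀ s ∈ Icc 0 T, max (s - δ n) 0 ∈ Icc 0 s := fun n s hs =>
    ⟨le_max_right _ _, max_le (by linarith [hδ0 n]) hs.1⟩
  have hYV : ∀ n, ∀ s ∈ Icc 0 T, Y n s = S (s - max (s - δ n) 0) (V n (max (s - δ n) 0)) :=
    fun n s hs => delayPath_eq hT.le (hδ0 n).le _ hs
  have hYle : ∀ n, ∀ s ∈ Icc 0 T, ‖Y n s‖ ≤ D * ‖V n (max (s - δ n) 0)‖ := by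
    intro n s hs
    rw [hYV n s hs]
    have := hθ n s hs
    exact norm_semigroup_apply_le_of_le hl hb (by linarith [this.2])
      (by linarith [this.1, hs.2]) _
  set R₀ := 2 * (D * (‖x‖ + L)) * Real.exp (2 * (D ^ 2 * L)) with hR₀
  have hVR : ∀ n, ∀ t ∈ Icc 0 T, ‖V n t‖ ≤ R₀ := fun n t ht =>
    IsMonoDrift.norm_le hS hl hb hF le_rfl (hYc n) (hVU n) (by fun_prop) (hθ n) (hYle n) ht
  set R := D * R₀ with hR
  have hR0 : 0 ≤ R := by positivity
  have hYR : ∀ n, ∀ s ∈ Icc 0 T, ‖Y n s‖ ≤ R := by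
    intro n s hs
    refine (hYle n s hs).trans ?_
    have := hθ n s hs
    exact mul_le_mul_of_nonneg_left (hVR n _ ⟨this.1, this.2.trans hs.2⟩) hD0.le
  -- the delayed paths are uniformly close to the solutions
  have hclose : ∀ ε > 0, ∀ᶠ n in atTop, ∀ t ∈ Icc 0 T, ‖V n t - Y n t‖ ≤ ε := by
    intro ε hε
    obtain ⟨δ₀, hδ₀, hw⟩ := exists_integral_window_le hT.le
      (hF.integrable.const_mul (1 + R)) (ε := ε / D) (by positivity)
    filter_upwards [hδt.eventually_lt_const hδ₀] with n hn t ht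
    have hm := hθ n t ht
    have hmT : max (t - δ n) 0 ∈ Icc 0 T := ⟨hm.1, hm.2.trans ht.2⟩
    have e : V n t - Y n t = ∫ s in max (t - δ n) 0..t, S (t - s) (F s (Y n s)) := by
      rw [hYV n t ht, hVU n t ht, hVU n _ hmT,
        hS.mild_split hl hb x (hF.integrableOn (hYc n)) hm.1 hm.2 ht.2]
      abel
    rw [e]
    refine (norm_integral_semigroup_le hl hb (hF.integrable.const_mul (1 + R))
      (hF.ae_norm_le (hYc n) (hYR n)) hm.1 hm.2 ht.2).trans ?_
    calc D * _ ≤ D * (ε / D) := by gcongr; exact hw _ (hδ0 n).le hn t ht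
      _ = ε := by field_simp
  have hcauchy : CauchySeq U := by
    rw [Metric.cauchySeq_iff]
    intro η hη
    obtain ⟨ε, hε0, hε⟩ : ∃ ε : ℝ, 0 < ε ∧ 2 * ((16 * ε ^ 2 + 8 * ε * (1 + R)) * L)
        * Real.exp (2 * (2 * l * T + 4 * L)) < (η / 2) ^ 2 := by
      have h1 := ((tendsto_stability_const R L (2 * (2 * l * T + 4 * L))).eventually_lt_const
        (show (0 : ℝ) < (η / 2) ^ 2 by positivity)).filter_mono
        (nhdsWithin_le_nhds (s := Ioi 0))
      obtain ⟨ε, h2, h3⟩ := (h1.and self_mem_nhdsWithin).exists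
      exact ⟨ε, h3, h2⟩
    obtain ⟨N, hN⟩ := eventually_atTop.1 (hclose ε hε0)
    refine ⟨N, fun m hm n hn => ?_⟩
    refine lt_of_le_of_lt (norm_continuousMap_sub_le (by positivity) fun t => ?_)
      (half_lt_self hη)
    have h := hF.norm_sub_sq_le hS hl hb le_rfl (hYc m) (hYc n) (hVU m) (hVU n) hε0.le hR0 (hN m hm)
      (hN n hn) (hYR m) (hYR n) t.2
    simp only [hV, IccExtend_val] at h
    exact h.trans hε.le
  obtain ⟨u, hu⟩ := cauchySeq_tendsto_of_complete hcauchy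
  have huc : Continuous (IccExtend hT.le u) := u.continuous.Icc_extend'
  refine ⟨u, fun t => ?_⟩
  have hVu : ∀ s ∈ Icc 0 T, Tendsto (fun n => V n s) atTop (𝓝 (IccExtend hT.le u s)) := by
    intro s hs
    simp only [hV, IccExtend_of_mem _ _ hs]
    exact ((continuous_eval_const (F := C(Icc (0 : ℝ) T, H)) (⟨s, hs⟩ : Icc (0 : ℝ) T)).tendsto u).comp hu
  have hYu : ∀ s ∈ Icc 0 T, Tendsto (fun n => Y n s) atTop (𝓝 (IccExtend hT.le u s)) := by
    intro s hs
    have h0 : Tendsto (fun n => V n s - Y n s) atTop (𝓝 0) := by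
      rw [tendsto_zero_iff_norm_tendsto_zero, Metric.tendsto_atTop]
      intro ε hε
      obtain ⟨N, hN⟩ := eventually_atTop.1 (hclose (ε / 2) (half_pos hε))
      refine ⟨N, fun n hn => ?_⟩
      rw [dist_zero_right, norm_norm]
      exact (hN n hn s hs).trans_lt (half_lt_self hε)
    simpa using (hVu s hs).sub h0
  have hFu := hF.demi Y _ hYc huc hYu
  refine ext_inner_left ℝ fun y => ?_
  have hint : ∀ {φ : ℝ → H}, Continuous φ →
      IntervalIntegrable (fun s => S (t - s) (F s (φ s))) volume 0 t := fun hφ =>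
    hS.intervalIntegrable_apply hl hb (hF.integrableOn hφ) le_rfl t.2.1 le_rfl t.2.2
  have hinner : ∀ {φ : ℝ → H}, Continuous φ → inner ℝ y (mildConv S (fun s => F s (φ s)) t)
      = ∫ s in (0 : ℝ)..t, inner ℝ y (S (t - s) (F s (φ s))) := fun hφ =>
    ((innerSL ℝ y).intervalIntegral_comp_comm (hint hφ)).symm
  have hlim : Tendsto (fun n => inner ℝ y (mildConv S (fun s => F s (Y n s)) t)) atTop
      (𝓝 (inner ℝ y (mildConv S (fun s => F s (IccExtend hT.le u s)) t))) := by
    simp only [hinner huc, hinner (hYc _)]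
    have hsub : Ioc 0 (t : ℝ) ⊆ Icc 0 T := fun s hs => ⟨hs.1.le, hs.2.trans t.2.2⟩
    refine intervalIntegral.tendsto_integral_filter_of_dominated_convergence
      (fun s => ‖y‖ * (D * ((1 + R) * ℓ s))) ?_ ?_ ?_ ?_
    · refine Eventually.of_forall fun n => ?_
      rw [uIoc_of_le t.2.1]
      have := ((intervalIntegrable_iff_integrableOn_Ioc_of_le t.2.1).1
        (hint (hYc n))).aestronglyMeasurable
      exact aestronglyMeasurable_const.inner this
    · refine Eventually.of_forall fun n => ?_
      have := hF.ae_norm_le (hYc n) (hYR n)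
      rw [ae_restrict_iff' measurableSet_Icc] at this
      filter_upwards [this] with s hs hst
      rw [uIoc_of_le t.2.1] at hst
      refine (norm_inner_le_norm _ _).trans ?_
      gcongr
      refine (norm_semigroup_apply_le_of_le hl hb (by linarith [hst.2] : (0 : ℝ) ≤ t - s)
        (by linarith [hst.1, t.2.2] : (t : ℝ) - s ≤ T) _).trans ?_
      gcongr
      exact hs (hsub hst)
    · rw [intervalIntegrable_iff_integrableOn_Ioc_of_le t.2.1]
      exact IntegrableOn.mono_set (((hF.integrable.const_mul _).const_mul _).const_mul _) hsub
    · rw [ae_restrict_iff' measurableSet_Icc] at hFu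
      filter_upwards [hFu] with s hs hst
      rw [uIoc_of_le t.2.1] at hst
      have := hs (hsub hst) (ContinuousLinearMap.adjoint (S (t - s)) y)
      simp only [ContinuousLinearMap.adjoint_inner_right] at this
      simpa only [real_inner_comm y] using this
  have h1 : Tendsto (fun n => inner ℝ y (V n t)) atTop
      (𝓝 (inner ℝ y (S t x + mildConv S (fun s => F s (IccExtend hT.le u s)) t))) := by
    rw [inner_add_right]
    refine (hlim.const_add _).congr fun n => ?_
    rw [hVU n t t.2, inner_add_right]
  have h2 := (tendsto_const_nhds (x := y)).inner (𝕜 := ℝ) (hVu t t.2)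
  rw [IccExtend_val] at h2
  exact tendsto_nhds_unique h2 h1

end Existence

/-! ### Young's inequality for the relative entropy integrand -/

/-- `e^a - 1 - a`, the convex conjugate of `r ↦ klFun (1 + r)`. -/
noncomputable def expGap (a : ℝ) : ℝ := Real.exp a - 1 - a

theorem expGap_nonneg (a : ℝ) : 0 ≤ expGap a := by
  have := Real.add_one_le_exp a
  unfold expGap; linarith

theorem continuous_expGap : Continuous expGap := by unfold expGap; fun_prop

theorem expGap_mono {a b : ℝ} (ha : 0 ≤ a) (hab : a ≤ b) : expGap a ≤ expGap b := by
  unfold expGap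
  have h1 : Real.exp b = Real.exp a * Real.exp (b - a) := by rw [← Real.exp_add]; congr 1; ring
  have h2 := Real.add_one_le_exp (b - a)
  have h3 := Real.one_le_exp ha
  nlinarith

/-- **Young's inequality** for the dual pair `expGap`, `r ↦ klFun (1 + r)`. -/
theorem mul_sub_one_le_expGap_add_klFun (a : ℝ) {b : ℝ} (hb : 0 ≤ b) :
    a * (b - 1) ≤ expGap a + InformationTheory.klFun b := by
  rw [InformationTheory.klFun_apply]
  unfold expGap
  rcases hb.eq_or_lt with rfl | hb
  · have := Real.exp_pos a
    simp; linarith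
  · have h1 : Real.exp a = b * Real.exp (a - Real.log b) := by
      rw [Real.exp_sub, Real.exp_log hb]; field_simp
    have h2 := mul_le_mul_of_nonneg_left (Real.add_one_le_exp (a - Real.log b)) hb.le
    rw [h1]
    linarith

theorem expGap_neg_le {a : ℝ} (ha : 0 ≤ a) : expGap (-a) ≤ expGap a := by
  have := Real.self_le_sinh_iff.2 ha
  rw [Real.sinh_eq] at this
  unfold expGap; linarith

theorem mul_abs_sub_one_le {a b : ℝ} (ha : 0 ≤ a) (hb : 0 ≤ b) :
    a * |b - 1| ≤ expGap a + InformationTheory.klFun b := by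
  rcases abs_cases (b - 1) with ⟨h, -⟩ | ⟨h, -⟩
  · rw [h]; exact mul_sub_one_le_expGap_add_klFun a hb
  · rw [h]
    have := mul_sub_one_le_expGap_add_klFun (-a) hb
    have := expGap_neg_le ha
    linarith

theorem sq_sqrt_sub_one_le_klFun {r : ℝ} (hr : 0 ≤ r) :
    (√r - 1) ^ 2 ≤ InformationTheory.klFun r := by
  rw [InformationTheory.klFun_apply]
  rcases hr.eq_or_lt with rfl | hr'
  · simp
  · have hs : 0 < √r := Real.sqrt_pos.2 hr'
    have h1 := Real.one_sub_inv_le_log_of_pos hs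
    have h2 : Real.log r = 2 * Real.log (√r) := by
      rw [Real.log_sqrt hr]; ring
    have h3 : √r * √r = r := Real.mul_self_sqrt hr
    rw [h2]
    have h4 : r * (1 - (√r)⁻¹) ≤ r * Real.log √r := by gcongr
    have h5 : r * (√r)⁻¹ = √r := by
      field_simp; linarith [h3, sq √r]
    nlinarith

/-- The entropy controls the truncation of `r - 1` at height `m` in `L²`. -/
theorem sq_min_sub_one_le {m r : ℝ} (hm : 0 ≤ m) (hr : 0 ≤ r) :
    (min (r - 1) m) ^ 2 ≤ (√(m + 1) + 1) ^ 2 * InformationTheory.klFun r := by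
  refine le_trans ?_ (mul_le_mul_of_nonneg_left (sq_sqrt_sub_one_le_klFun hr) (sq_nonneg _))
  rw [← mul_pow, sq_le_sq, abs_mul, abs_of_nonneg (by positivity : 0 ≤ √(m + 1) + 1)]
  have hr2 : √r * √r = r := Real.mul_self_sqrt hr
  have hm2 : √(m + 1) * √(m + 1) = m + 1 := Real.mul_self_sqrt (by linarith)
  rcases le_total (r - 1) m with h | h
  · rw [min_eq_left h, show r - 1 = (√r + 1) * (√r - 1) by linarith, abs_mul,
      abs_of_nonneg (by positivity : 0 ≤ √r + 1)]
    gcongr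
    linarith
  · rw [min_eq_right h, abs_of_nonneg hm]
    have h1 : √(m + 1) ≤ √r := Real.sqrt_le_sqrt (by linarith)
    calc m = (√(m + 1) + 1) * (√(m + 1) - 1) := by linarith
      _ ≤ (√(m + 1) + 1) * |√r - 1| := by
        gcongr
        exact (by linarith : √(m + 1) - 1 ≤ √r - 1).trans (le_abs_self _)

/-- The entropy controls what the truncation of `r - 1` at height `e^c` leaves over, with a constant
that tends to `0` as `c → ∞`. This is the uniform integrability of entropy balls. -/
theorem sub_one_sub_min_le {c r : ℝ} (hc : 1 ≤ c) (hr : 0 ≤ r) :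
    r - 1 - min (r - 1) (Real.exp c) ≤ c⁻¹ * InformationTheory.klFun r := by
  have hk := InformationTheory.klFun_nonneg hr
  rcases le_total (r - 1) (Real.exp c) with h | h
  · rw [min_eq_left h, sub_self]; positivity
  · rw [min_eq_right h, ← sub_nonneg]
    have h1 := mul_sub_one_le_expGap_add_klFun c hr
    have h2 : expGap c ≤ c * Real.exp c := by
      unfold expGap; nlinarith [Real.exp_pos c]
    have h3 : 0 ≤ c⁻¹ * (c * Real.exp c + InformationTheory.klFun r - c * (r - 1)) :=
      mul_nonneg (by positivity) (by linarith)
    have h4 : c⁻¹ * (c * Real.exp c + InformationTheory.klFun r - c * (r - 1))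
      = Real.exp c + c⁻¹ * InformationTheory.klFun r - (r - 1) := by field_simp
    linarith

/-! ### The Orlicz heart paired with densities of bounded relative entropy -/

section Orlicz

variable {α : Type*} [MeasurableSpace α] {μ : Measure α} {E : Type*} [NormedAddCommGroup E]

/-- The functions all of whose multiples have integrable `e^{c‖Ψ‖} - 1 - c‖Ψ‖`: the Orlicz heart
dual to the densities `g` with `∫ klFun g < ∞`. -/
structure MemOrliczHeart (Ψ : α → E) (μ : Measure α) : Prop where
  aestronglyMeasurable : AEStronglyMeasurable Ψ μ
  integrable : ∀ c : ℝ, 0 ≤ c → Integrable (fun p => expGap (c * ‖Ψ p‖)) μ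

/-- The measurable densities `g ≥ 0` with `∫ klFun g dμ ≤ N`. -/
def entropyBall (μ : Measure α) (N : ℝ≥0) : Set (α → ℝ≥0) :=
  {g | Measurable g ∧ ∫⁻ p, ENNReal.ofReal (InformationTheory.klFun (g p)) ∂μ ≤ N}

theorem MemOrliczHeart.mono {F : Type*} [NormedAddCommGroup F] {Ψ : α → E} {Φ : α → F}
    (hΨ : MemOrliczHeart Ψ μ) (hΦ : AEStronglyMeasurable Φ μ) {C : ℝ} (hC : 0 ≤ C)
    (h : ∀ᵐ p ∂μ, ‖Φ p‖ ≤ C * ‖Ψ p‖) : MemOrliczHeart Φ μ := by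
  refine ⟨hΦ, fun c hc => (hΨ.integrable (c * C) (by positivity)).mono'
    (continuous_expGap.comp_aestronglyMeasurable (hΦ.norm.const_mul c)) ?_⟩
  filter_upwards [h] with p hp
  rw [Real.norm_of_nonneg (expGap_nonneg _), mul_assoc]
  exact expGap_mono (by positivity) (by gcongr)

theorem MemOrliczHeart.add {Ψ Φ : α → E} (hΨ : MemOrliczHeart Ψ μ) (hΦ : MemOrliczHeart Φ μ) :
    MemOrliczHeart (fun p => Ψ p + Φ p) μ := by
  have hm := hΨ.aestronglyMeasurable.add hΦ.aestronglyMeasurable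
  refine ⟨hm, fun c hc => ((hΨ.integrable (2 * c) (by positivity)).add
    (hΦ.integrable (2 * c) (by positivity))).mono'
    (continuous_expGap.comp_aestronglyMeasurable (hm.norm.const_mul c))
    (Eventually.of_forall fun p => ?_)⟩
  rw [Real.norm_of_nonneg (expGap_nonneg _), Pi.add_apply]
  have h := norm_add_le (Ψ p) (Φ p)
  rcases le_total ‖Ψ p‖ ‖Φ p‖ with h' | h'
  · refine le_trans (expGap_mono (by positivity) ?_) (le_add_of_nonneg_left (expGap_nonneg _))
    nlinarith
  · refine le_trans (expGap_mono (by positivity) ?_) (le_add_of_nonneg_right (expGap_nonneg _))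
    nlinarith

theorem memOrliczHeart_of_bounded {Ψ : α → E} (hΨ : AEStronglyMeasurable Ψ μ) {B : ℝ}
    (hB : ∀ p, ‖Ψ p‖ ≤ B) {A : Set α} (hA : MeasurableSet A) (hμA : μ A ≠ ∞)
    (h0 : ∀ p, p ∉ A → Ψ p = 0) : MemOrliczHeart Ψ μ := by
  refine ⟨hΨ, fun c hc => ?_⟩
  have hi : Integrable (A.indicator fun _ => expGap (c * B)) μ :=
    (integrable_indicator_iff hA).2 (integrableOn_const hμA)
  refine hi.mono' (continuous_expGap.comp_aestronglyMeasurable (hΨ.norm.const_mul c))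
    (Eventually.of_forall fun p => ?_)
  rw [Real.norm_of_nonneg (expGap_nonneg _)]
  by_cases hp : p ∈ A
  · rw [indicator_of_mem hp]
    exact expGap_mono (by positivity) (by gcongr; exact hB p)
  · rw [indicator_of_notMem hp, h0 p hp]
    simp [expGap]

variable {N : ℝ≥0} {g : α → ℝ≥0}

theorem integrable_klFun_of_mem (hg : g ∈ entropyBall μ N) :
    Integrable (fun p => InformationTheory.klFun (g p)) μ := by
  refine ⟨(InformationTheory.measurable_klFun.comp
    hg.1.coe_nnreal_real).aestronglyMeasurable, ?_⟩
  rw [hasFiniteIntegral_iff_ofReal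
    (Eventually.of_forall fun p => InformationTheory.klFun_nonneg (g p).coe_nonneg)]
  exact hg.2.trans_lt ENNReal.coe_lt_top

theorem integral_klFun_le_of_mem (hg : g ∈ entropyBall μ N) :
    ∫ p, InformationTheory.klFun (g p) ∂μ ≤ N := by
  rw [integral_eq_lintegral_of_nonneg_ae
    (Eventually.of_forall fun p => InformationTheory.klFun_nonneg (g p).coe_nonneg)
    (integrable_klFun_of_mem hg).aestronglyMeasurable]
  exact ENNReal.toReal_le_coe_of_le_coe hg.2

variable [NormedSpace ℝ E]

theorem aestronglyMeasurable_sub_one_smul (hg : Measurable g) {Ψ : α → E}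
    (hΨ : AEStronglyMeasurable Ψ μ) :
    AEStronglyMeasurable (fun p => ((g p : ℝ) - 1) • Ψ p) μ :=
  (hg.coe_nnreal_real.sub_const 1).aestronglyMeasurable.smul hΨ

theorem MemOrliczHeart.integrable_smul {Ψ : α → E} (hΨ : MemOrliczHeart Ψ μ)
    (hg : g ∈ entropyBall μ N) : Integrable (fun p => ((g p : ℝ) - 1) • Ψ p) μ := by
  refine ((hΨ.integrable 1 zero_le_one).add (integrable_klFun_of_mem hg)).mono'
    (aestronglyMeasurable_sub_one_smul hg.1 hΨ.aestronglyMeasurable) (Eventually.of_forall fun p => ?_)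
  rw [norm_smul, mul_comm, Real.norm_eq_abs, Pi.add_apply, one_mul]
  exact mul_abs_sub_one_le (norm_nonneg _) (g p).coe_nonneg

/-- The bound that makes the pairing equicontinuous: it is small when `c` is large and
`∫ expGap (c ‖Ψ‖)` is small, uniformly over the entropy ball. -/
theorem MemOrliczHeart.integral_norm_smul_le {Ψ : α → E} (hΨ : MemOrliczHeart Ψ μ)
    (hg : g ∈ entropyBall μ N) {c : ℝ} (hc : 0 < c) :
    ∫ p, ‖((g p : ℝ) - 1) • Ψ p‖ ∂μ ≤ c⁻¹ * ((∫ p, expGap (c * ‖Ψ p‖) ∂μ) + N) := by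
  have h1 : ∫ p, ‖((g p : ℝ) - 1) • Ψ p‖ ∂μ
      ≤ ∫ p, c⁻¹ * (expGap (c * ‖Ψ p‖) + InformationTheory.klFun (g p)) ∂μ := by
    refine integral_mono (hΨ.integrable_smul hg).norm
      (((hΨ.integrable c hc.le).add (integrable_klFun_of_mem hg)).const_mul _) fun p => ?_
    have := mul_abs_sub_one_le (a := c * ‖Ψ p‖) (by positivity) (g p).coe_nonneg
    dsimp only
    rw [norm_smul, Real.norm_eq_abs, le_inv_mul_iff₀ hc]
    calc _ = c * ‖Ψ p‖ * |(g p : ℝ) - 1| := by ring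
      _ ≤ _ := this
  refine h1.trans ?_
  rw [integral_const_mul, integral_add (hΨ.integrable c hc.le) (integrable_klFun_of_mem hg)]
  gcongr
  exact integral_klFun_le_of_mem hg

end Orlicz

/-! ### Weak compactness of entropy balls -/

/-- Bounded families in a Hilbert space have weak limits along ultrafilters (Banach–Alaoglu). -/
theorem exists_weak_limit {E : Type*} [NormedAddCommGroup E] [InnerProductSpace ℝ E]
    [CompleteSpace E] {ι : Type*} (𝓤 : Ultrafilter ι) (v : ι → E) {B : ℝ}
    (h : ∀ᶠ i in (𝓤 : Filter ι), ‖v i‖ ≤ B) :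
    ∃ w : E, ∀ f, Tendsto (fun i => inner ℝ (v i) f) 𝓤 (𝓝 (inner ℝ w f)) := by
  set V : ι → WeakDual ℝ E := fun i =>
    StrongDual.toWeakDual (InnerProductSpace.toDual ℝ E (v i)) with hV
  have hc := WeakDual.isCompact_closedBall (𝕜 := ℝ) (0 : StrongDual ℝ E) B
  obtain ⟨x, -, hx⟩ := hc.ultrafilter_le_nhds (𝓤.map V) (by
    rw [le_principal_iff]
    change ∀ᶠ i in (𝓤 : Filter ι), _
    filter_upwards [h] with i hi
    change WeakDual.toStrongDual (V i) ∈ Metric.closedBall _ _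
    rw [mem_closedBall_zero_iff]
    exact (LinearIsometryEquiv.norm_map (InnerProductSpace.toDual ℝ E) (v i)).le.trans hi)
  refine ⟨(InnerProductSpace.toDual ℝ E).symm (WeakDual.toStrongDual x), fun f => ?_⟩
  rw [InnerProductSpace.toDual_symm_apply]
  have : Tendsto (fun w : WeakDual ℝ E => w f) (𝓝 x) (𝓝 (x f)) :=
    (WeakDual.eval_continuous f).tendsto x
  exact this.comp (show Tendsto V 𝓤 (𝓝 x) from hx)

section Truncation

variable {α : Type*} [MeasurableSpace α] {μ : Measure α} {N : ℝ≥0}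

theorem measurable_min_sub_one {g : α → ℝ≥0} (hg : Measurable g) (m : ℝ) :
    Measurable fun p => min ((g p : ℝ) - 1) m :=
  (hg.coe_nnreal_real.sub_const 1).min measurable_const

theorem memLp_min_sub_one {g : α → ℝ≥0} (hg : g ∈ entropyBall μ N) {m : ℝ} (hm : 0 ≤ m) :
    MemLp (fun p => min ((g p : ℝ) - 1) m) 2 μ := by
  rw [memLp_two_iff_integrable_sq (measurable_min_sub_one hg.1 m).aestronglyMeasurable]
  refine ((integrable_klFun_of_mem hg).const_mul ((√(m + 1) + 1) ^ 2)).mono'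
    ((measurable_min_sub_one hg.1 m).pow_const 2).aestronglyMeasurable
    (Eventually.of_forall fun p => ?_)
  rw [Real.norm_of_nonneg (sq_nonneg _)]
  exact sq_min_sub_one_le hm (g p).coe_nonneg

theorem integral_sq_min_sub_one_le {g : α → ℝ≥0} (hg : g ∈ entropyBall μ N) {m : ℝ} (hm : 0 ≤ m) :
    ∫ p, (min ((g p : ℝ) - 1) m) ^ 2 ∂μ ≤ (√(m + 1) + 1) ^ 2 * N := by
  calc _ ≤ ∫ p, (√(m + 1) + 1) ^ 2 * InformationTheory.klFun (g p) ∂μ :=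
        integral_mono ((memLp_two_iff_integrable_sq
          (measurable_min_sub_one hg.1 m).aestronglyMeasurable).1 (memLp_min_sub_one hg hm))
          ((integrable_klFun_of_mem hg).const_mul _) fun p => sq_min_sub_one_le hm (g p).coe_nonneg
    _ ≤ _ := by
        rw [integral_const_mul]
        gcongr
        exact integral_klFun_le_of_mem hg

/-- The truncations `min (g - 1) m` are bounded in `L²`, hence have weak limits along
ultrafilters. -/
theorem exists_limit_min_sub_one (𝓤 : Ultrafilter (α → ℝ≥0)) (h𝓤 : entropyBall μ N ∈ 𝓤) {m : ℝ}
    (hm : 0 ≤ m) :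
    ∃ h : α → ℝ, StronglyMeasurable h ∧ MemLp h 2 μ ∧ ∀ f : α → ℝ, MemLp f 2 μ →
      Tendsto (fun g : α → ℝ≥0 => ∫ p, f p * min ((g p : ℝ) - 1) m ∂μ) 𝓤
        (𝓝 (∫ p, f p * h p ∂μ)) := by
  classical
  set v : (α → ℝ≥0) → Lp ℝ 2 μ := fun g =>
    if hg : g ∈ entropyBall μ N then (memLp_min_sub_one hg hm).toLp else 0 with hv
  have hve : ∀ {g} (hg : g ∈ entropyBall μ N),
      v g =ᵐ[μ] fun p => min ((g p : ℝ) - 1) m := by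
    intro g hg
    simp only [hv, dif_pos hg]
    exact (memLp_min_sub_one hg hm).coeFn_toLp
  obtain ⟨w, hw⟩ := exists_weak_limit 𝓤 v (B := √((√(m + 1) + 1) ^ 2 * N)) (by
    filter_upwards [h𝓤] with g hg
    refine Real.le_sqrt_of_sq_le ?_
    rw [← real_inner_self_eq_norm_sq, L2.inner_def]
    refine le_trans (le_of_eq ?_) (integral_sq_min_sub_one_le hg hm)
    refine integral_congr_ae ?_
    filter_upwards [hve hg] with p hp
    rw [hp]
    simp [sq])
  refine ⟨w, Lp.stronglyMeasurable w, Lp.memLp w, fun f hf => ?_⟩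
  have h1 := hw hf.toLp
  have h2 : ∀ u : Lp ℝ 2 μ, inner ℝ u hf.toLp = ∫ p, f p * u p ∂μ := by
    intro u
    rw [L2.inner_def]
    refine integral_congr_ae ?_
    filter_upwards [hf.coeFn_toLp] with p hp
    rw [hp]; simp
  rw [h2 w] at h1
  refine h1.congr' ?_
  filter_upwards [h𝓤] with g hg
  rw [h2]
  refine integral_congr_ae ?_
  filter_upwards [hve hg] with p hp
  rw [hp]

end Truncation

section WeakLimit

variable {α : Type*} [MeasurableSpace α] {μ : Measure α} {N : ℝ≥0}

theorem integral_indicator_one_mul {A : Set α} (hA : MeasurableSet A) (φ : α → ℝ) :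
    ∫ p, A.indicator (fun _ => (1 : ℝ)) p * φ p ∂μ = ∫ p in A, φ p ∂μ := by
  rw [← integral_indicator hA]
  congr 1 with p
  by_cases hp : p ∈ A <;> simp [hp]

theorem integrableOn_of_memLp_two {φ : α → ℝ} (hφ : MemLp φ 2 μ) {A : Set α} (hA : μ A < ∞) :
    IntegrableOn φ A μ := by
  have : IsFiniteMeasure (μ.restrict A) := ⟨by simpa using hA⟩
  exact (hφ.restrict A).integrable one_le_two

/-- Every ultrafilter on an entropy ball has a limit density: the limits `h j` of the truncations
`min (g - 1) (exp (j + 1))` increase with `j`, and differ from their supremum by at most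
`N / (j + 1)` in `L¹` on sets of finite measure. -/
theorem exists_truncation_limit [SigmaFinite μ] (𝓤 : Ultrafilter (α → ℝ≥0))
    (h𝓤 : entropyBall μ N ∈ 𝓤) :
    ∃ (g : α → ℝ≥0) (h : ℕ → α → ℝ), Measurable g ∧ (∀ j, MemLp (h j) 2 μ) ∧
      (∀ (j : ℕ) (f : α → ℝ), MemLp f 2 μ →
        Tendsto (fun g' : α → ℝ≥0 => ∫ p, f p * min ((g' p : ℝ) - 1) (Real.exp (j + 1)) ∂μ) 𝓤
          (𝓝 (∫ p, f p * h j p ∂μ))) ∧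
      ∀ (j : ℕ) (A : Set α), MeasurableSet A → μ A < ∞ →
        IntegrableOn (fun p => (g p : ℝ) - 1 - h j p) A μ ∧
        ∫ p in A, ‖(g p : ℝ) - 1 - h j p‖ ∂μ ≤ (j + 1 : ℝ)⁻¹ * N := by
  choose h hm hL2 hlim using fun j : ℕ =>
    exists_limit_min_sub_one (μ := μ) 𝓤 h𝓤 (Real.exp_pos ((j : ℝ) + 1)).le
  have hset : ∀ (j : ℕ) A, MeasurableSet A → μ A < ∞ →
      Tendsto (fun g' : α → ℝ≥0 => ∫ p in A, min ((g' p : ℝ) - 1) (Real.exp (j + 1)) ∂μ) 𝓤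
        (𝓝 (∫ p in A, h j p ∂μ)) := by
    intro j A hA hμA
    have := hlim j _ (memLp_indicator_const 2 hA (1 : ℝ) (Or.inr hμA.ne))
    simpa only [integral_indicator_one_mul hA] using this
  have hint : ∀ j A, μ A < ∞ → IntegrableOn (h j) A μ := fun j A hμA =>
    integrableOn_of_memLp_two (hL2 j) hμA
  have hτint : ∀ {g' : α → ℝ≥0} (j : ℕ) {A : Set α}, g' ∈ entropyBall μ N → μ A < ∞ →
      IntegrableOn (fun p => min ((g' p : ℝ) - 1) (Real.exp ((j : ℝ) + 1))) A μ :=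
    fun j A hg hμA => integrableOn_of_memLp_two (memLp_min_sub_one hg (Real.exp_pos _).le) hμA
  have hmono_exp : ∀ {j k : ℕ}, j ≤ k → Real.exp ((j : ℝ) + 1) ≤ Real.exp ((k : ℝ) + 1) :=
    fun hjk => by gcongr
  have hconst : ∀ A, μ A < ∞ → IntegrableOn (fun _ => (1 : ℝ)) A μ := fun A hμA =>
    integrableOn_const hμA.ne
  have hpos : ∀ j, 0 ≤ᵐ[μ] fun p => 1 + h j p := by
    intro j
    refine ae_nonneg_of_forall_setIntegral_nonneg_of_sigmaFinite
      (fun A _ hμA => (hconst A hμA).add (hint j A hμA)) fun A hA hμA => ?_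
    rw [integral_add (hconst A hμA) (hint j A hμA)]
    refine ge_of_tendsto ((hset j A hA hμA).const_add _) ?_
    filter_upwards [h𝓤] with g' hg'
    rw [← integral_add (hconst A hμA) (hτint j hg' hμA)]
    refine integral_nonneg fun p => ?_
    have h1 : (-1 : ℝ) ≤ min ((g' p : ℝ) - 1) (Real.exp ((j : ℝ) + 1)) :=
      le_min (by linarith [(g' p).coe_nonneg]) (by linarith [Real.exp_pos ((j : ℝ) + 1)])
    simp only [Pi.zero_apply]; linarith
  have hmono : ∀ j, ∀ᵐ p ∂μ, h j p ≤ h (j + 1) p := by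
    intro j
    have : 0 ≤ᵐ[μ] fun p => h (j + 1) p - h j p := by
      refine ae_nonneg_of_forall_setIntegral_nonneg_of_sigmaFinite
        (fun A _ hμA => (hint _ A hμA).sub (hint j A hμA)) fun A hA hμA => ?_
      rw [integral_sub (hint _ A hμA) (hint j A hμA), sub_nonneg]
      refine le_of_tendsto_of_tendsto (hset j A hA hμA) (hset (j + 1) A hA hμA) ?_
      filter_upwards [h𝓤] with g' hg'
      exact integral_mono (hτint j hg' hμA) (hτint (j + 1) hg' hμA)
        fun p => min_le_min_left _ (hmono_exp (Nat.le_succ j))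
    filter_upwards [this] with p hp
    simpa using hp
  have hwin : ∀ {j k A}, j ≤ k → MeasurableSet A → μ A < ∞ →
      ∫ p in A, (h k p - h j p) ∂μ ≤ (j + 1 : ℝ)⁻¹ * N := by
    intro j k A hjk hA hμA
    rw [integral_sub (hint k A hμA) (hint j A hμA)]
    refine le_of_tendsto ((hset k A hA hμA).sub (hset j A hA hμA)) ?_
    filter_upwards [h𝓤] with g' hg'
    rw [← integral_sub (hτint k hg' hμA) (hτint j hg' hμA)]
    have hkl := (integrable_klFun_of_mem hg').const_mul (j + 1 : ℝ)⁻¹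
    calc _ ≤ ∫ p in A, (j + 1 : ℝ)⁻¹ * InformationTheory.klFun (g' p) ∂μ := by
          refine integral_mono ((hτint k hg' hμA).sub (hτint j hg' hμA)) hkl.integrableOn fun p => ?_
          refine le_trans ?_ (sub_one_sub_min_le (by simp : (1 : ℝ) ≤ j + 1) (g' p).coe_nonneg)
          gcongr
          exact min_le_left _ _
      _ ≤ ∫ p, (j + 1 : ℝ)⁻¹ * InformationTheory.klFun (g' p) ∂μ :=
          setIntegral_le_integral hkl (Eventually.of_forall fun p =>
            mul_nonneg (by positivity) (InformationTheory.klFun_nonneg (g' p).coe_nonneg))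
      _ ≤ _ := by
          rw [integral_const_mul]
          gcongr
          exact integral_klFun_le_of_mem hg'
  set G : α → ℝ≥0∞ := fun p => ⨆ j, ENNReal.ofReal (1 + h j p) with hG
  have hGm : Measurable G :=
    Measurable.iSup fun j => ((hm j).measurable.const_add 1).ennreal_ofReal
  have hGfin : ∀ᵐ p ∂μ, G p < ∞ := by
    refine ae_of_forall_measure_lt_top_ae_restrict _ fun A hA hμA => ?_
    refine ae_lt_top hGm (ne_of_lt ?_)
    rw [lintegral_iSup_ae (fun j => ((hm j).measurable.const_add 1).ennreal_ofReal)]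
    · refine lt_of_le_of_lt (iSup_le fun j => ?_)
        (ENNReal.ofReal_lt_top (r := ∫ p in A, (1 + h 0 p) ∂μ + ((0 : ℕ) + 1 : ℝ)⁻¹ * N))
      have hi : IntegrableOn (fun p => 1 + h j p) A μ := (hconst A hμA).add (hint j A hμA)
      rw [← ofReal_integral_eq_lintegral_ofReal hi (ae_restrict_of_ae (hpos j))]
      refine ENNReal.ofReal_le_ofReal ?_
      have := hwin (Nat.zero_le j) hA hμA
      rw [integral_sub (hint j A hμA) (hint 0 A hμA)] at this
      rw [integral_add (hconst A hμA) (hint j A hμA), integral_add (hconst A hμA) (hint 0 A hμA)]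
      linarith
    · intro j
      filter_upwards [ae_restrict_of_ae (hmono j)] with p hp
      gcongr
  have hmonoall : ∀ᵐ p ∂μ, Monotone fun j => h j p := by
    filter_upwards [ae_all_iff.2 hmono] with p hp
    exact monotone_nat_of_le_succ hp
  refine ⟨fun p => (G p).toNNReal, h, hGm.ennreal_toNNReal, hL2, hlim, fun j A hA hμA => ?_⟩
  have hconv : ∀ᵐ p ∂μ, Tendsto (fun k => h k p) atTop (𝓝 (((G p).toNNReal : ℝ) - 1)) := by
    filter_upwards [hmonoall, hGfin, ae_all_iff.2 hpos] with p hp hfin hp0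
    have h1 : Tendsto (fun k => ENNReal.ofReal (1 + h k p)) atTop (𝓝 (G p)) :=
      tendsto_atTop_iSup fun i k hik => ENNReal.ofReal_le_ofReal (by have := hp hik; simpa using this)
    have h2 := ((ENNReal.tendsto_toReal hfin.ne).comp h1).sub_const 1
    refine h2.congr fun k => ?_
    have := hp0 k
    simp only [Function.comp_apply]
    rw [ENNReal.toReal_ofReal this]; ring
  have hnn : ∀ᵐ p ∂μ, 0 ≤ ((G p).toNNReal : ℝ) - 1 - h j p := by
    filter_upwards [hconv, hmonoall] with p hp hmp
    have := hmp.ge_of_tendsto hp j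
    linarith
  have hmeas : Measurable fun p => ((G p).toNNReal : ℝ) - 1 - h j p :=
    (hGm.ennreal_toNNReal.coe_nnreal_real.sub_const 1).sub (hm j).measurable
  have hfatou : ∫⁻ p in A, ENNReal.ofReal (((G p).toNNReal : ℝ) - 1 - h j p) ∂μ
      ≤ ENNReal.ofReal ((j + 1 : ℝ)⁻¹ * N) := by
    calc _ = ∫⁻ p in A, liminf (fun k => ENNReal.ofReal (h k p - h j p)) atTop ∂μ := by
          refine lintegral_congr_ae (ae_restrict_of_ae ?_)
          filter_upwards [hconv] with p hp
          exact ((ENNReal.continuous_ofReal.tendsto _).comp (hp.sub_const (h j p))).liminf_eq.symm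
      _ ≤ liminf (fun k => ∫⁻ p in A, ENNReal.ofReal (h k p - h j p) ∂μ) atTop :=
          lintegral_liminf_le fun k => ((hm k).measurable.sub (hm j).measurable).ennreal_ofReal
      _ ≤ _ := by
          refine liminf_le_of_frequently_le' (Eventually.frequently ?_)
          filter_upwards [eventually_ge_atTop j] with k hk
          have hi : IntegrableOn (fun p => h k p - h j p) A μ := (hint k A hμA).sub (hint j A hμA)
          rw [← ofReal_integral_eq_lintegral_ofReal hi]
          · exact ENNReal.ofReal_le_ofReal (hwin hk hA hμA)
          · filter_upwards [ae_restrict_of_ae hmonoall] with p hp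
            have := hp hk
            simpa using this
  have hI : IntegrableOn (fun p => ((G p).toNNReal : ℝ) - 1 - h j p) A μ := by
    refine ⟨hmeas.aestronglyMeasurable, ?_⟩
    rw [hasFiniteIntegral_iff_ofReal (ae_restrict_of_ae hnn)]
    exact hfatou.trans_lt ENNReal.ofReal_lt_top
  refine ⟨hI, ?_⟩
  rw [integral_congr_ae (g := fun p => ((G p).toNNReal : ℝ) - 1 - h j p)
    (by filter_upwards [ae_restrict_of_ae hnn] with p hp; exact Real.norm_of_nonneg hp),
    integral_eq_lintegral_of_nonneg_ae (ae_restrict_of_ae hnn) hmeas.aestronglyMeasurable]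
  exact ENNReal.toReal_le_of_le_ofReal (by positivity) hfatou

/-- The limit density, tested against bounded functions supported on sets of finite measure. -/
theorem exists_limit_of_bounded [SigmaFinite μ] (𝓤 : Ultrafilter (α → ℝ≥0))
    (h𝓤 : entropyBall μ N ∈ 𝓤) :
    ∃ g : α → ℝ≥0, Measurable g ∧ ∀ (f : α → ℝ) (A : Set α) (B : ℝ), 0 ≤ B → Measurable f →
      MeasurableSet A → μ A < ∞ → (∀ p, ‖f p‖ ≤ B) → (∀ p ∉ A, f p = 0) →
      Tendsto (fun g' : α → ℝ≥0 => ∫ p, ((g' p : ℝ) - 1) • f p ∂μ) 𝓤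
          (𝓝 (∫ p, ((g p : ℝ) - 1) • f p ∂μ)) ∧
        Integrable (fun p => ((g p : ℝ) - 1) • f p) μ := by
  obtain ⟨g, h, hgm, hL2, hlim, hclose⟩ := exists_truncation_limit 𝓤 h𝓤
  refine ⟨g, hgm, fun f A B hB0 hf hA hμA hB hfA => ?_⟩
  have hsupp : ∀ φ : α → ℝ, (∫ p, f p * φ p ∂μ) = ∫ p in A, f p * φ p ∂μ := fun φ =>
    (setIntegral_eq_integral_of_forall_compl_eq_zero fun p hp => by rw [hfA p hp, zero_mul]).symm
  have hf2 : MemLp f 2 μ := by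
    refine (memLp_indicator_const 2 hA B (Or.inr hμA.ne)).mono hf.aestronglyMeasurable
      (Eventually.of_forall fun p => ?_)
    by_cases hp : p ∈ A
    · rw [indicator_of_mem hp]; exact (hB p).trans (le_abs_self B)
    · rw [hfA p hp]; simp
  have hfheart : MemOrliczHeart f μ :=
    memOrliczHeart_of_bounded hf.aestronglyMeasurable hB hA hμA.ne hfA
  have hfh : ∀ j, Integrable (fun p => f p * h j p) μ := fun j => hf2.integrable_mul (hL2 j)
  have hbd : ∀ j, Integrable (fun p => f p * ((g p : ℝ) - 1 - h j p)) μ ∧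
      |∫ p, f p * ((g p : ℝ) - 1 - h j p) ∂μ| ≤ B * ((j + 1 : ℝ)⁻¹ * N) := by
    intro j
    obtain ⟨h1, h2⟩ := hclose j A hA hμA
    have h3 : IntegrableOn (fun p => f p * ((g p : ℝ) - 1 - h j p)) A μ :=
      h1.bdd_mul (c := B) hf.aestronglyMeasurable (Eventually.of_forall hB)
    refine ⟨(integrableOn_iff_integrable_of_support_subset ?_).1 h3, ?_⟩
    · intro p hp
      by_contra hpA
      exact hp (by simp [hfA p hpA])
    · rw [hsupp]
      have hnz : ∀ p, ‖f p * ((g p : ℝ) - 1 - h j p)‖ ≤ B * ‖(g p : ℝ) - 1 - h j p‖ := fun p => by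
        rw [norm_mul]; gcongr; exact hB p
      refine (norm_integral_le_of_norm_le (h1.norm.const_mul B)
        (Eventually.of_forall hnz)).trans ?_
      rw [integral_const_mul]
      gcongr
  have hfg : Integrable (fun p => f p * ((g p : ℝ) - 1)) μ := by
    refine ((hbd 0).1.add (hfh 0)).congr (Eventually.of_forall fun p => ?_)
    simp only [Pi.add_apply]; ring
  simp only [smul_eq_mul, mul_comm _ (f _)]
  refine ⟨?_, hfg⟩
  rw [Metric.tendsto_nhds]
  intro ε hε
  obtain ⟨j, hj⟩ : ∃ j : ℕ, B * ((j + 1 : ℝ)⁻¹ * N) < ε / 3 := by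
    have h1 : Tendsto (fun j : ℕ => B * ((j + 1 : ℝ)⁻¹ * N)) atTop (𝓝 0) := by
      have := ((tendsto_one_div_add_atTop_nhds_zero_nat (𝕜 := ℝ)).mul_const (N : ℝ)).const_mul B
      simpa using this
    exact (h1.eventually_lt_const (by positivity)).exists
  have hlimj := (Metric.tendsto_nhds.1 (hlim j f hf2)) (ε / 3) (by positivity)
  filter_upwards [hlimj, h𝓤] with g' h1 hg'
  have hfg' : Integrable (fun p => f p * ((g' p : ℝ) - 1)) μ := by
    simpa only [smul_eq_mul, mul_comm _ (f _)] using hfheart.integrable_smul hg'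
  have hfτ : Integrable (fun p => f p * min ((g' p : ℝ) - 1) (Real.exp (j + 1))) μ :=
    hf2.integrable_mul (memLp_min_sub_one hg' (Real.exp_pos _).le)
  have hkl := (integrable_klFun_of_mem hg').const_mul (j + 1 : ℝ)⁻¹
  have d1 : |∫ p, f p * ((g' p : ℝ) - 1) ∂μ
      - ∫ p, f p * min ((g' p : ℝ) - 1) (Real.exp (j + 1)) ∂μ| ≤ B * ((j + 1 : ℝ)⁻¹ * N) := by
    rw [← integral_sub hfg' hfτ, ← Real.norm_eq_abs]
    refine (norm_integral_le_of_norm_le (hkl.const_mul B)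
      (Eventually.of_forall fun p => ?_)).trans ?_
    · rw [← mul_sub, norm_mul]
      have h2 : 0 ≤ (g' p : ℝ) - 1 - min ((g' p : ℝ) - 1) (Real.exp (j + 1)) :=
        sub_nonneg.2 (min_le_left _ _)
      rw [Real.norm_of_nonneg h2]
      exact mul_le_mul (hB p) (sub_one_sub_min_le (by simp) (g' p).coe_nonneg) h2 hB0
    · rw [integral_const_mul, integral_const_mul]
      gcongr
      exact integral_klFun_le_of_mem hg'
  have d2 : |∫ p, f p * ((g p : ℝ) - 1) ∂μ - ∫ p, f p * h j p ∂μ|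
      ≤ B * ((j + 1 : ℝ)⁻¹ * N) := by
    rw [← integral_sub hfg (hfh j)]
    simpa only [mul_sub] using (hbd j).2
  rw [Real.dist_eq] at h1 ⊢
  rw [abs_lt] at h1 ⊢
  rw [abs_le] at d1 d2
  constructor <;> linarith [h1.1, h1.2, d1.1, d1.2, d2.1, d2.2]

/-! The lower semicontinuity of the entropy follows from its dual form: `klFun r` is the supremum
over `a` of `a (r - 1) - expGap a`, attained at `a = log r`. -/

/-- With `a = log r` truncated to `[-m, m]`, the dual expression stays nonnegative. -/
theorem dual_klFun_truncated (r : ℝ) {m : ℝ} (hm : 0 ≤ m) :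
    0 ≤ Real.log (max (Real.exp (-m)) (min r (Real.exp m))) * (r - 1)
      - expGap (Real.log (max (Real.exp (-m)) (min r (Real.exp m)))) := by
  have hem : Real.exp (-m) ≤ 1 := Real.exp_le_one_iff.2 (by linarith)
  have hem' : 1 ≤ Real.exp m := Real.one_le_exp hm
  set c := max (Real.exp (-m)) (min r (Real.exp m)) with hc
  have hc0 : 0 < c := lt_max_of_lt_left (Real.exp_pos _)
  have e : Real.log c * (r - 1) - expGap (Real.log c)
      = Real.log c * (r - c) + InformationTheory.klFun c := by
    rw [InformationTheory.klFun_apply]; unfold expGap; rw [Real.exp_log hc0]; ring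
  rw [e]
  have hk := InformationTheory.klFun_nonneg hc0.le
  have : 0 ≤ Real.log c * (r - c) := by
    rcases le_total r 1 with h | h
    · have h1 : c ≤ 1 := max_le hem (min_le_of_left_le h)
      have h2 : r ≤ c := by
        rw [hc, min_eq_left (h.trans hem')]; exact le_max_right _ _
      exact mul_nonneg_of_nonpos_of_nonpos (Real.log_nonpos hc0.le h1) (by linarith)
    · have h1 : 1 ≤ c := le_max_of_le_right (le_min h hem')
      have h2 : c ≤ r := max_le (hem.trans h) (min_le_left _ _)
      exact mul_nonneg (Real.log_nonneg h1) (by linarith)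
  linarith

theorem tendsto_dual_klFun {r : ℝ} (hr : 0 ≤ r) :
    Tendsto (fun m : ℕ => Real.log (max (Real.exp (-m)) (min r (Real.exp m))) * (r - 1)
      - expGap (Real.log (max (Real.exp (-m)) (min r (Real.exp m))))) atTop
      (𝓝 (InformationTheory.klFun r)) := by
  have hx : Tendsto (fun m : ℕ => Real.exp (m : ℝ)) atTop atTop :=
    Real.tendsto_exp_atTop.comp tendsto_natCast_atTop_atTop
  have hx' : Tendsto (fun m : ℕ => Real.exp (-(m : ℝ))) atTop (𝓝 0) :=
    Real.tendsto_exp_neg_atTop_nhds_zero.comp tendsto_natCast_atTop_atTop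
  rcases hr.eq_or_lt with rfl | hr'
  · have : Tendsto (fun m : ℕ => 1 - Real.exp (-(m : ℝ))) atTop (𝓝 1) := by
      simpa using hx'.const_sub 1
    rw [InformationTheory.klFun_zero]
    refine this.congr fun m => ?_
    rw [min_eq_left (Real.exp_pos _).le, max_eq_left (Real.exp_pos _).le, Real.log_exp]
    unfold expGap; ring
  · refine tendsto_const_nhds.congr' ?_
    filter_upwards [hx.eventually_ge_atTop r, hx'.eventually_le_const hr'] with m h1 h2
    rw [min_eq_left h1, max_eq_right h2, InformationTheory.klFun_apply]
    unfold expGap; rw [Real.exp_log hr']; ring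

/-- The entropy is lower semicontinuous: the dual form is tested with the bounded functions obtained
by truncating `log g` and restricting it to sets of finite measure, and Fatou's lemma removes the
truncation. -/
theorem mem_entropyBall_of_limit [SigmaFinite μ] (𝓤 : Ultrafilter (α → ℝ≥0))
    (h𝓤 : entropyBall μ N ∈ 𝓤) {g : α → ℝ≥0} (hgm : Measurable g)
    (hg : ∀ (f : α → ℝ) (A : Set α) (B : ℝ), 0 ≤ B → Measurable f →
      MeasurableSet A → μ A < ∞ → (∀ p, ‖f p‖ ≤ B) → (∀ p ∉ A, f p = 0) →
      Tendsto (fun g' : α → ℝ≥0 => ∫ p, ((g' p : ℝ) - 1) • f p ∂μ) 𝓤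
          (𝓝 (∫ p, ((g p : ℝ) - 1) • f p ∂μ)) ∧
        Integrable (fun p => ((g p : ℝ) - 1) • f p) μ) : g ∈ entropyBall μ N := by
  refine ⟨hgm, ?_⟩
  set φ : ℕ → α → ℝ := fun m p =>
    Real.log (max (Real.exp (-(m : ℝ))) (min (g p : ℝ) (Real.exp m))) with hφ
  set f : ℕ → α → ℝ := fun m => (spanningSets μ m).indicator (φ m) with hf
  have hφm : ∀ m, Measurable (φ m) := fun m =>
    Real.measurable_log.comp (measurable_const.max (hgm.coe_nnreal_real.min measurable_const))
  have hφb : ∀ m p, ‖φ m p‖ ≤ m := by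
    intro m p
    have hem : Real.exp (-(m : ℝ)) ≤ Real.exp m := Real.exp_le_exp.2 (by linarith [m.cast_nonneg (α := ℝ)])
    rw [Real.norm_eq_abs, abs_le]
    constructor
    · rw [Real.le_log_iff_exp_le (lt_max_of_lt_left (Real.exp_pos _))]; exact le_max_left _ _
    · rw [Real.log_le_iff_le_exp (lt_max_of_lt_left (Real.exp_pos _))]
      exact max_le hem (min_le_right _ _)
  have hAm : ∀ m, MeasurableSet (spanningSets μ m) := measurableSet_spanningSets μ
  have hfm : ∀ m, Measurable (f m) := fun m => (hφm m).indicator (hAm m)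
  have hfb : ∀ m p, ‖f m p‖ ≤ m := fun m p => (norm_indicator_le_norm_self _ _).trans (hφb m p)
  have hf0 : ∀ m, ∀ p ∉ spanningSets μ m, f m p = 0 := fun m p hp => indicator_of_notMem hp _
  have hheart : ∀ m, MemOrliczHeart (f m) μ := fun m =>
    memOrliczHeart_of_bounded (hfm m).aestronglyMeasurable (hfb m) (hAm m)
      (measure_spanningSets_lt_top μ m).ne (hf0 m)
  have hgap : ∀ m, Integrable (fun p => expGap (f m p)) μ := by
    intro m
    refine ((hheart m).integrable 1 zero_le_one).mono'
      (continuous_expGap.measurable.comp (hfm m)).aestronglyMeasurable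
      (Eventually.of_forall fun p => ?_)
    rw [Real.norm_of_nonneg (expGap_nonneg _), one_mul, Real.norm_eq_abs]
    rcases abs_cases (f m p) with ⟨h, -⟩ | ⟨h, h'⟩
    · rw [h]
    · rw [h]
      have := expGap_neg_le (a := -f m p) (by linarith)
      rwa [neg_neg] at this
  have hfg := fun m => hg (f m) _ m m.cast_nonneg (hfm m) (hAm m)
    (measure_spanningSets_lt_top μ m) (hfb m) (hf0 m)
  have hle : ∀ m, ∫ p, (((g p : ℝ) - 1) • f m p - expGap (f m p)) ∂μ ≤ N := by
    intro m
    rw [integral_sub (hfg m).2 (hgap m)]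
    refine le_of_tendsto ((hfg m).1.sub_const _) ?_
    filter_upwards [h𝓤] with g' hg'
    rw [← integral_sub ((hheart m).integrable_smul hg') (hgap m)]
    refine (integral_mono (((hheart m).integrable_smul hg').sub (hgap m))
      (integrable_klFun_of_mem hg') fun p => ?_).trans (integral_klFun_le_of_mem hg')
    have := mul_sub_one_le_expGap_add_klFun (f m p) (g' p).coe_nonneg
    simp only [smul_eq_mul, Pi.sub_apply]
    linarith
  have hnn : ∀ m p, 0 ≤ ((g p : ℝ) - 1) • f m p - expGap (f m p) := by
    intro m p
    by_cases hp : p ∈ spanningSets μ m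
    · have := dual_klFun_truncated (g p) (m.cast_nonneg (α := ℝ))
      simp only [hf, indicator_of_mem hp, hφ, smul_eq_mul]
      linarith
    · rw [hf0 m p hp]; simp [expGap]
  have hlim : ∀ p, Tendsto (fun m => ((g p : ℝ) - 1) • f m p - expGap (f m p)) atTop
      (𝓝 (InformationTheory.klFun (g p))) := by
    intro p
    refine (tendsto_dual_klFun (g p).coe_nonneg).congr' ?_
    filter_upwards [eventually_ge_atTop (spanningSetsIndex μ p)] with m hm
    have hp : p ∈ spanningSets μ m := monotone_spanningSets μ hm (mem_spanningSetsIndex μ p)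
    simp only [hf, indicator_of_mem hp, hφ, smul_eq_mul]
    ring
  have hmeas : ∀ m, Measurable fun p => ((g p : ℝ) - 1) • f m p - expGap (f m p) := fun m =>
    ((hgm.coe_nnreal_real.sub_const 1).smul (hfm m)).sub (continuous_expGap.measurable.comp (hfm m))
  calc ∫⁻ p, ENNReal.ofReal (InformationTheory.klFun (g p)) ∂μ
      = ∫⁻ p, liminf (fun m => ENNReal.ofReal (((g p : ℝ) - 1) • f m p - expGap (f m p))) atTop ∂μ :=
        lintegral_congr fun p =>
          ((ENNReal.continuous_ofReal.tendsto _).comp (hlim p)).liminf_eq.symm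
    _ ≤ liminf (fun m => ∫⁻ p, ENNReal.ofReal (((g p : ℝ) - 1) • f m p - expGap (f m p)) ∂μ) atTop :=
        lintegral_liminf_le fun m => (hmeas m).ennreal_ofReal
    _ ≤ N := by
        refine liminf_le_of_frequently_le' (Frequently.of_forall fun m => ?_)
        have hi : Integrable (fun p => ((g p : ℝ) - 1) • f m p - expGap (f m p)) μ :=
          (hfg m).2.sub (hgap m)
        rw [← ofReal_integral_eq_lintegral_ofReal hi (Eventually.of_forall (hnn m))]
        exact ENNReal.ofReal_le_of_le_toReal (by simpa using hle m)

end WeakLimit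

section WeakCompactness

variable {α : Type*} [MeasurableSpace α] {μ : Measure α} {N : ℝ≥0}
  {E : Type*} [NormedAddCommGroup E] [NormedSpace ℝ E] [CompleteSpace E]

/-- Convergence against bounded real functions supported on sets of finite measure passes to
vector-valued simple functions, by linearity. -/
theorem tendsto_integral_indicator_simpleFunc {𝓤 : Filter (α → ℝ≥0)}
    (h𝓤 : entropyBall μ N ∈ 𝓤) {g : α → ℝ≥0} (hgN : g ∈ entropyBall μ N)
    (hg : ∀ (f : α → ℝ) (A : Set α) (B : ℝ), 0 ≤ B → Measurable f →
      MeasurableSet A → μ A < ∞ → (∀ p, ‖f p‖ ≤ B) → (∀ p ∉ A, f p = 0) →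
      Tendsto (fun g' : α → ℝ≥0 => ∫ p, ((g' p : ℝ) - 1) • f p ∂μ) 𝓤
          (𝓝 (∫ p, ((g p : ℝ) - 1) • f p ∂μ)))
    {A : Set α} (hA : MeasurableSet A) (hμA : μ A < ∞) (s : SimpleFunc α E) :
    Tendsto (fun g' : α → ℝ≥0 => ∫ p, ((g' p : ℝ) - 1) • A.indicator s p ∂μ) 𝓤
      (𝓝 (∫ p, ((g p : ℝ) - 1) • A.indicator s p ∂μ)) := by
  induction s using SimpleFunc.induction with
  | const y hB =>
    rename_i B
    have e : ∀ g' : α → ℝ≥0, ∫ p, ((g' p : ℝ) - 1) • A.indicator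
        (SimpleFunc.piecewise B hB (SimpleFunc.const α y) (SimpleFunc.const α 0)) p ∂μ
        = (∫ p, ((g' p : ℝ) - 1) • (A ∩ B).indicator (fun _ => (1 : ℝ)) p ∂μ) • y := by
      intro g'
      rw [← integral_smul_const]
      congr 1 with p
      by_cases hp : p ∈ A <;> by_cases hp' : p ∈ B <;> simp [hp, hp']
    simp only [e]
    refine (hg _ (A ∩ B) 1 zero_le_one (measurable_const.indicator (hA.inter hB)) (hA.inter hB)
      ((measure_mono inter_subset_left).trans_lt hμA) (fun p => ?_)
      fun p hp => indicator_of_notMem hp _).smul_const y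
    exact (norm_indicator_le_norm_self _ _).trans (by simp)
  | add hd h1 h2 =>
    rename_i s t
    have hh : ∀ s : SimpleFunc α E, MemOrliczHeart (A.indicator s) μ := by
      intro s
      obtain ⟨B, hB⟩ := s.exists_forall_norm_le
      exact memOrliczHeart_of_bounded
        (s.stronglyMeasurable.indicator hA).aestronglyMeasurable
        (fun p => (norm_indicator_le_norm_self _ _).trans (hB p)) hA hμA.ne
        fun p hp => indicator_of_notMem hp _
    have e : ∀ g' ∈ entropyBall μ N, ∫ p, ((g' p : ℝ) - 1) • A.indicator (s + t) p ∂μ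
        = (∫ p, ((g' p : ℝ) - 1) • A.indicator s p ∂μ)
          + ∫ p, ((g' p : ℝ) - 1) • A.indicator t p ∂μ := by
      intro g' hg'
      rw [← integral_add ((hh s).integrable_smul hg') ((hh t).integrable_smul hg')]
      congr 1 with p
      rw [← smul_add]
      by_cases hp : p ∈ A <;> simp [hp]
    rw [e g hgN]
    refine (h1.add h2).congr' ?_
    filter_upwards [h𝓤] with g' hg'
    exact (e g' hg').symm

omit [NormedSpace ℝ E] [CompleteSpace E] in
/-- Dominated convergence in the Orlicz heart. -/
theorem MemOrliczHeart.tendsto_integral_expGap_sub {Ψ Θ : α → E} (hΨ : MemOrliczHeart Ψ μ)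
    (hΘ : AEStronglyMeasurable Θ μ) {ι : Type*} {L : Filter ι} [L.IsCountablyGenerated]
    {Φ : ι → α → E} (hΦm : ∀ i, AEStronglyMeasurable (Φ i) μ) {C : ℝ} (hC : 0 ≤ C)
    (hΦ : ∀ᶠ i in L, ∀ᵐ p ∂μ, ‖Θ p - Φ i p‖ ≤ C * ‖Ψ p‖)
    (hlim : ∀ᵐ p ∂μ, Tendsto (fun i => Φ i p) L (𝓝 (Θ p))) {c : ℝ} (hc : 0 ≤ c) :
    Tendsto (fun i => ∫ p, expGap (c * ‖Θ p - Φ i p‖) ∂μ) L (𝓝 0) := by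
  have h0 : (0 : ℝ) = ∫ p : α, (0 : ℝ) ∂μ := by simp
  rw [h0]
  refine tendsto_integral_filter_of_dominated_convergence (fun p => expGap (c * C * ‖Ψ p‖)) ?_ ?_
    (hΨ.integrable (c * C) (by positivity)) ?_
  · exact Eventually.of_forall fun i => continuous_expGap.comp_aestronglyMeasurable
      ((hΘ.sub (hΦm i)).norm.const_mul c)
  · filter_upwards [hΦ] with i hi
    filter_upwards [hi] with p hp
    rw [Real.norm_of_nonneg (expGap_nonneg _), mul_assoc]
    exact expGap_mono (by positivity) (by gcongr)
  · filter_upwards [hlim] with p hp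
    have h1 : Tendsto (fun i => c * ‖Θ p - Φ i p‖) L (𝓝 0) := by
      simpa using ((hp.const_sub (Θ p)).norm.const_mul c)
    have h2 : expGap 0 = 0 := by simp [expGap]
    have := (continuous_expGap.tendsto 0).comp h1
    rwa [h2] at this

/-- **Weak compactness of entropy balls**: every ultrafilter on `entropyBall μ N` has a limit in
it, in the topology of testing against vector-valued functions in the Orlicz heart. -/
theorem exists_weak_limit_entropyBall [SigmaFinite μ] (𝓤 : Ultrafilter (α → ℝ≥0))
    (h𝓤 : entropyBall μ N ∈ 𝓤) :
    ∃ g ∈ entropyBall μ N, ∀ Ψ : α → E, MemOrliczHeart Ψ μ →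
      Tendsto (fun g' : α → ℝ≥0 => ∫ p, ((g' p : ℝ) - 1) • Ψ p ∂μ) 𝓤
        (𝓝 (∫ p, ((g p : ℝ) - 1) • Ψ p ∂μ)) := by
  obtain ⟨g, hgm, hg⟩ := exists_limit_of_bounded 𝓤 h𝓤
  have hgN := mem_entropyBall_of_limit 𝓤 h𝓤 hgm hg
  refine ⟨g, hgN, fun Ψ hΨ => ?_⟩
  have hsm := hΨ.aestronglyMeasurable
  set Ψ' := hsm.mk Ψ with hΨ'
  have hsm' : StronglyMeasurable Ψ' := hsm.stronglyMeasurable_mk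
  set A : ℕ → Set α := fun n => spanningSets μ n ∩ {p | ‖hsm'.approx n p‖ ≤ 2 * ‖Ψ' p‖} with hA
  have hAm : ∀ n, MeasurableSet (A n) := fun n => (measurableSet_spanningSets μ n).inter
    (measurableSet_le (hsm'.approx n).stronglyMeasurable.norm.measurable
      (hsm'.norm.measurable.const_mul 2))
  have hμA : ∀ n, μ (A n) < ∞ := fun n =>
    (measure_mono inter_subset_left).trans_lt (measure_spanningSets_lt_top μ n)
  set Φ : ℕ → α → E := fun n => (A n).indicator (hsm'.approx n) with hΦ
  have hΦm : ∀ n, AEStronglyMeasurable (Φ n) μ := fun n =>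
    ((hsm'.approx n).stronglyMeasurable.indicator (hAm n)).aestronglyMeasurable
  have hΦle : ∀ n, ∀ᵐ p ∂μ, ‖Φ n p‖ ≤ 2 * ‖Ψ p‖ := by
    intro n
    filter_upwards [hsm.ae_eq_mk] with p hp
    by_cases hpA : p ∈ A n
    · rw [hp]; simp only [hΦ, indicator_of_mem hpA]; exact hpA.2
    · simp only [hΦ, indicator_of_notMem hpA, norm_zero]; positivity
  have hΦheart : ∀ n, MemOrliczHeart (Φ n) μ := fun n =>
    hΨ.mono (hΦm n) zero_le_two (hΦle n)
  have hΦsub : ∀ n, ∀ᵐ p ∂μ, ‖Ψ p - Φ n p‖ ≤ 3 * ‖Ψ p‖ := by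
    intro n
    filter_upwards [hΦle n] with p hp
    exact (norm_sub_le _ _).trans (by linarith)
  have hlim : ∀ᵐ p ∂μ, Tendsto (fun n => Φ n p) atTop (𝓝 (Ψ p)) := by
    filter_upwards [hsm.ae_eq_mk] with p hp
    rw [hp]
    have h1 := hsm'.tendsto_approx p
    by_cases h0 : Ψ' p = 0
    · have : ∀ n, Φ n p = 0 := by
        intro n
        by_cases hpA : p ∈ A n
        · have h2 : ‖hsm'.approx n p‖ ≤ 2 * ‖Ψ' p‖ := hpA.2
          rw [h0, norm_zero, mul_zero, norm_le_zero_iff] at h2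
          simp only [hΦ, indicator_of_mem hpA, h2]
        · simp only [hΦ, indicator_of_notMem hpA]
      simp only [this]
      exact h0 ▸ tendsto_const_nhds
    · refine h1.congr' ?_
      have h2 : ‖Ψ' p‖ < 2 * ‖Ψ' p‖ := by have := norm_pos_iff.2 h0; linarith
      filter_upwards [h1.norm.eventually_le_const h2,
        eventually_ge_atTop (spanningSetsIndex μ p)] with n hn hn'
      have hpA : p ∈ A n :=
        ⟨monotone_spanningSets μ hn' (mem_spanningSetsIndex μ p), hn⟩
      simp only [hΦ, indicator_of_mem hpA]
  have hsimple : ∀ n, Tendsto (fun g' : α → ℝ≥0 => ∫ p, ((g' p : ℝ) - 1) • Φ n p ∂μ) 𝓤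
      (𝓝 (∫ p, ((g p : ℝ) - 1) • Φ n p ∂μ)) := fun n =>
    tendsto_integral_indicator_simpleFunc h𝓤 hgN
      (fun f A B hB hf hA hμA hfB hfA => (hg f A B hB hf hA hμA hfB hfA).1) (hAm n) (hμA n) _
  rw [Metric.tendsto_nhds]
  intro ε hε
  -- `c` absorbs the entropy bound `N`, then `n` makes the exponential term small
  obtain ⟨c, hc0, hc⟩ : ∃ c : ℝ, 0 < c ∧ c⁻¹ * (1 + N) < ε / 3 := by
    refine ⟨(1 + N) * 6 / ε, by positivity, ?_⟩
    rw [inv_div]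
    have : (0 : ℝ) < 1 + N := by positivity
    field_simp
    norm_num
  have h3 := hΨ.tendsto_integral_expGap_sub hΨ.aestronglyMeasurable hΦm
    (by norm_num : (0 : ℝ) ≤ 3) (Eventually.of_forall hΦsub) hlim hc0.le
  obtain ⟨n, hn⟩ := (h3.eventually_le_const one_pos).exists
  have hsubheart : MemOrliczHeart (fun p => Ψ p - Φ n p) μ :=
    hΨ.mono (hΨ.aestronglyMeasurable.sub (hΦm n)) (by norm_num) (hΦsub n)
  have hd : ∀ g' ∈ entropyBall μ N,
      dist (∫ p, ((g' p : ℝ) - 1) • Ψ p ∂μ) (∫ p, ((g' p : ℝ) - 1) • Φ n p ∂μ) < ε / 3 := by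
    intro g' hg'
    rw [dist_eq_norm, ← integral_sub (hΨ.integrable_smul hg') ((hΦheart n).integrable_smul hg')]
    simp only [← smul_sub]
    refine (norm_integral_le_integral_norm _).trans_lt (lt_of_le_of_lt ?_ hc)
    refine (hsubheart.integral_norm_smul_le hg' hc0).trans ?_
    gcongr
  filter_upwards [h𝓤, (Metric.tendsto_nhds.1 (hsimple n)) (ε / 3) (by positivity)] with g' hg' h4
  have d1 := hd g' hg'
  have d2 := hd g hgN
  rw [dist_comm] at d2
  have := dist_triangle4 (∫ p, ((g' p : ℝ) - 1) • Ψ p ∂μ) (∫ p, ((g' p : ℝ) - 1) • Φ n p ∂μ)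
    (∫ p, ((g p : ℝ) - 1) • Φ n p ∂μ) (∫ p, ((g p : ℝ) - 1) • Ψ p ∂μ)
  linarith

end WeakCompactness

/-! ### Weak limits of simple functions -/

section WeakMeasurability

variable {H : Type*} [NormedAddCommGroup H] [InnerProductSpace ℝ H] [CompleteSpace H]
  {α : Type*} [MeasurableSpace α]

/-- A pointwise weak limit of simple functions is strongly measurable: its projections onto the
finite-dimensional spaces spanned by the values of the first `n` functions are measurable, and
they converge strongly to it. -/
theorem stronglyMeasurable_of_tendsto_weak {h : α → H} (s : ℕ → SimpleFunc α H)
    (hs : ∀ p y, Tendsto (fun n => inner ℝ (s n p) y) atTop (𝓝 (inner ℝ (h p) y))) :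
    StronglyMeasurable h := by
  set V : ℕ → Submodule ℝ H := fun n =>
    Submodule.span ℝ (⋃ k ∈ Finset.range n, (s k).range : Set H) with hV
  have hfin : ∀ n, FiniteDimensional ℝ (V n) := fun n =>
    FiniteDimensional.span_of_finite ℝ ((Finset.range n).finite_toSet.biUnion
      fun k _ => (s k).range.finite_toSet)
  have hVm : Monotone V := fun m n hmn =>
    Submodule.span_mono (biUnion_subset_biUnion_left (by simpa using hmn))
  have hmem : ∀ k p, s k p ∈ V (k + 1) := fun k p =>
    Submodule.subset_span (mem_biUnion (x := k) (by simp) (SimpleFunc.mem_range_self _ _))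
  have hcl : ∀ p, h p ∈ (⨆ n, V n).topologicalClosure := by
    intro p
    rw [← Submodule.orthogonal_orthogonal_eq_closure, Submodule.mem_orthogonal]
    intro y hy
    rw [real_inner_comm]
    refine tendsto_nhds_unique (hs p y) ?_
    refine tendsto_const_nhds.congr fun k => ?_
    exact ((Submodule.mem_orthogonal _ _).1 hy _ (Submodule.mem_iSup_of_mem _ (hmem k p))).symm
  have hin : ∀ y, Measurable fun p => inner ℝ (h p) y := by
    intro y
    refine measurable_of_tendsto_metrizable (f := fun n p => inner ℝ (s n p) y) (fun n => ?_)
      (tendsto_pi_nhds.2 fun p => hs p y)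
    exact ((s n).stronglyMeasurable.inner stronglyMeasurable_const).measurable
  refine stronglyMeasurable_of_tendsto atTop (f := fun n p => (V n).starProjection (h p))
    (fun n => ?_) (tendsto_pi_nhds.2 fun p => ?_)
  · have e : (fun p => (V n).starProjection (h p)) = fun p =>
        ∑ i, inner ℝ (h p) (stdOrthonormalBasis ℝ (V n) i : H) •
          (stdOrthonormalBasis ℝ (V n) i : H) := by
      ext p
      rw [Submodule.starProjection_apply,
        (stdOrthonormalBasis ℝ (V n)).orthogonalProjectionOnto_apply_eq_sum]
      simp [real_inner_comm]
    rw [e]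
    refine Finset.stronglyMeasurable_fun_sum _ fun i _ => ?_
    exact (hin _).stronglyMeasurable.smul_const _
  · have := Submodule.starProjection_tendsto_closure_iSup V hVm (h p)
    rwa [Submodule.starProjection_eq_self_iff.2 (hcl p)] at this

theorem Demicontinuous.stronglyMeasurable_comp {f : H → H} (hf : Demicontinuous f) {φ : α → H}
    (hφ : StronglyMeasurable φ) : StronglyMeasurable fun p => f (φ p) :=
  stronglyMeasurable_of_tendsto_weak (fun n => (hφ.approx n).map f)
    fun p y => hf _ _ (hφ.tendsto_approx p) y

end WeakMeasurability

/-! ### Exponential integrability and the Orlicz heart -/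

section Heart

theorem expGap_le_sq_mul_exp {x : ℝ} (hx : 0 ≤ x) : expGap x ≤ x ^ 2 * Real.exp x := by
  have h1 : Real.exp x - 1 ≤ x * Real.exp x := by
    have h2 := Real.add_one_le_exp (-x)
    have h3 : Real.exp (-x) * Real.exp x = 1 := by rw [← Real.exp_add]; simp
    nlinarith [Real.exp_pos x]
  unfold expGap
  nlinarith

theorem mul_le_sq_add {c δ a : ℝ} (hδ : 0 < δ) : c * a ≤ c ^ 2 / (4 * δ) + δ * a ^ 2 := by
  have : c ^ 2 / (4 * δ) + δ * a ^ 2 - c * a = (c - 2 * δ * a) ^ 2 / (4 * δ) := by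
    field_simp; ring
  have : 0 ≤ (c - 2 * δ * a) ^ 2 / (4 * δ) := by positivity
  linarith

variable {X : Type*} [MeasurableSpace X] {ν : Measure X} {T : ℝ}

theorem ae_nuT_mem [SFinite ν] : ∀ᵐ p ∂nuT T ν, p.1 ∈ Icc 0 T :=
  Measure.quasiMeasurePreserving_fst.ae (ae_restrict_mem measurableSet_Icc)

/-- A square integrable function with locally integrable `exp (δ k²)` lies in the Orlicz heart:
where `k ≤ 1` the function `e^{ck} - 1 - ck` is of order `k²`, and `{k > 1}` has finite measure. -/
theorem memOrliczHeart_toReal [SFinite ν] {k : ℝ × X → ℝ≥0∞} (hk : AEMeasurable k (nuT T ν))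
    (hk2 : ∫⁻ p, k p ^ 2 ∂nuT T ν < ∞) {δ : ℝ} (hδ : 0 < δ) (hexp : ExpSqIntegrable T ν δ k) :
    MemOrliczHeart (fun p => (k p).toReal) (nuT T ν) := by
  have hm : AEMeasurable (fun p => (k p).toReal) (nuT T ν) := hk.ennreal_toReal
  refine ⟨hm.aestronglyMeasurable, fun c hc => ?_⟩
  refine ⟨continuous_expGap.comp_aestronglyMeasurable
    (hm.aestronglyMeasurable.norm.const_mul c), ?_⟩
  rw [hasFiniteIntegral_iff_ofReal (Eventually.of_forall fun p => expGap_nonneg _)]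
  set E : Set (ℝ × X) := {p | 1 < hk.mk k p} ∩ Icc 0 T ×ˢ univ with hE
  have hEm : MeasurableSet E := (measurableSet_lt measurable_const hk.measurable_mk).inter
    (measurableSet_Icc.prod MeasurableSet.univ)
  have hμE : nuT T ν E < ∞ := by
    have h1 : nuT T ν E ≤ ∫⁻ p, hk.mk k p ^ 2 ∂nuT T ν := by
      rw [← setLIntegral_one]
      refine (setLIntegral_mono_ae (hk.measurable_mk.pow_const 2).aemeasurable
        (Eventually.of_forall fun p hp => ?_)).trans (setLIntegral_le_lintegral E _)
      exact one_le_pow₀ (le_of_lt hp.1)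
    refine h1.trans_lt ?_
    rw [lintegral_congr_ae (g := fun p => k p ^ 2)]
    · exact hk2
    · filter_upwards [hk.ae_eq_mk] with p hp
      rw [hp]
  have hexpE := hexp E hEm inter_subset_right hμE
  have hbound : ∀ᵐ p ∂nuT T ν, ENNReal.ofReal (expGap (c * ‖(k p).toReal‖))
      ≤ ENNReal.ofReal (c ^ 2 * Real.exp c) * k p ^ 2
        + ENNReal.ofReal (Real.exp (c ^ 2 / (4 * δ))) *
          E.indicator (fun p => EReal.exp ((δ : EReal) * ((k p ^ 2 : ℝ≥0∞) : EReal))) p := by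
    filter_upwards [hk.ae_eq_mk, ae_nuT_mem (T := T) (ν := ν)] with p hp hpT
    by_cases htop : k p = ∞
    · simp [htop, expGap]
    obtain ⟨a, ha⟩ : ∃ a : ℝ≥0, (a : ℝ≥0∞) = k p := ⟨(k p).toNNReal, ENNReal.coe_toNNReal htop⟩
    have hta : (k p).toReal = a := by rw [← ha]; simp
    rw [hta, Real.norm_of_nonneg a.coe_nonneg]
    rcases le_or_gt a 1 with h1 | h1
    · refine le_trans ?_ le_self_add
      rw [← ha, ← ENNReal.coe_pow, ENNReal.coe_nnreal_eq (a ^ 2),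
        ← ENNReal.ofReal_mul (by positivity)]
      refine ENNReal.ofReal_le_ofReal ((expGap_le_sq_mul_exp (by positivity)).trans ?_)
      have : c * (a : ℝ) ≤ c := by
        have : (a : ℝ) ≤ 1 := by exact_mod_cast h1
        nlinarith
      push_cast
      calc (c * (a : ℝ)) ^ 2 * Real.exp (c * a) ≤ (c * (a : ℝ)) ^ 2 * Real.exp c := by gcongr
        _ = _ := by ring
    · refine le_trans ?_ le_add_self
      have hpE : p ∈ E := by
        refine ⟨?_, hpT, trivial⟩
        change 1 < hk.mk k p
        rw [← hp, ← ha]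
        exact_mod_cast h1
      rw [indicator_of_mem hpE]
      have e1 : (δ : EReal) * ((k p ^ 2 : ℝ≥0∞) : EReal) = ((δ * (a : ℝ) ^ 2 : ℝ) : EReal) := by
        rw [← ha]
        push_cast
        rfl
      rw [e1, EReal.exp_coe, ← ENNReal.ofReal_mul (Real.exp_pos _).le, ← Real.exp_add]
      refine ENNReal.ofReal_le_ofReal ?_
      have h3 := mul_le_sq_add (c := c) (a := (a : ℝ)) hδ
      have h4 := Real.exp_le_exp.2 h3
      have : 0 ≤ c * (a : ℝ) := by positivity
      unfold expGap
      linarith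
  refine (lintegral_mono_ae hbound).trans_lt ?_
  rw [lintegral_add_left' ((hk.pow_const 2).const_mul _), lintegral_const_mul' _ _ (by simp),
    lintegral_const_mul' _ _ (by simp), lintegral_indicator hEm]
  exact ENNReal.add_lt_top.2 ⟨ENNReal.mul_lt_top (by simp) hk2, ENNReal.mul_lt_top (by simp) hexpE⟩

end Heart

/-! ### The jump coefficient and its drift -/

section Jump

variable {H : Type*} [NormedAddCommGroup H] {X : Type*} [MeasurableSpace X]
  {ν : Measure X} {T : ℝ} {G : ℝ → H → X → H} {κ : ℝ × X → ℝ}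

/-- A jump coefficient whose growth and Lipschitz constants in the state variable are dominated by a
function `κ` in the Orlicz heart of `ν_T`. -/
structure IsJumpCoeff (T : ℝ) (ν : Measure X) (G : ℝ → H → X → H) (κ : ℝ × X → ℝ) : Prop where
  meas : ∀ x, AEStronglyMeasurable (fun p : ℝ × X => G p.1 x p.2) (nuT T ν)
  heart : MemOrliczHeart κ (nuT T ν)
  nonneg : ∀ p, 0 ≤ κ p
  growth : ∀ᵐ p ∂nuT T ν, ∀ x, ‖G p.1 x p.2‖ ≤ κ p * (1 + ‖x‖)
  lip : ∀ᵐ p ∂nuT T ν, ∀ x y, ‖G p.1 x p.2 - G p.1 y p.2‖ ≤ κ p * ‖x - y‖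

theorem ae_lt_top_of_lintegral_sq {α : Type*} [MeasurableSpace α] {μ : Measure α} {k : α → ℝ≥0∞}
    (hk : AEMeasurable k μ) (hk2 : ∫⁻ p, k p ^ 2 ∂μ < ∞) : ∀ᵐ p ∂μ, k p < ∞ := by
  filter_upwards [ae_lt_top' (hk.pow_const 2) hk2.ne] with p hp
  exact (ENNReal.pow_lt_top_iff.1 hp).resolve_right two_ne_zero

/-- The sum of the growth and Lipschitz norms dominates both, and lies in the Orlicz heart. -/
theorem isJumpCoeff_toReal [SFinite ν]
    (hG : ∀ x, AEStronglyMeasurable (fun p : ℝ × X => G p.1 x p.2) (nuT T ν))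
    (h0m : AEMeasurable (growthNorm G) (nuT T ν)) (h1m : AEMeasurable (lipNorm G) (nuT T ν))
    (h0 : ∫⁻ p, growthNorm G p ^ 2 ∂nuT T ν < ∞) (h1 : ∫⁻ p, lipNorm G p ^ 2 ∂nuT T ν < ∞)
    {δ : ℝ} (hδ : 0 < δ) (h0e : ExpSqIntegrable T ν δ (growthNorm G))
    (h1e : ExpSqIntegrable T ν δ (lipNorm G)) :
    IsJumpCoeff T ν G fun p => (growthNorm G p).toReal + (lipNorm G p).toReal := by
  refine ⟨hG, (memOrliczHeart_toReal h0m h0 hδ h0e).add (memOrliczHeart_toReal h1m h1 hδ h1e),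
    fun p => by positivity, ?_, ?_⟩
  · filter_upwards [ae_lt_top_of_lintegral_sq h0m h0] with p hp x
    have hx : ENNReal.ofReal (‖G p.1 x p.2‖ / (1 + ‖x‖)) ≤ growthNorm G p :=
      le_iSup (fun x => ENNReal.ofReal (‖G p.1 x p.2‖ / (1 + ‖x‖))) x
    rw [ENNReal.ofReal_le_iff_le_toReal hp.ne, div_le_iff₀ (by positivity)] at hx
    refine hx.trans ?_
    gcongr
    exact le_add_of_nonneg_right ENNReal.toReal_nonneg
  · filter_upwards [ae_lt_top_of_lintegral_sq h1m h1] with p hp x y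
    rcases eq_or_ne x y with rfl | hxy
    · simp
    have hx : ENNReal.ofReal (‖G p.1 x p.2 - G p.1 y p.2‖ / ‖x - y‖) ≤ lipNorm G p :=
      le_iSup₂ (f := fun x y => ENNReal.ofReal (‖G p.1 x p.2 - G p.1 y p.2‖ / ‖x - y‖)) x y
    rw [ENNReal.ofReal_le_iff_le_toReal hp.ne,
      div_le_iff₀ (norm_pos_iff.2 (sub_ne_zero.2 hxy))] at hx
    refine hx.trans ?_
    gcongr
    exact le_add_of_nonneg_left ENNReal.toReal_nonneg

/-- Measurability along a path, by approximating the path with simple functions. -/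
theorem IsJumpCoeff.aestronglyMeasurable_path (hJ : IsJumpCoeff T ν G κ) {φ : ℝ → H}
    (hφ : StronglyMeasurable φ) :
    AEStronglyMeasurable (fun p : ℝ × X => G p.1 (φ p.1) p.2) (nuT T ν) := by
  refine aestronglyMeasurable_of_tendsto_ae atTop
    (f := fun n p => G p.1 (hφ.approx n p.1) p.2) (fun n => ?_) ?_
  · have e : (fun p : ℝ × X => G p.1 (hφ.approx n p.1) p.2) = fun p =>
        ∑ y ∈ (hφ.approx n).range,
          (Prod.fst ⁻¹' (hφ.approx n ⁻¹' {y})).indicator (fun p : ℝ × X => G p.1 y p.2) p := by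
      ext p
      rw [Finset.sum_eq_single_of_mem (hφ.approx n p.1) (SimpleFunc.mem_range_self _ _)]
      · rw [indicator_of_mem (by simp)]
      · intro y _ hy
        rw [indicator_of_notMem]
        simpa using hy.symm
    rw [e]
    refine Finset.aestronglyMeasurable_fun_sum _ fun y _ => ?_
    exact (hJ.meas y).indicator (measurable_fst ((hφ.approx n).measurableSet_fiber y))
  · filter_upwards [hJ.lip] with p hp
    rw [tendsto_iff_norm_sub_tendsto_zero]
    have h1 : Tendsto (fun n => κ p * ‖hφ.approx n p.1 - φ p.1‖) atTop (𝓝 0) := by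
      simpa using (tendsto_iff_norm_sub_tendsto_zero.1 (hφ.tendsto_approx p.1)).const_mul (κ p)
    exact squeeze_zero (fun _ => norm_nonneg _) (fun n => hp _ _) h1

theorem IsJumpCoeff.memOrliczHeart_path [SFinite ν] (hJ : IsJumpCoeff T ν G κ) {φ : ℝ → H}
    (hφ : Continuous φ) : MemOrliczHeart (fun p : ℝ × X => G p.1 (φ p.1) p.2) (nuT T ν) := by
  obtain ⟨R, hR⟩ := isCompact_Icc.exists_bound_of_continuousOn (hφ.continuousOn (s := Icc 0 T))
  refine hJ.heart.mono (hJ.aestronglyMeasurable_path hφ.stronglyMeasurable) (C := 1 + |R|)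
    (by positivity) ?_
  filter_upwards [hJ.growth, ae_nuT_mem (T := T) (ν := ν)] with p hp hpT
  refine (hp _).trans ?_
  rw [mul_comm, Real.norm_of_nonneg (hJ.nonneg p)]
  have := hJ.nonneg p
  gcongr
  exact (hR _ hpT).trans (le_abs_self R)

/-- The rate `∫ κ |g - 1| dν`, as a function of time. -/
noncomputable def jumpRate (ν : Measure X) (κ : ℝ × X → ℝ) (g : ℝ × X → ℝ≥0) (s : ℝ) : ℝ :=
  ∫ v, ‖((g (s, v) : ℝ) - 1) • κ (s, v)‖ ∂ν

variable {N : ℝ≥0} {g : ℝ × X → ℝ≥0}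

theorem jumpRate_nonneg (s : ℝ) : 0 ≤ jumpRate ν κ g s := integral_nonneg fun _ => norm_nonneg _

theorem IsJumpCoeff.integrableOn_jumpRate [SFinite ν] (hJ : IsJumpCoeff T ν G κ)
    (hg : g ∈ controlBall T ν N) : IntegrableOn (jumpRate ν κ g) (Icc 0 T) :=
  (hJ.heart.integrable_smul hg).norm.integral_prod_left

theorem IsJumpCoeff.integral_jumpRate_le [SFinite ν] (hJ : IsJumpCoeff T ν G κ)
    (hg : g ∈ controlBall T ν N) :
    ∫ s in Icc 0 T, jumpRate ν κ g s ≤ (∫ p, expGap (1 * ‖κ p‖) ∂nuT T ν) + N := by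
  have h1 := integral_prod _ (hJ.heart.integrable_smul hg).norm
  have h2 := hJ.heart.integral_norm_smul_le hg one_pos
  rw [inv_one, one_mul] at h2
  exact h1.symm.le.trans h2

variable [NormedSpace ℝ H]

/-- The jump part of the drift, `∫ (g - 1) G dν`. -/
noncomputable def jumpDrift (ν : Measure X) (G : ℝ → H → X → H) (g : ℝ × X → ℝ≥0) (s : ℝ) (x : H) :
    H :=
  ∫ v, ((g (s, v) : ℝ) - 1) • G s x v ∂ν

theorem IsJumpCoeff.integrable_path [SFinite ν] (hJ : IsJumpCoeff T ν G κ)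
    (hg : g ∈ controlBall T ν N) {φ : ℝ → H} (hφ : Continuous φ) :
    Integrable (fun p : ℝ × X => ((g p : ℝ) - 1) • G p.1 (φ p.1) p.2) (nuT T ν) :=
  (hJ.memOrliczHeart_path hφ).integrable_smul hg

theorem IsJumpCoeff.integrableOn_jumpDrift [SFinite ν] (hJ : IsJumpCoeff T ν G κ)
    (hg : g ∈ controlBall T ν N) {φ : ℝ → H} (hφ : Continuous φ) :
    IntegrableOn (fun s => jumpDrift ν G g s (φ s)) (Icc 0 T) :=
  (hJ.integrable_path hg hφ).integral_prod_left

theorem IsJumpCoeff.ae_norm_jumpDrift_le [SFinite ν] (hJ : IsJumpCoeff T ν G κ)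
    (hg : g ∈ controlBall T ν N) (φ : ℝ → H) :
    ∀ᵐ s ∂volume.restrict (Icc 0 T),
      ‖jumpDrift ν G g s (φ s)‖ ≤ jumpRate ν κ g s * (1 + ‖φ s‖) := by
  filter_upwards [(hJ.heart.integrable_smul hg).prod_right_ae,
    Measure.ae_ae_of_ae_prod hJ.growth] with s h1 h2
  rw [jumpDrift, jumpRate, ← integral_mul_const]
  refine norm_integral_le_of_norm_le (h1.norm.mul_const _) ?_
  filter_upwards [h2] with v hv
  rw [norm_smul, norm_smul, mul_assoc, Real.norm_of_nonneg (hJ.nonneg _)]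
  gcongr
  exact hv _

theorem IsJumpCoeff.ae_norm_jumpDrift_sub_le [SFinite ν] (hJ : IsJumpCoeff T ν G κ)
    (hg : g ∈ controlBall T ν N) {φ χ : ℝ → H} (hφ : Continuous φ) (hχ : Continuous χ) :
    ∀ᵐ s ∂volume.restrict (Icc 0 T),
      ‖jumpDrift ν G g s (φ s) - jumpDrift ν G g s (χ s)‖ ≤ jumpRate ν κ g s * ‖φ s - χ s‖ := by
  filter_upwards [(hJ.heart.integrable_smul hg).prod_right_ae, Measure.ae_ae_of_ae_prod hJ.lip,
    (hJ.integrable_path hg hφ).prod_right_ae, (hJ.integrable_path hg hχ).prod_right_ae]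
    with s h1 h2 h3 h4
  rw [jumpDrift, jumpDrift, jumpRate, ← integral_sub h3 h4, ← integral_mul_const]
  refine norm_integral_le_of_norm_le (h1.norm.mul_const _) ?_
  filter_upwards [h2] with v hv
  rw [← smul_sub, norm_smul, norm_smul, mul_assoc, Real.norm_of_nonneg (hJ.nonneg _)]
  gcongr
  exact hv _ _

end Jump

section Drift

variable {H : Type*} [NormedAddCommGroup H] [InnerProductSpace ℝ H] [CompleteSpace H] {X : Type*}
  [MeasurableSpace X] {ν : Measure X} {T : ℝ} {G : ℝ → H → X → H} {κ : ℝ × X → ℝ} {f : H → H}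
  {C M : ℝ} {N : ℝ≥0} {g : ℝ × X → ℝ≥0}

/-- For a control of finite cost, `f + ∫ (g - 1) G dν` is a drift to which the theory of mild
equations applies. -/
theorem IsJumpCoeff.isMonoDrift [SFinite ν] (hJ : IsJumpCoeff T ν G κ) (hg : g ∈ controlBall T ν N)
    (hfd : Demicontinuous f) (hC : 0 ≤ C) (hfC : ∀ x, ‖f x‖ ≤ C * (1 + ‖x‖)) (hM : 0 ≤ M)
    (hfM : ∀ x y, inner ℝ (f x - f y) (x - y) ≤ M * ‖x - y‖ ^ 2) :
    IsMonoDrift T (fun s x => f x + jumpDrift ν G g s x) (fun s => C + M + jumpRate ν κ g s) where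
  nonneg s := by have := jumpRate_nonneg (ν := ν) (κ := κ) (g := g) s; positivity
  integrable := (integrable_const _).add (hJ.integrableOn_jumpRate hg)
  meas φ hφ := (hfd.stronglyMeasurable_comp hφ.stronglyMeasurable).aestronglyMeasurable.add
    (hJ.integrableOn_jumpDrift hg hφ).aestronglyMeasurable
  growth φ hφ := by
    filter_upwards [hJ.ae_norm_jumpDrift_le hg φ] with s hs
    refine (norm_add_le _ _).trans ((add_le_add (hfC _) hs).trans ?_)
    nlinarith [norm_nonneg (φ s)]
  mono φ χ hφ hχ := by
    filter_upwards [hJ.ae_norm_jumpDrift_sub_le hg hφ hχ] with s hs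
    have e : f (φ s) + jumpDrift ν G g s (φ s) - (f (χ s) + jumpDrift ν G g s (χ s))
        = (f (φ s) - f (χ s)) + (jumpDrift ν G g s (φ s) - jumpDrift ν G g s (χ s)) := by abel
    rw [e, inner_add_left]
    have h1 := hfM (φ s) (χ s)
    have h2 : inner ℝ (jumpDrift ν G g s (φ s) - jumpDrift ν G g s (χ s)) (φ s - χ s)
        ≤ jumpRate ν κ g s * ‖φ s - χ s‖ * ‖φ s - χ s‖ :=
      (real_inner_le_norm _ _).trans (by gcongr)
    nlinarith [sq_nonneg ‖φ s - χ s‖]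
  demi φ χ hφ hχ hlim := by
    filter_upwards [ae_all_iff.2 fun n => hJ.ae_norm_jumpDrift_sub_le hg (hφ n) hχ,
      ae_restrict_mem measurableSet_Icc] with s hs hsT y
    have h1 : Tendsto (fun n => jumpDrift ν G g s (φ n s)) atTop (𝓝 (jumpDrift ν G g s (χ s))) := by
      rw [tendsto_iff_norm_sub_tendsto_zero]
      refine squeeze_zero (fun _ => norm_nonneg _) hs ?_
      simpa using (tendsto_iff_norm_sub_tendsto_zero.1 (hlim s hsT)).const_mul (jumpRate ν κ g s)
    simp only [inner_add_left]
    exact (hfd _ _ (hlim s hsT) y).add (h1.inner tendsto_const_nhds)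

omit [InnerProductSpace ℝ H] [CompleteSpace H] in
/-- The total rate is bounded uniformly over the controls in `S^N`. -/
theorem IsJumpCoeff.integral_rate_le [SFinite ν] (hJ : IsJumpCoeff T ν G κ) (hT : 0 ≤ T)
    (hg : g ∈ controlBall T ν N) :
    ∫ s in Icc 0 T, (C + M + jumpRate ν κ g s)
      ≤ T * (C + M) + ((∫ p, expGap (1 * ‖κ p‖) ∂nuT T ν) + N) := by
  rw [integral_add (integrable_const _) (hJ.integrableOn_jumpRate hg), setIntegral_const]
  have h1 := hJ.integral_jumpRate_le hg
  simp only [Real.volume_real_Icc, sub_zero, smul_eq_mul, max_eq_left hT]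
  linarith

end Drift

/-! ### The skeleton equation -/

section SkeletonEquation

variable {H : Type*} [NormedAddCommGroup H] [InnerProductSpace ℝ H] [CompleteSpace H] {X : Type*}
  [MeasurableSpace X] {ν : Measure X} {T : ℝ} {G : ℝ → H → X → H} {κ : ℝ × X → ℝ} {f : H → H}
  {C M l : ℝ} {N : ℝ≥0} {g : ℝ × X → ℝ≥0} {S : ℝ → H →L[ℝ] H} {x₀ : H}

theorem Demicontinuous.integrableOn_comp (hfd : Demicontinuous f)
    (hfC : ∀ x, ‖f x‖ ≤ C * (1 + ‖x‖)) {φ : ℝ → H} (hφ : Continuous φ) :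
    IntegrableOn (fun s => f (φ s)) (Icc 0 T) := by
  have hc : IntegrableOn (fun s => C * (1 + ‖φ s‖)) (Icc 0 T) :=
    (by fun_prop : Continuous fun s => C * (1 + ‖φ s‖)).integrableOn_Icc
  exact hc.mono' (hfd.stronglyMeasurable_comp hφ.stronglyMeasurable).aestronglyMeasurable
    (Eventually.of_forall fun s => hfC _)

omit [CompleteSpace H] in
theorem IsC0Semigroup.mildConv_add (hS : IsC0Semigroup S) (hl : 0 ≤ l)
    (hb : ∀ t : ℝ, 0 ≤ t → ‖S t‖ ≤ Real.exp (l * t)) {h k : ℝ → H}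
    (hh : IntegrableOn h (Icc 0 T)) (hk : IntegrableOn k (Icc 0 T)) {t : ℝ} (ht : t ∈ Icc 0 T) :
    mildConv S (fun s => h s + k s) t = mildConv S h t + mildConv S k t := by
  simp only [mildConv, map_add]
  exact intervalIntegral.integral_add (hS.intervalIntegrable_apply hl hb hh le_rfl ht.1 le_rfl ht.2)
    (hS.intervalIntegrable_apply hl hb hk le_rfl ht.1 le_rfl ht.2)

/-- The skeleton equation is the mild equation with drift `f + jumpDrift`; the integrability
requirements hold along every continuous path. -/
theorem IsJumpCoeff.isSkeletonSolution_iff [SFinite ν] (hJ : IsJumpCoeff T ν G κ)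
    (hg : g ∈ controlBall T ν N) (hS : IsC0Semigroup S) (hl : 0 ≤ l)
    (hb : ∀ t : ℝ, 0 ≤ t → ‖S t‖ ≤ Real.exp (l * t)) (hfd : Demicontinuous f)
    (hfC : ∀ x, ‖f x‖ ≤ C * (1 + ‖x‖)) (hT : 0 < T) {φ : C(Icc (0 : ℝ) T, H)} :
    IsSkeletonSolution hT ν S f G x₀ g φ ↔ ∀ t : Icc (0 : ℝ) T, φ t = S t x₀ + mildConv S
      (fun s => f (IccExtend hT.le φ s) + jumpDrift ν G g s (IccExtend hT.le φ s)) t := by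
  have hφ : Continuous (IccExtend hT.le φ) := φ.continuous.Icc_extend'
  have hi := hfd.integrableOn_comp hfC hφ (T := T)
  have e : ∀ t : Icc (0 : ℝ) T, S t x₀ + mildConv S
      (fun s => f (IccExtend hT.le φ s) + jumpDrift ν G g s (IccExtend hT.le φ s)) t
      = S t x₀ + (∫ s in (0 : ℝ)..t, S (t - s) (f (IccExtend hT.le φ s)))
      + ∫ s in (0 : ℝ)..t,
          S (t - s) (∫ v, ((g (s, v) : ℝ) - 1) • G s (IccExtend hT.le φ s) v ∂ν) := by
    intro t
    rw [hS.mildConv_add hl hb hi (hJ.integrableOn_jumpDrift hg hφ) t.2, add_assoc]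
    rfl
  exact ⟨fun h t => (h.eq t).trans (e t).symm,
    fun h => ⟨hi, hJ.integrable_path hg hφ, fun t => (h t).trans (e t)⟩⟩

theorem IsJumpCoeff.existsUnique_isSkeletonSolution [SFinite ν] (hJ : IsJumpCoeff T ν G κ)
    (hg : g ∈ controlBall T ν N) (hS : IsC0Semigroup S) (hl : 0 ≤ l)
    (hb : ∀ t : ℝ, 0 ≤ t → ‖S t‖ ≤ Real.exp (l * t)) (hfd : Demicontinuous f) (hC : 0 ≤ C)
    (hfC : ∀ x, ‖f x‖ ≤ C * (1 + ‖x‖)) (hM : 0 ≤ M)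
    (hfM : ∀ x y, inner ℝ (f x - f y) (x - y) ≤ M * ‖x - y‖ ^ 2) (hT : 0 < T) :
    ∃! φ : C(Icc (0 : ℝ) T, H), IsSkeletonSolution hT ν S f G x₀ g φ := by
  have hF := hJ.isMonoDrift hg hfd hC hfC hM hfM
  simp only [hJ.isSkeletonSolution_iff hg hS hl hb hfd hfC hT]
  obtain ⟨u, hu⟩ := hF.exists_solution hS hl hb hT x₀
  exact ⟨u, hu, fun v hv => hF.unique hS hl hb hT hv hu⟩

omit [CompleteSpace H] in
theorem isSkeletonSolution_skeletonMap {hT : 0 < T}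
    (h : ∃ φ, IsSkeletonSolution hT ν S f G x₀ g φ) :
    IsSkeletonSolution hT ν S f G x₀ g (skeletonMap hT ν S f G x₀ g) := by
  rw [skeletonMap, dif_pos h]
  exact h.choose_spec

/-! ### Continuity of the jump convolution in the control -/

/-- The kernel `1_{s ≤ t} S (t - s) G (s, φ s, v)`, whose pairing with `g - 1` is the convolution
of `S` with the jump drift. -/
noncomputable def jumpKernel (S : ℝ → H →L[ℝ] H) (G : ℝ → H → X → H) (φ : ℝ → H) (t : ℝ)
    (p : ℝ × X) : H :=
  (Iic t).indicator (fun s => S (max (t - s) 0) (G p.1 (φ p.1) p.2)) p.1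

omit [CompleteSpace H] [MeasurableSpace X] in
theorem norm_jumpKernel_le (hl : 0 ≤ l) (hb : ∀ t : ℝ, 0 ≤ t → ‖S t‖ ≤ Real.exp (l * t))
    (φ : ℝ → H) {t : ℝ} (ht : t ∈ Icc 0 T) {p : ℝ × X} (hp : p.1 ∈ Icc 0 T) :
    ‖jumpKernel S G φ t p‖ ≤ Real.exp (l * T) * ‖G p.1 (φ p.1) p.2‖ :=
  (norm_indicator_le_norm_self _ _).trans (norm_semigroup_apply_le_of_le hl hb (le_max_right _ _)
    (max_le (by linarith [hp.1, ht.2]) (ht.1.trans ht.2)) _)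

omit [CompleteSpace H] in
theorem IsJumpCoeff.aestronglyMeasurable_jumpKernel (hJ : IsJumpCoeff T ν G κ)
    (hS : IsC0Semigroup S) (hl : 0 ≤ l) (hb : ∀ t : ℝ, 0 ≤ t → ‖S t‖ ≤ Real.exp (l * t))
    {φ : ℝ → H} (hφ : Continuous φ) (t : ℝ) :
    AEStronglyMeasurable (jumpKernel S G φ t) (nuT T ν) := by
  have h1 : AEStronglyMeasurable (fun p : ℝ × X => S (max (t - p.1) 0) (G p.1 (φ p.1) p.2))
      (nuT T ν) := hS.aestronglyMeasurable_apply hl hb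
    (measurable_fst.const_sub t).aestronglyMeasurable
    (hJ.aestronglyMeasurable_path hφ.stronglyMeasurable)
  exact h1.indicator (measurable_fst measurableSet_Iic)

omit [CompleteSpace H] in
theorem IsJumpCoeff.memOrliczHeart_jumpKernel [SFinite ν] (hJ : IsJumpCoeff T ν G κ)
    (hS : IsC0Semigroup S) (hl : 0 ≤ l) (hb : ∀ t : ℝ, 0 ≤ t → ‖S t‖ ≤ Real.exp (l * t))
    {φ : ℝ → H} (hφ : Continuous φ) {t : ℝ} (ht : t ∈ Icc 0 T) :
    MemOrliczHeart (jumpKernel S G φ t) (nuT T ν) := by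
  refine (hJ.memOrliczHeart_path hφ).mono (hJ.aestronglyMeasurable_jumpKernel hS hl hb hφ t)
    (Real.exp_pos (l * T)).le ?_
  filter_upwards [ae_nuT_mem (T := T) (ν := ν)] with p hp
  exact norm_jumpKernel_le hl hb φ ht hp

theorem IsJumpCoeff.mildConv_jumpDrift_eq [SFinite ν] (hJ : IsJumpCoeff T ν G κ)
    (hg : g ∈ controlBall T ν N) (hS : IsC0Semigroup S) (hl : 0 ≤ l)
    (hb : ∀ t : ℝ, 0 ≤ t → ‖S t‖ ≤ Real.exp (l * t)) {φ : ℝ → H} (hφ : Continuous φ) {t : ℝ}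
    (ht : t ∈ Icc 0 T) :
    mildConv S (fun s => jumpDrift ν G g s (φ s)) t
      = ∫ p, ((g p : ℝ) - 1) • jumpKernel S G φ t p ∂nuT T ν := by
  rw [mildConv_eq_setIntegral _ ht, nuT,
    integral_prod _ ((hJ.memOrliczHeart_jumpKernel hS hl hb hφ ht).integrable_smul hg)]
  refine integral_congr_ae ?_
  filter_upwards [(hJ.integrable_path hg hφ).prod_right_ae] with s hs
  by_cases hst : s ∈ Iic t
  · simp only [jumpKernel, indicator_of_mem hst, jumpDrift]
    rw [← ContinuousLinearMap.integral_comp_comm _ hs]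
    simp only [map_smul]
  · simp only [jumpKernel, indicator_of_notMem hst, smul_zero, integral_zero]

omit [CompleteSpace H] [MeasurableSpace X] in
theorem tendsto_jumpKernel (hS : IsC0Semigroup S) (hl : 0 ≤ l)
    (hb : ∀ t : ℝ, 0 ≤ t → ‖S t‖ ≤ Real.exp (l * t)) (φ : ℝ → H) {t : ℝ} {p : ℝ × X}
    (hp : p.1 ≠ t) :
    Tendsto (fun r => jumpKernel S G φ r p) (𝓝 t) (𝓝 (jumpKernel S G φ t p)) := by
  have hc : Continuous fun r => S (max (r - p.1) 0) (G p.1 (φ p.1) p.2) :=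
    (hS.continuous_extend hl hb).comp
      (by fun_prop : Continuous fun r : ℝ => (r - p.1, G p.1 (φ p.1) p.2))
  rcases lt_or_gt_of_ne hp with hlt | hgt
  · rw [jumpKernel, indicator_of_mem (mem_Iic.2 hlt.le)]
    refine (hc.tendsto t).congr' ?_
    filter_upwards [lt_mem_nhds hlt] with r hr
    rw [jumpKernel, indicator_of_mem (mem_Iic.2 hr.le)]
  · rw [jumpKernel, indicator_of_notMem (by simpa using hgt)]
    refine tendsto_const_nhds.congr' ?_
    filter_upwards [gt_mem_nhds hgt] with r hr
    rw [jumpKernel, indicator_of_notMem (by simpa using hr)]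

omit [CompleteSpace H] in
/-- The jump convolutions are equicontinuous in time, uniformly over the controls in `S^N`. -/
theorem IsJumpCoeff.equicontinuous_jumpKernel [SFinite ν] (hJ : IsJumpCoeff T ν G κ)
    (hS : IsC0Semigroup S) (hl : 0 ≤ l) (hb : ∀ t : ℝ, 0 ≤ t → ‖S t‖ ≤ Real.exp (l * t))
    (N : ℝ≥0) {φ : ℝ → H} (hφ : Continuous φ) {t : ℝ} (ht : t ∈ Icc 0 T) {ε : ℝ} (hε : 0 < ε) :
    ∀ᶠ r in 𝓝[Icc 0 T] t, ∀ g ∈ controlBall T ν N,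
      dist (∫ p, ((g p : ℝ) - 1) • jumpKernel S G φ r p ∂nuT T ν)
        (∫ p, ((g p : ℝ) - 1) • jumpKernel S G φ t p ∂nuT T ν) < ε := by
  obtain ⟨c, hc0, hc⟩ : ∃ c : ℝ, 0 < c ∧ c⁻¹ * (1 + N) < ε := by
    refine ⟨(1 + N) * 2 / ε, by positivity, ?_⟩
    rw [inv_div]
    have : (0 : ℝ) < 1 + N := by positivity
    field_simp
    norm_num
  set D := Real.exp (l * T) with hD
  have hheart := hJ.memOrliczHeart_path hφ
  have hm := hJ.aestronglyMeasurable_jumpKernel hS hl hb hφ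
  have hsub : ∀ r ∈ Icc 0 T, ∀ᵐ p ∂nuT T ν, ‖jumpKernel S G φ t p - jumpKernel S G φ r p‖
      ≤ 2 * D * ‖G p.1 (φ p.1) p.2‖ := by
    intro r hr
    filter_upwards [ae_nuT_mem (T := T) (ν := ν)] with p hp
    have h1 := norm_jumpKernel_le (G := G) hl hb φ ht hp
    have h2 := norm_jumpKernel_le (G := G) hl hb φ hr hp
    exact (norm_sub_le _ _).trans (by linarith)
  have hlim : ∀ᵐ p ∂nuT T ν,
      Tendsto (fun r => jumpKernel S G φ r p) (𝓝[Icc 0 T] t) (𝓝 (jumpKernel S G φ t p)) := by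
    have : ∀ᵐ s ∂volume.restrict (Icc 0 T), s ≠ t :=
      ae_restrict_of_ae (by simp [ae_iff, measure_singleton])
    filter_upwards [Measure.quasiMeasurePreserving_fst.ae this] with p hp
    exact (tendsto_jumpKernel hS hl hb φ hp).mono_left nhdsWithin_le_nhds
  have h3 := hheart.tendsto_integral_expGap_sub (hm t) hm (by positivity : 0 ≤ 2 * D)
    (eventually_mem_nhdsWithin.mono hsub) hlim hc0.le
  filter_upwards [h3.eventually_le_const one_pos, self_mem_nhdsWithin] with r hr hrT g hg
  have h1 := hJ.memOrliczHeart_jumpKernel hS hl hb hφ ht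
  have h2 := hJ.memOrliczHeart_jumpKernel hS hl hb hφ hrT
  have hsubheart : MemOrliczHeart
      (fun p => jumpKernel S G φ t p - jumpKernel S G φ r p) (nuT T ν) :=
    hheart.mono ((hm t).sub (hm r)) (by positivity) (hsub r hrT)
  rw [dist_comm, dist_eq_norm, ← integral_sub (h1.integrable_smul hg) (h2.integrable_smul hg)]
  simp only [← smul_sub]
  refine (norm_integral_le_integral_norm _).trans_lt (lt_of_le_of_lt ?_ hc)
  refine (hsubheart.integral_norm_smul_le hg hc0).trans ?_
  gcongr

/-- Weak convergence of controls makes the jump convolutions along a fixed path converge at every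
time; by equicontinuity they converge uniformly in time. -/
theorem IsJumpCoeff.tendstoUniformlyOn_mildConv [SFinite ν] (hJ : IsJumpCoeff T ν G κ)
    (hS : IsC0Semigroup S) (hl : 0 ≤ l) (hb : ∀ t : ℝ, 0 ≤ t → ‖S t‖ ≤ Real.exp (l * t))
    {φ : ℝ → H} (hφ : Continuous φ) {𝓤 : Filter (ℝ × X → ℝ≥0)} (h𝓤 : controlBall T ν N ∈ 𝓤)
    (hg : g ∈ controlBall T ν N)
    (hlim : ∀ Ψ : ℝ × X → H, MemOrliczHeart Ψ (nuT T ν) →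
      Tendsto (fun g' : ℝ × X → ℝ≥0 => ∫ p, ((g' p : ℝ) - 1) • Ψ p ∂nuT T ν) 𝓤
        (𝓝 (∫ p, ((g p : ℝ) - 1) • Ψ p ∂nuT T ν))) :
    TendstoUniformlyOn (fun g' t => mildConv S (fun s => jumpDrift ν G g' s (φ s)) t)
      (mildConv S (fun s => jumpDrift ν G g s (φ s))) 𝓤 (Icc 0 T) := by
  rw [← tendstoLocallyUniformlyOn_iff_tendstoUniformlyOn_of_compact isCompact_Icc,
    Metric.tendstoLocallyUniformlyOn_iff]
  intro ε hε t ht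
  refine ⟨_, hJ.equicontinuous_jumpKernel hS hl hb N hφ ht (ε := ε / 3) (by positivity) |>.and
    self_mem_nhdsWithin, ?_⟩
  filter_upwards [h𝓤, Metric.tendsto_nhds.1
    (hlim _ (hJ.memOrliczHeart_jumpKernel hS hl hb hφ ht)) (ε / 3) (by positivity)]
    with g' hg' h1 r hr
  rw [hJ.mildConv_jumpDrift_eq hg hS hl hb hφ hr.2, hJ.mildConv_jumpDrift_eq hg' hS hl hb hφ hr.2]
  have h2 := hr.1 g hg
  have h3 := hr.1 g' hg'
  rw [dist_comm] at h1 h3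
  have := dist_triangle4 (∫ p, ((g p : ℝ) - 1) • jumpKernel S G φ r p ∂nuT T ν)
    (∫ p, ((g p : ℝ) - 1) • jumpKernel S G φ t p ∂nuT T ν)
    (∫ p, ((g' p : ℝ) - 1) • jumpKernel S G φ t p ∂nuT T ν)
    (∫ p, ((g' p : ℝ) - 1) • jumpKernel S G φ r p ∂nuT T ν)
  linarith

/-! ### Compactness of the solution sets and the rate function -/

/-- Every ultrafilter on `S^N` has a weak limit `g`, and the solutions converge uniformly along it:
`Γ g` solves the equation with control `g'` up to a uniformly small error, and the stability
estimate compares it with `Γ g'`. -/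
theorem IsJumpCoeff.isCompact_image_skeletonMap [SigmaFinite ν] (hJ : IsJumpCoeff T ν G κ)
    (hS : IsC0Semigroup S) (hl : 0 ≤ l)
    (hb : ∀ t : ℝ, 0 ≤ t → ‖S t‖ ≤ Real.exp (l * t)) (hfd : Demicontinuous f) (hC : 0 ≤ C)
    (hfC : ∀ x, ‖f x‖ ≤ C * (1 + ‖x‖)) (hM : 0 ≤ M)
    (hfM : ∀ x y, inner ℝ (f x - f y) (x - y) ≤ M * ‖x - y‖ ^ 2) (hT : 0 < T) (N : ℝ≥0) :
    IsCompact (skeletonMap hT ν S f G x₀ '' controlBall T ν N) := by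
  set Γ := skeletonMap hT ν S f G x₀ with hΓ
  have hsol : ∀ g ∈ controlBall T ν N, ∀ t ∈ Icc (0 : ℝ) T,
      IccExtend hT.le (Γ g) t = S t x₀ + mildConv S (fun s => f (IccExtend hT.le (Γ g) s) +
        jumpDrift ν G g s (IccExtend hT.le (Γ g) s)) t := by
    intro g hg t ht
    rw [IccExtend_of_mem _ _ ht]
    exact (hJ.isSkeletonSolution_iff hg hS hl hb hfd hfC hT).1 (isSkeletonSolution_skeletonMap
      (hJ.existsUnique_isSkeletonSolution hg hS hl hb hfd hC hfC hM hfM hT).exists) ⟨t, ht⟩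
  have hcont : ∀ g, Continuous (IccExtend hT.le (Γ g)) := fun g => (Γ g).continuous.Icc_extend'
  set L := T * (C + M) + ((∫ p, expGap (1 * ‖κ p‖) ∂nuT T ν) + N) with hL
  have hrate : ∀ g ∈ controlBall T ν N, ∫ s in Icc 0 T, (C + M + jumpRate ν κ g s) ≤ L :=
    fun g hg => hJ.integral_rate_le hT.le hg
  have hF := fun g (hg : g ∈ controlBall T ν N) => hJ.isMonoDrift hg hfd hC hfC hM hfM
  set R := 2 * (Real.exp (l * T) * (‖x₀‖ + L)) * Real.exp (2 * (Real.exp (l * T) ^ 2 * L)) with hR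
  have hRb : ∀ g ∈ controlBall T ν N, ∀ t ∈ Icc 0 T, ‖IccExtend hT.le (Γ g) t‖ ≤ R :=
    fun g hg t ht => IsMonoDrift.norm_le hS hl hb (hF g hg) (hrate g hg) (hcont g) (hsol g hg)
      (θ := fun s => s) continuous_id (fun s hs => ⟨hs.1, le_rfl⟩)
      (fun s hs => le_mul_of_one_le_left (norm_nonneg _)
        (Real.one_le_exp (mul_nonneg hl hT.le))) ht
  rw [isCompact_iff_ultrafilter_le_nhds]
  intro 𝓕 h𝓕
  rw [le_principal_iff] at h𝓕
  set 𝓤 := Ultrafilter.ofComapInfPrincipal h𝓕 with h𝓤def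
  have h𝓤 : controlBall T ν N ∈ 𝓤 := Ultrafilter.ofComapInfPrincipal_mem h𝓕
  have hmap : 𝓤.map Γ = 𝓕 := Ultrafilter.ofComapInfPrincipal_eq_of_map h𝓕
  have : SigmaFinite (nuT T ν) := by unfold nuT; infer_instance
  obtain ⟨g, hg, hlim⟩ := exists_weak_limit_entropyBall (E := H) (μ := nuT T ν) (N := N) 𝓤 h𝓤
  have hR0 : 0 ≤ R := (norm_nonneg _).trans (hRb g hg 0 ⟨le_rfl, hT.le⟩)
  refine ⟨Γ g, mem_image_of_mem _ hg, ?_⟩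
  rw [← hmap]
  change Tendsto Γ 𝓤 (𝓝 (Γ g))
  rw [Metric.tendsto_nhds]
  intro η hη
  obtain ⟨ε, hε0, hεη, hε⟩ : ∃ ε : ℝ, 0 < ε ∧ ε < η / 3 ∧
      2 * ((16 * ε ^ 2 + 8 * ε * (1 + R)) * L) * Real.exp (2 * (2 * l * T + 4 * L))
        < (η / 3) ^ 2 := by
    have h1 := ((tendsto_stability_const R L (2 * (2 * l * T + 4 * L))).eventually_lt_const
      (show (0 : ℝ) < (η / 3) ^ 2 by positivity)).filter_mono (nhdsWithin_le_nhds (s := Ioi 0))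
    obtain ⟨ε, h2, h3⟩ := (h1.and (Ioo_mem_nhdsGT (by positivity : 0 < η / 3))).exists
    exact ⟨ε, h3.1, h3.2, h2⟩
  filter_upwards [h𝓤, Metric.tendstoUniformlyOn_iff.1
    (hJ.tendstoUniformlyOn_mildConv hS hl hb (hcont g) h𝓤 hg hlim) ε hε0] with g' hg' hz
  -- `Γ g` solves the equation with control `g'` up to the difference of the jump convolutions
  set u : ℝ → H := fun t => S t x₀ + mildConv S (fun s => f (IccExtend hT.le (Γ g) s) +
        jumpDrift ν G g' s (IccExtend hT.le (Γ g) s)) t with hu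
  have hclose : ∀ t ∈ Icc 0 T, ‖u t - IccExtend hT.le (Γ g) t‖ ≤ ε := by
    intro t ht
    have hi := hfd.integrableOn_comp hfC (hcont g) (T := T)
    have hz' := hz t ht
    rw [dist_comm, dist_eq_norm] at hz'
    rw [hsol g hg t ht, hu]
    simp only
    rw [hS.mildConv_add hl hb hi (hJ.integrableOn_jumpDrift hg' (hcont g)) ht,
      hS.mildConv_add hl hb hi (hJ.integrableOn_jumpDrift hg (hcont g)) ht, add_sub_add_left_eq_sub,
      add_sub_add_left_eq_sub]
    exact hz'.le
  refine lt_of_le_of_lt ((ContinuousMap.dist_le (C := η / 3 + η / 3) (by positivity)).2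
    fun t => ?_) (by linarith)
  have hst := (hF g' hg').norm_sub_sq_le hS hl hb (hrate g' hg') (hcont g') (hcont g) (u₂ := u)
    (hsol g' hg') (fun t _ => rfl) hε0.le hR0 (by simpa using fun _ _ _ => hε0.le) hclose
    (hRb g' hg') (hRb g hg) t.2
  have h1 : ‖IccExtend hT.le (Γ g') t - u t‖ ≤ η / 3 :=
    (sq_le_sq₀ (norm_nonneg _) (by positivity)).1 (hst.trans hε.le)
  have h2 := hclose t t.2
  rw [IccExtend_val] at h1 h2
  rw [dist_eq_norm, ← sub_add_sub_cancel _ (u t)]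
  exact (norm_add_le _ _).trans (add_le_add h1 (h2.trans hεη.le))

omit [CompleteSpace H] in
/-- The level set `{I ≤ a}` is the intersection of the sets `K_N` with `N > a`. -/
theorem setOf_rateFunction_le (hT : 0 < T) (a : ℝ≥0) :
    {φ | rateFunction hT ν S f G x₀ φ ≤ a}
      = ⋂ N : Ioi a, skeletonMap hT ν S f G x₀ '' controlBall T ν N := by
  ext φ
  simp only [mem_ofPred_eq, mem_iInter]
  constructor
  · rintro h ⟨N, hN⟩
    have h1 : rateFunction hT ν S f G x₀ φ < N := h.trans_lt (by exact_mod_cast hN)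
    simp only [rateFunction, iInf_lt_iff] at h1
    obtain ⟨g, ⟨hg, hφ⟩, hc⟩ := h1
    obtain ⟨N', hN'⟩ := mem_iUnion.1 hg
    exact ⟨g, ⟨hN'.1, hc.le⟩, hφ.symm⟩
  · intro h
    by_contra! hlt
    obtain ⟨N, hN, hN'⟩ := ENNReal.lt_iff_exists_nnreal_btwn.1 hlt
    obtain ⟨g, hg, hφ⟩ := h ⟨N, by exact_mod_cast hN⟩
    refine absurd hN' (not_lt.2 ?_)
    exact (iInf₂_le g ⟨mem_iUnion.2 ⟨N, hg⟩, hφ.symm⟩).trans hg.2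

omit [CompleteSpace H] in
theorem isGoodRateFunction_of_isCompact (hT : 0 < T)
    (hK : ∀ N : ℝ≥0, IsCompact (skeletonMap hT ν S f G x₀ '' controlBall T ν N)) :
    IsGoodRateFunction (rateFunction hT ν S f G x₀) := by
  have hc : ∀ a : ℝ≥0, IsCompact {φ | rateFunction hT ν S f G x₀ φ ≤ a} := by
    intro a
    rw [setOf_rateFunction_le]
    exact (hK (a + 1)).of_isClosed_subset (isClosed_iInter fun N => (hK N).isClosed)
      (iInter_subset_of_subset ⟨a + 1, by simp⟩ subset_rfl)
  refine ⟨lowerSemicontinuous_iff_isClosed_preimage.2 fun y => ?_, hc⟩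
  induction y with
  | top => simp
  | coe a => exact (hc a).isClosed

end SkeletonEquation

end LevySkeleton

theorem mainTheorem3
    {H : Type*} [NormedAddCommGroup H] [InnerProductSpace ℝ H] [CompleteSpace H]
    {X : Type*} [TopologicalSpace X] [PolishSpace X] [LocallyCompactSpace X]
    [MeasurableSpace X] [BorelSpace X]
    (ν : Measure X) [IsFiniteMeasureOnCompacts ν]
    (T : ℝ) (hT : 0 < T) (x₀ : H)
    -- the linear part
    (A : H →ₗ.[ℝ] H) (S : ℝ → H →L[ℝ] H)
    (hA_closed : A.IsClosed) (hA_dense : Dense (A.domain : Set H))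
    (hS : LevySkeleton.IsC0Semigroup S) (hAS : LevySkeleton.IsGenerator A S)
    (hS_bound : ∃ l : ℝ, 0 < l ∧ ∀ t : ℝ, 0 ≤ t → ‖S t‖ ≤ Real.exp (l * t))
    -- the drift
    (f : H → H)
    (hf_demi : LevySkeleton.Demicontinuous f)
    (hf_growth : ∃ C : ℝ, 0 < C ∧ ∀ x, ‖f x‖ ≤ C * (1 + ‖x‖))
    (hf_mono : ∃ M : ℝ, 0 ≤ M ∧ ∀ x y, inner ℝ (f x - f y) (x - y) ≤ M * ‖x - y‖ ^ 2)
    -- the jump coefficient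
    (G : ℝ → H → X → H)
    (hG_meas : ∀ x, AEStronglyMeasurable (fun p : ℝ × X => G p.1 x p.2) (LevySkeleton.nuT T ν))
    (hG_lip : ∃ M : ℝ, 0 ≤ M ∧ ∀ t ∈ Icc (0 : ℝ) T, ∀ x y,
      ∫⁻ v, ENNReal.ofReal (‖G t x v - G t y v‖ ^ 2) ∂ν ≤ ENNReal.ofReal (M * ‖x - y‖ ^ 2))
    (hG0_meas : AEMeasurable (LevySkeleton.growthNorm G) (LevySkeleton.nuT T ν))
    (hG1_meas : AEMeasurable (LevySkeleton.lipNorm G) (LevySkeleton.nuT T ν))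
    (hG0_sq : ∫⁻ p, LevySkeleton.growthNorm G p ^ 2 ∂(LevySkeleton.nuT T ν) < ∞)
    (hG1_sq : ∫⁻ p, LevySkeleton.lipNorm G p ^ 2 ∂(LevySkeleton.nuT T ν) < ∞)
    (hG_exp : ∃ δ : ℝ, 0 < δ ∧
      LevySkeleton.ExpSqIntegrable T ν δ (LevySkeleton.growthNorm G) ∧
      LevySkeleton.ExpSqIntegrable T ν δ (LevySkeleton.lipNorm G)) :
    -- the skeleton map is well defined on the controls of finite cost,
    (∀ g ∈ LevySkeleton.controls T ν,
      ∃! φ : C(Icc (0 : ℝ) T, H), LevySkeleton.IsSkeletonSolution hT ν S f G x₀ g φ) ∧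
    -- it maps each ball of controls onto a compact set,
    (∀ N : ℝ≥0, IsCompact
      (LevySkeleton.skeletonMap hT ν S f G x₀ '' LevySkeleton.controlBall T ν N)) ∧
    -- and the rate function is good.
    LevySkeleton.IsGoodRateFunction (LevySkeleton.rateFunction hT ν S f G x₀) := by
  obtain ⟨l, hl, hb⟩ := hS_bound
  obtain ⟨C, hC, hfC⟩ := hf_growth
  obtain ⟨M, hM, hfM⟩ := hf_mono
  obtain ⟨δ, hδ, he0, he1⟩ := hG_exp
  have hJ := LevySkeleton.isJumpCoeff_toReal hG_meas hG0_meas hG1_meas hG0_sq hG1_sq hδ he0 he1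
  have hK := fun N => hJ.isCompact_image_skeletonMap (x₀ := x₀) hS hl.le hb hf_demi hC.le hfC hM
    hfM hT N
  refine ⟨fun g hg => ?_, hK, LevySkeleton.isGoodRateFunction_of_isCompact hT hK⟩
  obtain ⟨N, hN⟩ := mem_iUnion.1 hg
  exact hJ.existsUnique_isSkeletonSolution hN hS hl.le hb hf_demi hC.le hfC hM hfM hT
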